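/- All functions are real-valued, and functions on subsets of $\mathbb{R}^4$ are identified when they agree almost everywhere. $\dot H^1(\mathbb{R}^4)$ is the space of functions whose Fourier transform is a function $\hat f$ with $|\xi|\hat f\in L^2$. For $R>0$, $\dot H^1(R)$ is the space of restrictions to $\{x\in\mathbb{R}^4:|x|>R\}$ of radial elements of $\dot H^1(\mathbb{R}^4)$, with scalar product $\langle f,g\rangle=\int_{|x|>R}\nabla f\cdot\nabla g\,dx$. It contains $1/r^2$, where $r=|x|$. Let $\pi_R$ be the orthogonal projection of $\dot H^1(R)$ onto the line spanned by $1/r^2$, and let $\pi_R^\perp=\mathrm{Id}-\pi_R$. For $u_0\in\dot H^1(R)$, the solution of $\partial_t^2u_L-\Delta u_L=0$ with data $(u_0,0)$ in the region $\{(t,x)\in[0,\infty)\times\mathbb{R}^4:|x|>R+t\}$ is the restriction to this region of $$\tilde u(t)=\cos(t\sqrt{-\Delta})\,\tilde u_0+\frac{\sin(t\sqrt{-\Delta})}{\sqrt{-\Delta}}\,\tilde u_1 ,$$ where $(\tilde u_0,\tilde u_1)\in\dot H^1(\mathbb{R}^4)\times L^2(\mathbb{R}^4)$ is any pair that equals $(u_0,0)$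 on $\{|x|>R\}$ (by finite speed of propagation the restriction does not depend on the choice of the pair). **Proposition.** Let $R>0$, let $u_0\in\dot H^1(R)$ (so $u_0$ is radial), and let $u_L$ be the solution of the free wave equation with data $(u_0,0)$ in $\{(t,x)\in[0,\infty)\times\mathbb{R}^4:|x|>R+t\}$. Then both limits below exist, are finite, and satisfy $$\lim_{t\to\infty}\|\nabla u_L(t)\|^2_{L^2(|x|>t+R)}=\lim_{t\to\infty}\|\partial_tu_L(t)\|^2_{L^2(|x|>t+R)}\ \ge\ \frac{3}{20}\,\|\nabla\pi_R^\perp u_0\|^2_{L^2(|x|>R)} .$$ -/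

import Mathlib

open MeasureTheory Filter Topology
open scoped FourierTransform SchwartzMap ENNReal NNReal ContDiff

noncomputable section

namespace ExteriorWave

/-- The space `ℝ⁴` with its Euclidean norm. -/
abbrev E4 := EuclideanSpace ℝ (Fin 4)

/-- The exterior region `{x ∈ ℝ⁴ : |x| > ρ}`. -/
def ext (ρ : ℝ) : Set E4 := {x | ρ < ‖x‖}

/-- Radial symmetry (of a class of functions modulo null sets). -/
def IsRadial (f : E4 → ℝ) : Prop :=
  ∃ p : ℝ → ℝ, ∀ᵐ x : E4, f x = p ‖x‖

/-- `F` is the Fourier transform of `f` in the sense of tempered distributions, where `f` and `F`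
are functions that can be integrated against every Schwartz function. The normalization is
`𝓕 φ ξ = ∫ exp (-2 π i ⟨x, ξ⟩) φ x dx`, so `-Δ` acts as multiplication by `(2 π |ξ|) ^ 2`. -/
structure HasFourier (f : E4 → ℝ) (F : E4 → ℂ) : Prop where
  integrable_left : ∀ φ : 𝓢(E4, ℂ), Integrable (fun x => (f x : ℂ) * 𝓕 φ x)
  integrable_right : ∀ φ : 𝓢(E4, ℂ), Integrable (fun ξ => F ξ * φ ξ)
  integral_eq : ∀ φ : 𝓢(E4, ℂ), ∫ x, (f x : ℂ) * 𝓕 φ x = ∫ ξ, F ξ * φ ξ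

/-- The homogeneous Sobolev space `Ḣ¹(ℝ⁴)`: the Fourier transform of `f` is a function `F` with
`|ξ| F ∈ L²`. -/
def MemHDot1 (f : E4 → ℝ) : Prop :=
  ∃ F : E4 → ℂ, HasFourier f F ∧ MemLp (fun ξ => (‖ξ‖ : ℂ) * F ξ) 2 volume

/-- The space `Ḣ¹(R)` of restrictions to `{|x| > R}` of radial elements of `Ḣ¹(ℝ⁴)`. Only the
values of `f` in `{|x| > R}` matter. -/
def MemHDot1Ext (R : ℝ) (f : E4 → ℝ) : Prop :=
  ∃ g : E4 → ℝ, MemHDot1 g ∧ IsRadial g ∧ ∀ᵐ x : E4, x ∈ ext R → f x = g x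

/-- `u` is the solution of `∂ₜ² u = Δ u` on `ℝ × ℝ⁴` with data `(u, ∂ₜ u) = (u₀, u₁)` at `t = 0`,
given by `u (t) = cos (t √(-Δ)) u₀ + (sin (t √(-Δ)) / √(-Δ)) u₁`. -/
def IsFreeWave (u₀ u₁ : E4 → ℝ) (u : ℝ → E4 → ℝ) : Prop :=
  ∃ F₀ F₁ : E4 → ℂ, HasFourier u₀ F₀ ∧ HasFourier u₁ F₁ ∧
    ∀ t : ℝ, HasFourier (u t) (fun ξ =>
      (Real.cos (t * (2 * Real.pi * ‖ξ‖)) : ℂ) * F₀ ξ +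
        ((Real.sin (t * (2 * Real.pi * ‖ξ‖)) / (2 * Real.pi * ‖ξ‖) : ℝ) : ℂ) * F₁ ξ)

/-- `u` is the solution of the free wave equation in `{(t, x) : t ≥ 0, |x| > R + t}` with data
`(u₀, u₁)` at `t = 0`: the restriction to that region of a solution on `ℝ × ℝ⁴` whose data lie in
`Ḣ¹(ℝ⁴) × L²(ℝ⁴)` and coincide with `(u₀, u₁)` in `{|x| > R}`. Only the values of `u` in the
region and those of `u₀, u₁` in `{|x| > R}` matter. -/
def IsExteriorFreeWave (R : ℝ) (u₀ u₁ : E4 → ℝ) (u : ℝ → E4 → ℝ) : Prop :=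
  ∃ (v₀ v₁ : E4 → ℝ) (v : ℝ → E4 → ℝ),
    MemHDot1 v₀ ∧ MemLp v₁ 2 volume ∧ IsFreeWave v₀ v₁ v ∧
    (∀ᵐ x : E4, x ∈ ext R → v₀ x = u₀ x) ∧
    (∀ᵐ x : E4, x ∈ ext R → v₁ x = u₁ x) ∧
    ∀ t : ℝ, 0 ≤ t → ∀ᵐ x : E4, x ∈ ext (R + t) → u t x = v t x

/-- `φ` is a test function in the open set `Ω`. -/
structure IsTest (Ω : Set E4) (φ : E4 → ℝ) : Prop where
  smooth : ContDiff ℝ ∞ φ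
  compact : HasCompactSupport φ
  supp : tsupport φ ⊆ Ω

/-- `g` is the weak gradient of `f` in the open set `Ω`. -/
structure IsWeakGrad (Ω : Set E4) (f : E4 → ℝ) (g : E4 → E4) : Prop where
  locInt_fun : LocallyIntegrableOn f Ω
  locInt_grad : LocallyIntegrableOn g Ω
  integral_eq : ∀ φ : E4 → ℝ, IsTest Ω φ →
    ∫ x, f x • gradient φ x = - ∫ x, φ x • g x

open Classical in
/-- The weak gradient `∇ f` in the open set `Ω`, determined almost everywhere in `Ω` (and `0` by
convention if there is none). -/
def weakGrad (Ω : Set E4) (f : E4 → ℝ) : E4 → E4 :=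
  if h : ∃ g, IsWeakGrad Ω f g then h.choose else 0

/-- `w` is the time derivative `∂ₜ u (t)` in the open set `Ω`, in the sense of distributions
in `x`. -/
structure IsTimeDeriv (Ω : Set E4) (u : ℝ → E4 → ℝ) (t : ℝ) (w : E4 → ℝ) : Prop where
  locInt : LocallyIntegrableOn w Ω
  hasDerivAt : ∀ φ : E4 → ℝ, IsTest Ω φ →
    HasDerivAt (fun s => ∫ x, u s x * φ x) (∫ x, w x * φ x) t

open Classical in
/-- The time derivative `∂ₜ u (t)` in the open set `Ω`, determined almost everywhere in `Ω` (and
`0` by convention if there is none). -/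
def timeDeriv (Ω : Set E4) (u : ℝ → E4 → ℝ) (t : ℝ) : E4 → ℝ :=
  if h : ∃ w, IsTimeDeriv Ω u t w then h.choose else 0

/-- `‖∇ f‖²` in `L²(|x| > ρ)`, for the weak gradient of `f` in `{|x| > ρ}`. -/
def gradNormSq (ρ : ℝ) (f : E4 → ℝ) : ℝ≥0∞ :=
  ∫⁻ x in ext ρ, ‖weakGrad (ext ρ) f x‖ₑ ^ 2

/-- `‖∂ₜ u (t)‖²` in `L²(|x| > ρ)`, for the time derivative of `u` in `{|x| > ρ}`. -/
def timeDerivNormSq (ρ : ℝ) (u : ℝ → E4 → ℝ) (t : ℝ) : ℝ≥0∞ :=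
  ∫⁻ x in ext ρ, ‖timeDeriv (ext ρ) u t x‖ₑ ^ 2

/-- The scalar product of `Ḣ¹(R)`, that is `∫ ∇ f · ∇ g` over `{|x| > R}`. -/
def innerHDot1 (R : ℝ) (f g : E4 → ℝ) : ℝ :=
  ∫ x in ext R, inner ℝ (weakGrad (ext R) f x) (weakGrad (ext R) g x)

/-- The function `1 / r²` on `ℝ⁴`. -/
def invSq (x : E4) : ℝ := 1 / ‖x‖ ^ 2

/-- The orthogonal projection `π_R` of `Ḣ¹(R)` onto the line spanned by `1 / r²`. -/
def proj (R : ℝ) (f : E4 → ℝ) (x : E4) : ℝ :=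
  innerHDot1 R f invSq / innerHDot1 R invSq invSq * invSq x

/-- The orthogonal projection `π_R^⊥` of `Ḣ¹(R)` onto the orthogonal complement of `1 / r²`. -/
def projPerp (R : ℝ) (f : E4 → ℝ) (x : E4) : ℝ := f x - proj R f x

end ExteriorWave

end

noncomputable section

namespace ExteriorWave

/-! Everything rests on smooth radial waves U(t, r) at rest for t = 0 and vanishing for r ≥ t + M.
The combination r U_r + 2 U = r⁻¹ (r² U)_r kills 1/r², and an integration by parts shows that ∫ r (r
U_r + 2 U)² dr over r > R at t = 0 is the squared norm of the gradient of the projected data, up to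
the area of the sphere (`gradNormSq_projPerp_test`). Since ∂_r (r U_r + 2 U) = r U_tt, there is a
potential W with W_t = r U_r + 2 U, W_r = r U_t and W = 0 at t = 0. It solves the radial wave
equation in dimension two, with data (0, r U_r + 2 U).

Put V = √r W, so that V_tt - V_rr = V / (4 r²). The quantity Q = √r (V_t - V_r) equals r (r U_r + 2
U) at t = 0, while for large t the integral of Q²/r over the exterior is at most twice the energy,
up to a vanishing error. To compare the two times, Q²/r is weighted by a polynomial in y = √((r -
t)/(r + t)), and a negative multiple of W² is added to the flux. The divergence of the resulting
field is a quadratic form in (Q, W), which is nonnegative as soon as the weight g satisfies the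
Riccati inequality (g/(1 + y²)² - y)² ≤ -g' on [0, 1]. The polynomial `weight` does, is at most 1,
and exceeds 3/5 at y = 1, that is at t = 0 (`weight_sub_sq_le`, `flux_nonneg`,
`integral_source_le`).

The exterior energy decreases, so it has a limit L. Integrating the equation of r^(3/2) U along
incoming characteristics from the edge r = t + M shows that r^(3/2) (U_t + U_r) is O(1/t); hence the
gradient part and the time derivative part both tend to L/2. Altogether 3/5 of the initial quantity
is at most 2 L, which is the factor 3/20 (`IsRadialWave.exists_tendsto`).

For general data the solution is handled by duality. A localized energy identity gives finite speed
of propagation for smooth waves, so the propagators map test functions in {|x| > R + t} to test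
functions in {|x| > R}; therefore the solution, tested outside the cone, only sees the transform F
of one fixed Ḣ¹ extension of u₀ (`IsExteriorFreeWave.extRep`). Plancherel's theorem then produces
the weak gradient and, for t > 0, the time derivative, so the zero defaults of `weakGrad` and
`timeDeriv` never intervene, with L² bounds by |ξ| F that are uniform in time. Radial test functions
are dense for this norm (`exists_test_near`), and the uniform bounds permit exchanging the
approximation with t → ∞ (`exists_limit_of_extRep`). -/

/-- The derivative of `u` in the direction `v`, as a function. -/
def pd {V : Type*} [NormedAddCommGroup V] [NormedSpace ℝ V] (v : V) (u : V → ℝ) : V → ℝ :=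
  fun p => fderiv ℝ u p v

/-! ### Directional derivatives and differentiation of integrals. -/

section DirectionalDerivative

variable {V : Type*} [NormedAddCommGroup V] [NormedSpace ℝ V]

lemma contDiff_pd {u : V → ℝ} (hu : ContDiff ℝ ∞ u) (v : V) : ContDiff ℝ ∞ (pd v u) :=
  (hu.fderiv_right (m := ∞) le_rfl).clm_apply contDiff_const

lemma pd_comm {u : V → ℝ} (hu : ContDiff ℝ ∞ u) (v w : V) : pd v (pd w u) = pd w (pd v u) := by
  have h2 : ∀ a b p, pd a (pd b u) p = fderiv ℝ (fderiv ℝ u) p a b := by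
    intro a b p
    have hd : DifferentiableAt ℝ (fderiv ℝ u) p :=
      ((hu.fderiv_right (m := ∞) le_rfl).differentiable (by simp)) p
    change fderiv ℝ (fun q => fderiv ℝ u q b) p a = _
    rw [fderiv_clm_apply hd (differentiableAt_const b)]
    simp
  funext p
  rw [h2, h2]
  exact (hu.contDiffAt.isSymmSndFDerivAt (by
    rw [minSmoothness_of_isRCLikeNormedField]
    exact WithTop.coe_le_coe.2 (le_top : (2 : ℕ∞) ≤ ⊤))).eq v w

lemma hasDerivAt_comp_curve {u : V → ℝ} (hu : ContDiff ℝ ∞ u) {γ : ℝ → V} {γ' : V} {s : ℝ}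
    (hγ : HasDerivAt γ γ' s) : HasDerivAt (fun s => u (γ s)) (pd γ' u (γ s)) s :=
  (hu.differentiable (by simp) (γ s)).hasFDerivAt.comp_hasDerivAt s hγ

lemma pd_eq_zero_of_eventuallyEq {u : V → ℝ} {p : V} (h : u =ᶠ[𝓝 p] 0) (v : V) :
    pd v u p = 0 := by
  unfold pd
  rw [h.fderiv_eq]
  simp

end DirectionalDerivative

/-- Differentiation under the integral sign over a compact set. -/
lemma hasDerivAt_integral_of_isCompact {X : Type*} [TopologicalSpace X] [MeasurableSpace X]
    [OpensMeasurableSpace X] [SecondCountableTopology X] [T2Space X] {μ : Measure X} {K : Set X}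
    (hK : IsCompact K) (hμ : μ K < ⊤) {k k' : ℝ × X → ℝ} (hk : Continuous k)
    (hk' : Continuous k') (hd : ∀ s x, HasDerivAt (fun s => k (s, x)) (k' (s, x)) s) (s : ℝ) :
    HasDerivAt (fun s => ∫ x in K, k (s, x) ∂μ) (∫ x in K, k' (s, x) ∂μ) s := by
  obtain ⟨C, hC⟩ := ((isCompact_Icc (a := s - 1) (b := s + 1)).prod hK).exists_bound_of_continuousOn
    hk'.continuousOn
  have : IsFiniteMeasure (μ.restrict K) := ⟨by simpa using hμ⟩
  have hs : ∀ f : ℝ × X → ℝ, Continuous f → ∀ s, Continuous fun x => f (s, x) :=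
    fun f hf s => hf.comp (by fun_prop)
  refine (hasDerivAt_integral_of_dominated_loc_of_deriv_le (bound := fun _ => C)
    (F' := fun s x => k' (s, x)) (s := Set.Icc (s - 1) (s + 1)) (Icc_mem_nhds (by simp) (by simp))
    (.of_forall fun s => ((hs k hk s).aestronglyMeasurable)) ?_
    ((hs k' hk' s).aestronglyMeasurable) ?_ (integrable_const C) ?_).2
  · obtain ⟨B, hB⟩ := hK.exists_bound_of_continuousOn (hs k hk s).continuousOn
    refine Integrable.of_bound (hs k hk s).aestronglyMeasurable B ?_
    filter_upwards [ae_restrict_mem hK.measurableSet] with x hx using hB x hx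
  · filter_upwards [ae_restrict_mem hK.measurableSet] with x hx s' hs'
    exact hC (s', x) ⟨hs', hx⟩
  · exact .of_forall fun x s' _ => hd s' x

/-- The squared positive part is C¹, unlike the positive part itself; it serves as the cutoff of the
localized energy. -/
lemma hasDerivAt_max_zero_sq (z : ℝ) : HasDerivAt (fun z : ℝ => (max z 0) ^ 2) (2 * max z 0) z := by
  rcases lt_trichotomy z 0 with h | h | h
  · have : (fun z : ℝ => (max z 0) ^ 2) =ᶠ[𝓝 z] fun _ => 0 := by
      filter_upwards [gt_mem_nhds h] with y hy
      simp [max_eq_right hy.le]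
    rw [max_eq_right h.le, mul_zero]
    exact (hasDerivAt_const z (0 : ℝ)).congr_of_eventuallyEq this
  · subst h
    have h1 : (fun z : ℝ => (max z 0) ^ 2) =O[𝓝 0] fun z => z ^ 2 := by
      refine Asymptotics.IsBigO.of_bound 1 (.of_forall fun z => ?_)
      rw [one_mul, norm_pow, norm_pow]
      gcongr
      rcases le_total z 0 with hz | hz
      · rw [max_eq_right hz]; simp
      · rw [max_eq_left hz]
    have := (h1.trans_isLittleO (by simpa using
      (Asymptotics.isLittleO_pow_pow (𝕜 := ℝ) (m := 1) (n := 2) (by norm_num))))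
    rw [hasDerivAt_iff_isLittleO]
    simpa using this
  · have : (fun z : ℝ => (max z 0) ^ 2) =ᶠ[𝓝 z] fun z => z ^ 2 := by
      filter_upwards [lt_mem_nhds h] with y hy
      simp [max_eq_left hy.le]
    rw [max_eq_left h.le]
    simpa using (hasDerivAt_pow 2 z).congr_of_eventuallyEq this

/-! ### Finite speed of propagation for smooth waves. -/

/-- The direction of time. -/
abbrev et : ℝ × E4 := (1, 0)

/-- The coordinate directions of space. -/
abbrev es (i : Fin 4) : ℝ × E4 := (0, EuclideanSpace.single i 1)

/-- Smooth solutions of the free wave equation on `ℝ × ℝ⁴`. -/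
structure IsSmoothWave (u : ℝ × E4 → ℝ) : Prop where
  smooth : ContDiff ℝ ∞ u
  wave : ∀ p, pd et (pd et u) p = ∑ i, pd (es i) (pd (es i) u) p

/-- The energy density of `u`. -/
def energyDensity (u : ℝ × E4 → ℝ) (p : ℝ × E4) : ℝ :=
  (pd et u p ^ 2 + ∑ i, pd (es i) u p ^ 2) / 2

/-- A smooth substitute for `‖x - x₀‖`. -/
def softDist (x₀ : E4) (ε : ℝ) (x : E4) : ℝ := √(‖x - x₀‖ ^ 2 + ε ^ 2)

lemma softDist_pos {x₀ : E4} {ε : ℝ} (hε : 0 < ε) (x : E4) : 0 < softDist x₀ ε x :=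
  Real.sqrt_pos.2 (by positivity)

lemma norm_le_softDist (x₀ : E4) (ε : ℝ) (x : E4) : ‖x - x₀‖ ≤ softDist x₀ ε x :=
  Real.le_sqrt_of_sq_le (by nlinarith [sq_nonneg ε])

lemma hasFDerivAt_softDist {x₀ : E4} {ε : ℝ} (hε : 0 < ε) (x : E4) :
    HasFDerivAt (softDist x₀ ε) ((1 / softDist x₀ ε x) • innerSL ℝ (x - x₀)) x := by
  have h1 : HasFDerivAt (fun x : E4 => ‖x - x₀‖ ^ 2 + ε ^ 2) (2 • innerSL ℝ (x - x₀)) x := by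
    have := ((hasFDerivAt_id x).sub_const x₀).norm_sq.add_const (ε ^ 2)
    simpa using this
  have h2 := h1.sqrt (by positivity)
  convert! h2 using 1
  ext v
  have := (softDist_pos (x₀ := x₀) hε x).ne'
  unfold softDist at this ⊢
  simp
  field_simp

lemma continuous_softDist (x₀ : E4) (ε : ℝ) : Continuous (softDist x₀ ε) := by
  unfold softDist; fun_prop

/-- The flux of energy in a direction of length at most one is bounded by the energy density: expand
the nonnegative sum of the (b i + y i / ψ * a)². Unit propagation speed enters here. -/
lemma sum_mul_inner_le (a : ℝ) (b : Fin 4 → ℝ) (y : E4) (ψ : ℝ) (hψ : 0 < ψ) (hy : ‖y‖ ≤ ψ) :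
    -(∑ i, y i / ψ * (a * b i)) ≤ (a ^ 2 + ∑ i, b i ^ 2) / 2 := by
  have h1 : ∑ i, (y i / ψ) ^ 2 ≤ 1 := by
    have : ∑ i, y i ^ 2 ≤ ψ ^ 2 := by
      have := EuclideanSpace.real_norm_sq_eq y
      rw [← this]; gcongr
    simp_rw [div_pow]
    rw [← Finset.sum_div]
    exact div_le_one_of_le₀ this (by positivity)
  have h2 : 0 ≤ ∑ i, (b i + y i / ψ * a) ^ 2 := Finset.sum_nonneg fun i _ => sq_nonneg _
  have h3 : ∑ i, (b i + y i / ψ * a) ^ 2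
      = ∑ i, b i ^ 2 + 2 * ∑ i, y i / ψ * (a * b i) + a ^ 2 * ∑ i, (y i / ψ) ^ 2 := by
    rw [Finset.mul_sum, Finset.mul_sum, ← Finset.sum_add_distrib, ← Finset.sum_add_distrib]
    exact Finset.sum_congr rfl fun i _ => by ring
  nlinarith [mul_le_mul_of_nonneg_left h1 (sq_nonneg a)]

lemma continuous_energyDensity {u : ℝ × E4 → ℝ} (hu : ContDiff ℝ ∞ u) :
    Continuous (energyDensity u) := by
  have h1 := (contDiff_pd hu et).continuous
  have h2 := fun i => (contDiff_pd hu (es i)).continuous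
  unfold energyDensity
  fun_prop

/-- Finite speed of propagation for smooth solutions. -/
theorem IsSmoothWave.eq_zero_of_ball {u : ℝ × E4 → ℝ} (hu : IsSmoothWave u) {x₀ : E4} {ρ : ℝ}
    (h0 : ∀ x ∈ Metric.ball x₀ ρ, u (0, x) = 0)
    (h1 : ∀ x ∈ Metric.ball x₀ ρ, pd et u (0, x) = 0) {t : ℝ} (ht : 0 ≤ t) (htρ : t < ρ) :
    u (t, x₀) = 0 := by
  -- The softened distance equals ε at x₀, so that ρ - s - ε is still positive at x₀ for every s ≤
  -- t.
  set ε := (ρ - t) / 2 with hεdef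
  have hε : 0 < ε := by rw [hεdef]; linarith
  have hsm := hu.smooth
  set ψ := softDist x₀ ε with hψ
  have hψc : Continuous ψ := continuous_softDist x₀ ε
  set m : ℝ × E4 → ℝ := fun p => max (ρ - p.1 - ψ p.2) 0 with hm
  have hmc : Continuous m := by fun_prop
  set e := energyDensity u with he
  have hec : Continuous e := continuous_energyDensity hsm
  have hpc : ∀ v, Continuous (pd v u) := fun v => (contDiff_pd hsm v).continuous
  have hppc : ∀ v w, Continuous (pd v (pd w u)) :=
    fun v w => (contDiff_pd (contDiff_pd hsm w) v).continuous
  set K := Metric.closedBall x₀ ρ with hK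
  have hKc : IsCompact K := isCompact_closedBall x₀ ρ
  have hsupp : ∀ s, 0 ≤ s → ∀ x, x ∉ K → m (s, x) = 0 := by
    intro s hs x hx
    have h1 := norm_le_softDist x₀ ε x
    have h2 : ρ < ‖x - x₀‖ := by simpa [hK, dist_eq_norm] using hx
    exact max_eq_right (by simp only; linarith)
  -- time derivative of the localized energy
  set k : ℝ × E4 → ℝ := fun p => m p ^ 2 * e p with hk
  set k' : ℝ × E4 → ℝ := fun p => -(2 * m p) * e p +
    m p ^ 2 * (pd et u p * pd et (pd et u) p + ∑ i, pd (es i) u p * pd et (pd (es i) u) p) with hk'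
  have hline : ∀ s (x : E4), HasDerivAt (fun s : ℝ => ((s, x) : ℝ × E4)) et s := fun s x =>
    (hasDerivAt_id s).prodMk (hasDerivAt_const s x)
  have hkd : ∀ s x, HasDerivAt (fun s => k (s, x)) (k' (s, x)) s := by
    intro s x
    have hm2 : HasDerivAt (fun s => m (s, x) ^ 2) (-(2 * m (s, x))) s := by
      have h := (hasDerivAt_max_zero_sq (ρ - s - ψ x)).comp s
        (((hasDerivAt_id s).const_sub ρ).sub_const (ψ x))
      convert! h using 1
      simp [hm]
    have he2 : HasDerivAt (fun s => e (s, x)) (pd et u (s, x) * pd et (pd et u) (s, x)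
        + ∑ i, pd (es i) u (s, x) * pd et (pd (es i) u) (s, x)) s := by
      have ha : ∀ v, HasDerivAt (fun s => pd v u (s, x) ^ 2)
          (2 * (pd v u (s, x) * pd et (pd v u) (s, x))) s := by
        intro v
        have := (hasDerivAt_comp_curve (contDiff_pd hsm v) (hline s x)).pow 2
        convert! this using 1
        ring
      have h := ((ha et).add (HasDerivAt.fun_sum (u := Finset.univ) fun i _ => ha (es i))).div_const 2
      convert! h using 1
      rw [← Finset.mul_sum]
      ring
    exact hm2.mul he2
  have hE := hasDerivAt_integral_of_isCompact (μ := volume) hKc hKc.measure_lt_top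
    (k := k) (k' := k') (by fun_prop) (by fun_prop) hkd
  have hneg : ∀ s, 0 ≤ s → ∫ x in K, k' (s, x) ≤ 0 := by
    intro s hs
    have hcs : ∀ f : E4 → ℝ, Continuous f → (∀ x, x ∉ K → f x = 0) → Integrable f :=
      fun f hf hz => hf.integrable_of_hasCompactSupport
        (HasCompactSupport.intro hKc hz)
    -- integration by parts
    have hibp : ∀ i, ∫ x, m (s, x) ^ 2 * pd et u (s, x) * pd (es i) (pd (es i) u) (s, x)
        = -∫ x, (-(2 * m (s, x)) * ((x - x₀) i / ψ x) * pd et u (s, x)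
          + m (s, x) ^ 2 * pd (es i) (pd et u) (s, x)) * pd (es i) u (s, x) := by
      intro i
      have hx : ∀ x, HasFDerivAt (fun x : E4 => ((s, x) : ℝ × E4))
        (ContinuousLinearMap.inr ℝ ℝ E4) x := fun x => by
          exact (hasFDerivAt_const s x).prodMk (hasFDerivAt_id x)
      have hsl : ∀ (f : ℝ × E4 → ℝ), ContDiff ℝ ∞ f → ∀ x, HasFDerivAt (fun x => f (s, x))
          ((fderiv ℝ f (s, x)).comp (ContinuousLinearMap.inr ℝ ℝ E4)) x := fun f hf x =>
        (hf.differentiable (by simp) _).hasFDerivAt.comp x (hx x)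
      have hm2 : ∀ x, HasFDerivAt (fun x => m (s, x) ^ 2)
          (-(2 * m (s, x)) • ((1 / ψ x) • innerSL ℝ (x - x₀))) x := by
        intro x
        have h := (hasDerivAt_max_zero_sq (ρ - s - ψ x)).comp_hasFDerivAt x
          ((hasFDerivAt_softDist (x₀ := x₀) hε x).const_sub (ρ - s))
        convert! h using 1
        rw [smul_neg, neg_smul]
      have hf : ∀ x, HasFDerivAt (fun x => m (s, x) ^ 2 * pd et u (s, x)) _ x :=
        fun x => (hm2 x).mul (hsl (pd et u) (contDiff_pd hsm et) x)
      have hg := hsl (pd (es i) u) (contDiff_pd hsm (es i))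
      have hf' : ∀ x, fderiv ℝ (fun x => m (s, x) ^ 2 * pd et u (s, x)) x
          (EuclideanSpace.single i 1) = -(2 * m (s, x)) * ((x - x₀) i / ψ x) * pd et u (s, x)
          + m (s, x) ^ 2 * pd (es i) (pd et u) (s, x) := by
        intro x
        rw [(hf x).fderiv]
        simp [pd, EuclideanSpace.inner_single_right]
        ring
      have hg' : ∀ x, fderiv ℝ (fun x => pd (es i) u (s, x)) x
          (EuclideanSpace.single i 1) = pd (es i) (pd (es i) u) (s, x) := by
        intro x
        rw [(hg x).fderiv]
        simp [pd]
      have hψ0 : ∀ x, ψ x ≠ 0 := fun x => (softDist_pos hε x).ne'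
      have hdc : Continuous fun x : E4 => (x - x₀) i / ψ x :=
        Continuous.div (by fun_prop) hψc hψ0
      have := integral_mul_fderiv_eq_neg_fderiv_mul_of_integrable (μ := (volume : Measure E4))
        (f := fun x => m (s, x) ^ 2 * pd et u (s, x)) (g := fun x => pd (es i) u (s, x))
        (v := EuclideanSpace.single i 1) ?_ ?_ ?_ (fun x _ => (hf x).differentiableAt)
        (fun x _ => (hg x).differentiableAt)
      · simpa only [hf', hg'] using this
      · simp only [hf']
        refine hcs _ (by fun_prop) fun x hx => ?_
        simp [hsupp s hs x hx]
      · simp only [hg']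
        refine hcs _ (by fun_prop) fun x hx => ?_
        simp [hsupp s hs x hx]
      · refine hcs _ (by fun_prop) fun x hx => ?_
        simp [hsupp s hs x hx]
    have hψ0 : ∀ x, ψ x ≠ 0 := fun x => (softDist_pos hε x).ne'
    have hdc : ∀ i, Continuous fun x : E4 => (x - x₀) i / ψ x := fun i =>
      Continuous.div (by fun_prop) hψc hψ0
    have hfull : ∫ x in K, k' (s, x) = ∫ x, k' (s, x) :=
      setIntegral_eq_integral_of_forall_compl_eq_zero fun x hx => by
        simp [hk', hsupp s hs x hx]
    have hi1 : ∀ i, Integrable fun x =>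
        m (s, x) ^ 2 * pd et u (s, x) * pd (es i) (pd (es i) u) (s, x) := fun i =>
      hcs _ (by fun_prop) fun x hx => by simp [hsupp s hs x hx]
    have hi2 : ∀ i, Integrable fun x => (-(2 * m (s, x)) * ((x - x₀) i / ψ x) * pd et u (s, x)
          + m (s, x) ^ 2 * pd (es i) (pd et u) (s, x)) * pd (es i) u (s, x) := fun i =>
      hcs _ (by have := hdc i; fun_prop) fun x hx => by simp [hsupp s hs x hx]
    have hi4 : ∀ i, Integrable fun x =>
        m (s, x) ^ 2 * pd et u (s, x) * pd (es i) (pd (es i) u) (s, x) +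
        (-(2 * m (s, x)) * ((x - x₀) i / ψ x) * pd et u (s, x)
          + m (s, x) ^ 2 * pd (es i) (pd et u) (s, x)) * pd (es i) u (s, x) :=
      fun i => (hi1 i).add (hi2 i)
    have hsum : ∫ x, ∑ i, (m (s, x) ^ 2 * pd et u (s, x) * pd (es i) (pd (es i) u) (s, x) +
        (-(2 * m (s, x)) * ((x - x₀) i / ψ x) * pd et u (s, x)
          + m (s, x) ^ 2 * pd (es i) (pd et u) (s, x)) * pd (es i) u (s, x)) = 0 := by
      rw [integral_finsetSum _ fun i _ => hi4 i]
      refine Finset.sum_eq_zero fun i _ => ?_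
      rw [integral_add (hi1 i) (hi2 i), hibp i]
      ring
    have hi3 : Integrable fun x => k' (s, x) :=
      hcs _ (by fun_prop) fun x hx => by simp [hk', hsupp s hs x hx]
    -- Subtracting a sum of divergences of zero integral leaves, thanks to the wave equation, only
    -- terms containing a derivative of the cutoff; their sum is pointwise nonpositive.
    rw [hfull, show ∫ x, k' (s, x) = ∫ x, (k' (s, x) - _) by
      rw [integral_sub hi3 (integrable_finsetSum _ fun i _ => hi4 i), hsum, sub_zero]]
    · refine integral_nonpos fun x => ?_
      have hw := hu.wave (s, x)
      have hm0 : 0 ≤ m (s, x) := le_max_right _ _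
      have hk2 := sum_mul_inner_le (-pd et u (s, x)) (fun i => pd (es i) u (s, x)) (x - x₀) (ψ x)
        (softDist_pos hε x) (norm_le_softDist x₀ ε x)
      simp only [hk', he, energyDensity, hw]
      have e1 : ∀ i, pd (es i) (pd et u) (s, x) = pd et (pd (es i) u) (s, x) := fun i => by
        rw [pd_comm hsm]
      simp only [e1, Pi.zero_apply, Fin.sum_univ_four] at hk2 ⊢
      nlinarith [mul_le_mul_of_nonneg_left hk2 hm0]
  have hanti : AntitoneOn (fun s => ∫ x in K, k (s, x)) (Set.Ici 0) := by
    refine antitoneOn_of_deriv_nonpos (convex_Ici 0)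
      (fun s _ => (hE s).continuousAt.continuousWithinAt)
      (fun s _ => (hE s).differentiableAt.differentiableWithinAt) fun s hs => ?_
    rw [(hE s).deriv]
    rw [interior_Ici] at hs
    exact hneg s (le_of_lt hs)
  have hinit : ∫ x in K, k (0, x) = 0 := by
    refine integral_eq_zero_of_ae (.of_forall fun x => ?_)
    by_cases hx : x ∈ Metric.ball x₀ ρ
    · have : e (0, x) = 0 := by
        have hi : ∀ i, pd (es i) u (0, x) = 0 := by
          intro i
          have hγ : HasDerivAt (fun s : ℝ => ((0, x + s • EuclideanSpace.single i 1) : ℝ × E4))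
              (es i) 0 := by
            have := (hasDerivAt_const (0 : ℝ) (0 : ℝ)).prodMk
              (((hasDerivAt_id (0 : ℝ)).smul_const (EuclideanSpace.single i (1 : ℝ))).const_add x)
            simpa using this
          have h2 := hasDerivAt_comp_curve hsm hγ
          have h3 : (fun s : ℝ => u (0, x + s • EuclideanSpace.single i 1)) =ᶠ[𝓝 0] fun _ => 0 := by
            have hcont : ContinuousAt (fun s : ℝ => x + s • EuclideanSpace.single i (1 : ℝ)) 0 := by
              fun_prop
            have := hcont.eventually_mem (s := Metric.ball x₀ ρ)
              (by simpa using Metric.isOpen_ball.mem_nhds hx)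
            filter_upwards [this] with s hs using h0 _ hs
          have h4 := (h2.congr_of_eventuallyEq h3.symm).unique (hasDerivAt_const 0 (0 : ℝ))
          simpa using h4
        simp [he, energyDensity, hi, h1 x hx]
      simp [hk, this]
    · have hm0 : m (0, x) = 0 := by
        have h1 := norm_le_softDist x₀ ε x
        have h2 : ρ ≤ ‖x - x₀‖ := by simpa [dist_eq_norm] using hx
        exact max_eq_right (by simp only; linarith)
      simp [hk, hm0]
  -- The localized energy stays zero and its density is continuous and nonnegative, so it vanishes
  -- at x₀, where the cutoff is positive. Hence u is constant in time at x₀ up to time t.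
  have hut : ∀ s ∈ Set.Icc 0 t, pd et u (s, x₀) = 0 := by
    intro s hs
    have hz : ∫ x in K, k (s, x) = 0 := by
      refine le_antisymm ?_ (integral_nonneg fun x => ?_)
      · rw [← hinit]
        exact hanti (by simp) hs.1 hs.1
      · simp only [hk, he, energyDensity, Pi.zero_apply]
        positivity
    have hfull : ∫ x in K, k (s, x) = ∫ x, k (s, x) :=
      setIntegral_eq_integral_of_forall_compl_eq_zero fun x hx => by
        simp [hk, hsupp s hs.1 x hx]
    have hkc : Continuous fun x => k (s, x) := by fun_prop
    have hki : Integrable fun x => k (s, x) := hkc.integrable_of_hasCompactSupport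
      (HasCompactSupport.intro hKc fun x hx => by simp [hk, hsupp s hs.1 x hx])
    rw [hfull, integral_eq_zero_iff_of_nonneg (fun x => by
      simp only [hk, he, energyDensity, Pi.zero_apply]; positivity) hki,
      Continuous.ae_eq_iff_eq _ hkc continuous_zero] at hz
    have h := congrFun hz x₀
    have hψx : ψ x₀ = ε := by simp [hψ, softDist, Real.sqrt_sq hε.le]
    have hmpos : 0 < m (s, x₀) := by
      refine lt_max_of_lt_left ?_
      simp only [hψx, hεdef]
      linarith [hs.2]
    have he0 : e (s, x₀) = 0 := by
      simp only [hk, Pi.zero_apply, mul_eq_zero] at h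
      exact h.resolve_left (by positivity)
    have hS : 0 ≤ ∑ i, pd (es i) u (s, x₀) ^ 2 := Finset.sum_nonneg fun i _ => sq_nonneg _
    simp only [he, energyDensity] at he0
    have : pd et u (s, x₀) ^ 2 = 0 := by nlinarith [sq_nonneg (pd et u (s, x₀))]
    simpa using this
  have hfin := constant_of_has_deriv_right_zero (f := fun s => u (s, x₀)) (a := 0) (b := t)
    (hsm.continuous.comp (by fun_prop)).continuousOn (fun s hs => by
      have := hasDerivAt_comp_curve hsm (hline s x₀)
      rw [hut s ⟨hs.1, hs.2.le⟩] at this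
      exact this.hasDerivWithinAt) t ⟨ht, le_rfl⟩
  rw [hfin, h0 x₀ (Metric.mem_ball_self (lt_of_le_of_lt ht htρ))]

/-! ### Smooth waves as Fourier integrals over the light cone. -/

open Real (fourierChar)

/-- Measurable functions all of whose moments are integrable. -/
structure RapidDecay (θ : E4 → ℂ) : Prop where
  meas : AEStronglyMeasurable θ volume
  moment : ∀ n : ℕ, Integrable fun ξ => ‖ξ‖ ^ n * ‖θ ξ‖

lemma RapidDecay.integrable {θ : E4 → ℂ} (h : RapidDecay θ) : Integrable θ := by
  have := h.moment 0
  simp only [pow_zero, one_mul] at this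
  exact (integrable_norm_iff h.meas).1 this

lemma RapidDecay.of_norm_le {θ η : E4 → ℂ} (h : RapidDecay θ) (hη : AEStronglyMeasurable η volume)
    {C : ℝ} (k : ℕ) (hle : ∀ ξ, ‖η ξ‖ ≤ C * (‖ξ‖ ^ k * ‖θ ξ‖)) : RapidDecay η := by
  refine ⟨hη, fun n => ?_⟩
  refine ((h.moment (n + k)).const_mul C).mono'
    ((continuous_norm.pow n).aestronglyMeasurable.mul hη.norm) (.of_forall fun ξ => ?_)
  rw [norm_mul, norm_pow, norm_norm, norm_norm]
  calc ‖ξ‖ ^ n * ‖η ξ‖ ≤ ‖ξ‖ ^ n * (C * (‖ξ‖ ^ k * ‖θ ξ‖)) := by gcongr; exact hle ξ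
    _ = _ := by ring

lemma SchwartzMap.rapidDecay (θ : 𝓢(E4, ℂ)) : RapidDecay θ :=
  ⟨θ.continuous.aestronglyMeasurable, fun n => θ.integrable_pow_mul volume n⟩

/-- The half-wave with phase `σ t ‖ξ‖` and density `θ` on the Fourier side. -/
def halfWave (σ : ℝ) (θ : E4 → ℂ) (p : ℝ × E4) : ℂ :=
  ∫ ξ, fourierChar (-(σ * ‖ξ‖ * p.1 + inner ℝ ξ p.2)) • θ ξ

/-- The density of the derivative of a half-wave in the direction `y`. -/
def halfSymbol (σ : ℝ) (y : ℝ × E4) (θ : E4 → ℂ) (ξ : E4) : ℂ :=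
  -(2 * Real.pi * Complex.I) * ((σ * ‖ξ‖ * y.1 + inner ℝ ξ y.2 : ℝ) : ℂ) * θ ξ

lemma RapidDecay.halfSymbol {θ : E4 → ℂ} (h : RapidDecay θ) (σ : ℝ) (y : ℝ × E4) :
    RapidDecay (halfSymbol σ y θ) := by
  refine h.of_norm_le (C := 2 * Real.pi * (|σ| * |y.1| + ‖y.2‖)) (k := 1) ?_ fun ξ => ?_
  · refine AEStronglyMeasurable.mul (Continuous.aestronglyMeasurable ?_) h.meas
    fun_prop
  · unfold ExteriorWave.halfSymbol
    rw [norm_mul, norm_mul, norm_neg, norm_mul, norm_mul, Complex.norm_I, Complex.norm_real,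
      Complex.norm_real, Real.norm_of_nonneg Real.pi_pos.le, Complex.norm_two, Real.norm_eq_abs]
    have h1 : |σ * ‖ξ‖ * y.1 + inner ℝ ξ y.2| ≤ (|σ| * |y.1| + ‖y.2‖) * ‖ξ‖ := by
      refine (abs_add_le _ _).trans ?_
      have := abs_real_inner_le_norm ξ y.2
      rw [abs_mul, abs_mul, abs_norm]
      linarith
    calc 2 * Real.pi * 1 * |σ * ‖ξ‖ * y.1 + inner ℝ ξ y.2| * ‖θ ξ‖
        ≤ 2 * Real.pi * 1 * ((|σ| * |y.1| + ‖y.2‖) * ‖ξ‖) * ‖θ ξ‖ := by gcongr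
      _ = _ := by ring

/-- The Euclidean inner product as a real bilinear map. -/
def innerForm : E4 →L[ℝ] E4 →L[ℝ] ℝ := innerSL ℝ

/-- The pairing of space-time with its dual. -/
def phaseForm : (ℝ × E4) →L[ℝ] (ℝ × E4) →L[ℝ] ℝ :=
  (ContinuousLinearMap.mul ℝ ℝ).bilinearComp (.fst ℝ ℝ E4) (.fst ℝ ℝ E4) +
    innerForm.bilinearComp (.snd ℝ ℝ E4) (.snd ℝ ℝ E4)

lemma phaseForm_apply (v w : ℝ × E4) : phaseForm v w = v.1 * w.1 + inner ℝ v.2 w.2 := rfl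

/-- The Lebesgue measure on `ℝ⁴`, carried by a light cone. -/
def coneMeasure (σ : ℝ) : Measure (ℝ × E4) := (volume : Measure E4).map fun ξ => (σ * ‖ξ‖, ξ)

lemma measurable_cone (σ : ℝ) : Measurable fun ξ : E4 => ((σ * ‖ξ‖, ξ) : ℝ × E4) := by fun_prop

lemma aestronglyMeasurable_cone {θ : E4 → ℂ} (h : AEStronglyMeasurable θ volume) (σ : ℝ) :
    AEStronglyMeasurable (fun v : ℝ × E4 => θ v.2) (coneMeasure σ) := by
  refine AEStronglyMeasurable.comp_measurable (f := Prod.snd) (g := θ) ?_ measurable_snd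
  rw [coneMeasure, Measure.map_map measurable_snd (measurable_cone σ)]
  have : (Prod.snd ∘ fun ξ : E4 => ((σ * ‖ξ‖, ξ) : ℝ × E4)) = id := rfl
  rwa [this, Measure.map_id]

/-- Seen as the space-time Fourier transform of a density on the cone, a half-wave is jointly smooth
in (t, x) by the general theory, which also gives its derivatives; the nonsmooth phase ‖ξ‖ is
absorbed in the measure. -/
lemma halfWave_eq_fourierIntegral (σ : ℝ) {θ : E4 → ℂ} (h : AEStronglyMeasurable θ volume) :
    halfWave σ θ = VectorFourier.fourierIntegral fourierChar (coneMeasure σ)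
      phaseForm.toLinearMap₁₂ fun v => θ v.2 := by
  funext p
  rw [halfWave, VectorFourier.fourierIntegral, coneMeasure, integral_map]
  · rfl
  · exact (measurable_cone σ).aemeasurable
  · refine AEStronglyMeasurable.fun_smul ?_ (aestronglyMeasurable_cone h σ)
    refine (Real.continuous_fourierChar.comp ?_).aestronglyMeasurable
    change Continuous fun v : ℝ × E4 => -(phaseForm v p)
    fun_prop

lemma RapidDecay.moment_cone {θ : E4 → ℂ} (h : RapidDecay θ) {σ : ℝ} (hσ : |σ| = 1) (n : ℕ) :
    Integrable (fun v : ℝ × E4 => ‖v‖ ^ n * ‖θ v.2‖) (coneMeasure σ) := by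
  rw [coneMeasure, integrable_map_measure]
  · refine (h.moment n).congr (.of_forall fun ξ => ?_)
    simp [Prod.norm_def, hσ]
  · exact (continuous_norm.pow n).aestronglyMeasurable.mul (aestronglyMeasurable_cone h.meas σ).norm
  · exact (measurable_cone σ).aemeasurable

lemma contDiff_halfWave {θ : E4 → ℂ} (h : RapidDecay θ) {σ : ℝ} (hσ : |σ| = 1) :
    ContDiff ℝ ∞ (halfWave σ θ) := by
  rw [halfWave_eq_fourierIntegral σ h.meas]
  exact VectorFourier.contDiff_fourierIntegral (N := ⊤) phaseForm fun n _ => h.moment_cone hσ n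

lemma fderiv_halfWave_apply {θ : E4 → ℂ} (h : RapidDecay θ) {σ : ℝ} (hσ : |σ| = 1)
    (p y : ℝ × E4) : fderiv ℝ (halfWave σ θ) p y = halfWave σ (halfSymbol σ y θ) p := by
  have h0 : Integrable (fun v : ℝ × E4 => θ v.2) (coneMeasure σ) := by
    have := h.moment_cone hσ 0
    simp only [pow_zero, one_mul] at this
    exact (integrable_norm_iff (aestronglyMeasurable_cone h.meas σ)).1 this
  have h1 : Integrable (fun v : ℝ × E4 => ‖v‖ * ‖θ v.2‖) (coneMeasure σ) := by
    simpa using h.moment_cone hσ 1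
  have hi : Integrable (fun v => VectorFourier.fourierSMulRight phaseForm (fun v => θ v.2) v)
      (coneMeasure σ) := by
    refine (h1.const_mul (2 * Real.pi * ‖phaseForm‖)).mono'
      (aestronglyMeasurable_cone h.meas σ).fourierSMulRight (.of_forall fun v => ?_)
    exact (VectorFourier.norm_fourierSMulRight_le phaseForm _ v).trans_eq (by ring)
  rw [halfWave_eq_fourierIntegral σ h.meas, VectorFourier.fderiv_fourierIntegral phaseForm h0 h1,
    halfWave, VectorFourier.fourierIntegral, ContinuousLinearMap.integral_apply, coneMeasure,
    integral_map (measurable_cone σ).aemeasurable]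
  · refine integral_congr_ae (.of_forall fun ξ => ?_)
    simp [halfSymbol, phaseForm_apply, Circle.smul_def]
    ring
  · have hm : AEStronglyMeasurable (fun v : ℝ × E4 => fourierChar (-(phaseForm v p)) •
        VectorFourier.fourierSMulRight phaseForm (fun v => θ v.2) v) (coneMeasure σ) := by
      refine AEStronglyMeasurable.fun_smul ?_ (aestronglyMeasurable_cone h.meas σ).fourierSMulRight
      refine (Real.continuous_fourierChar.comp ?_).aestronglyMeasurable
      fun_prop
    exact hm.apply_continuousLinearMap y
  · exact (VectorFourier.fourierIntegral_convergent_iff Real.continuous_fourierChar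
      (by apply phaseForm.continuous₂) p).2 hi

lemma pd_comp_halfWave (ℓ : ℂ →L[ℝ] ℝ) {θ : E4 → ℂ} (h : RapidDecay θ) {σ : ℝ} (hσ : |σ| = 1)
    (y : ℝ × E4) : pd y (fun p => ℓ (halfWave σ θ p)) =
      fun p => ℓ (halfWave σ (halfSymbol σ y θ) p) := by
  funext p
  have h1 := ((contDiff_halfWave h hσ).differentiable (by simp) p).hasFDerivAt
  have h2 := ℓ.hasFDerivAt.comp p h1
  rw [pd, ← fderiv_halfWave_apply h hσ]
  change fderiv ℝ (ℓ ∘ halfWave σ θ) p y = _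
  rw [h2.fderiv]
  rfl

lemma integrable_halfWave (σ : ℝ) {θ : E4 → ℂ} (h : Integrable θ) (p : ℝ × E4) :
    Integrable fun ξ => fourierChar (-(σ * ‖ξ‖ * p.1 + inner ℝ ξ p.2)) • θ ξ := by
  refine h.norm.mono' ?_ (.of_forall fun ξ => by simp)
  refine AEStronglyMeasurable.fun_smul ?_ h.1
  exact (Real.continuous_fourierChar.comp (by fun_prop)).aestronglyMeasurable

/-- Two derivatives multiply the density by (σ‖ξ‖)² in time and by the ξ i ² in space, with the same
factor, and the cone satisfies (σ‖ξ‖)² = ∑ ξ i ². The functional ℓ stands for the real or the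
imaginary part. -/
lemma isSmoothWave_halfWave (ℓ : ℂ →L[ℝ] ℝ) {θ : E4 → ℂ} (h : RapidDecay θ) {σ : ℝ}
    (hσ : |σ| = 1) : IsSmoothWave fun p => ℓ (halfWave σ θ p) := by
  refine ⟨ℓ.contDiff.comp (contDiff_halfWave h hσ), fun p => ?_⟩
  have h2 : ∀ y, pd y (pd y fun p => ℓ (halfWave σ θ p)) p =
      ℓ (halfWave σ (halfSymbol σ y (halfSymbol σ y θ)) p) := fun y => by
    rw [pd_comp_halfWave ℓ h hσ, pd_comp_halfWave ℓ (h.halfSymbol σ y) hσ]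
  simp only [h2]
  rw [← map_sum]
  congr 1
  unfold halfWave
  rw [← integral_finsetSum _ fun i _ => integrable_halfWave σ
    ((h.halfSymbol σ (es i)).halfSymbol σ (es i)).integrable p]
  refine integral_congr_ae (.of_forall fun ξ => ?_)
  simp only
  rw [← Finset.smul_sum]
  congr 1
  have hn : ‖ξ‖ ^ 2 = ∑ i, ξ i ^ 2 := EuclideanSpace.real_norm_sq_eq ξ
  have hs : σ ^ 2 = 1 := by rw [← sq_abs, hσ, one_pow]
  have hn' : ((σ * ‖ξ‖ : ℝ) : ℂ) ^ 2 = ∑ i, ((ξ i : ℝ) : ℂ) ^ 2 := by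
    rw [← Complex.ofReal_pow, mul_pow, hs, one_mul, hn]
    push_cast; rfl
  simp only [halfSymbol, mul_one, inner_zero_right, add_zero, mul_zero, zero_add,
    EuclideanSpace.inner_single_right, one_mul, conj_trivial]
  calc _ = (-(2 * Real.pi * Complex.I)) ^ 2 * ((σ * ‖ξ‖ : ℝ) : ℂ) ^ 2 * θ ξ := by ring
    _ = _ := by
        rw [hn', Finset.mul_sum, Finset.sum_mul]
        exact Finset.sum_congr rfl fun i _ => by ring

lemma IsSmoothWave.add {u v : ℝ × E4 → ℝ} (hu : IsSmoothWave u) (hv : IsSmoothWave v) :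
    IsSmoothWave fun p => u p + v p := by
  have h1 : ∀ (f g : ℝ × E4 → ℝ), ContDiff ℝ ∞ f → ContDiff ℝ ∞ g → ∀ y,
      pd y (fun p => f p + g p) = fun p => pd y f p + pd y g p := by
    intro f g hf hg y
    funext p
    unfold pd
    rw [fderiv_fun_add (hf.differentiable (by simp) p) (hg.differentiable (by simp) p)]
    rfl
  refine ⟨hu.smooth.add hv.smooth, fun p => ?_⟩
  simp only [h1 u v hu.smooth hv.smooth,
    h1 _ _ (contDiff_pd hu.smooth _) (contDiff_pd hv.smooth _), hu.wave, hv.wave,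
    Finset.sum_add_distrib]

/-- The solution with data `(𝓕 θ, 0)`. -/
def cosWave (θ : E4 → ℂ) (p : ℝ × E4) : ℂ :=
  halfWave 1 (fun ξ => θ ξ / 2) p + halfWave (-1) (fun ξ => θ ξ / 2) p

lemma RapidDecay.half {θ : E4 → ℂ} (h : RapidDecay θ) : RapidDecay fun ξ => θ ξ / 2 :=
  h.of_norm_le (C := 1 / 2) (k := 0) (h.integrable.div_const 2).1 fun ξ => by simp; linarith

/-- The multiplier of the half-wave sum. -/
lemma cosWave_eq {θ : E4 → ℂ} (h : Integrable θ) (t : ℝ) :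
    (fun x => cosWave θ (t, x)) =
      𝓕 fun ξ => (Real.cos (t * (2 * Real.pi * ‖ξ‖)) : ℂ) * θ ξ := by
  funext x
  have h2 : Integrable fun ξ => θ ξ / 2 := h.div_const 2
  unfold cosWave halfWave
  rw [Real.fourier_eq, ← integral_add (integrable_halfWave 1 h2 _) (integrable_halfWave (-1) h2 _)]
  refine integral_congr_ae (.of_forall fun ξ => ?_)
  simp only [Circle.smul_def, smul_eq_mul, Real.fourierChar_apply, Complex.ofReal_cos,
    Complex.cos, mul_neg]
  have f1 : Complex.exp (((-(2 * Real.pi * (1 * ‖ξ‖ * t + inner ℝ ξ x)) : ℝ) : ℂ) * Complex.I) =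
      Complex.exp (((-(2 * Real.pi * inner ℝ ξ x) : ℝ) : ℂ) * Complex.I) *
        Complex.exp (-((t * (2 * Real.pi * ‖ξ‖) : ℝ) : ℂ) * Complex.I) := by
    rw [← Complex.exp_add]; congr 1; push_cast; ring
  have f2 : Complex.exp (((-(2 * Real.pi * (-1 * ‖ξ‖ * t + inner ℝ ξ x)) : ℝ) : ℂ) * Complex.I) =
      Complex.exp (((-(2 * Real.pi * inner ℝ ξ x) : ℝ) : ℂ) * Complex.I) *
        Complex.exp (((t * (2 * Real.pi * ‖ξ‖) : ℝ) : ℂ) * Complex.I) := by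
    rw [← Complex.exp_add]; congr 1; push_cast; ring
  rw [f1, f2]
  ring

lemma isSmoothWave_cosWave (ℓ : ℂ →L[ℝ] ℝ) {θ : E4 → ℂ} (h : RapidDecay θ) :
    IsSmoothWave fun p => ℓ (cosWave θ p) := by
  simp only [cosWave, map_add]
  exact (isSmoothWave_halfWave ℓ h.half (by simp)).add (isSmoothWave_halfWave ℓ h.half (by simp))

/-- The two half-waves carry opposite time frequencies, so their time derivatives cancel at t = 0.
-/
lemma pd_et_cosWave_zero (ℓ : ℂ →L[ℝ] ℝ) {θ : E4 → ℂ} (h : RapidDecay θ) (x : E4) :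
    pd et (fun p => ℓ (cosWave θ p)) (0, x) = 0 := by
  have h1 := (isSmoothWave_halfWave ℓ h.half (σ := 1) (by simp)).smooth
  have h2 := (isSmoothWave_halfWave ℓ h.half (σ := -1) (by simp)).smooth
  simp only [cosWave, map_add]
  unfold pd
  rw [fderiv_fun_add (h1.differentiable (by simp) _) (h2.differentiable (by simp) _)]
  change pd et _ (0, x) + pd et _ (0, x) = 0
  rw [pd_comp_halfWave ℓ h.half (by simp), pd_comp_halfWave ℓ h.half (by simp), ← map_add]
  unfold halfWave
  rw [← integral_add (integrable_halfWave _ (h.half.halfSymbol _ _).integrable _)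
    (integrable_halfWave _ (h.half.halfSymbol _ _).integrable _)]
  rw [integral_eq_zero_of_ae, map_zero]
  refine .of_forall fun ξ => ?_
  simp [halfSymbol, Circle.smul_def]

/-- Finite speed of propagation for the cosine propagator. -/
lemma cosWave_eq_zero_of_ball {θ : E4 → ℂ} (h : RapidDecay θ) {x₀ : E4} {ρ : ℝ}
    (h0 : ∀ x ∈ Metric.ball x₀ ρ, 𝓕 θ x = 0) {t : ℝ} (ht : 0 ≤ t) (htρ : t < ρ) :
    cosWave θ (t, x₀) = 0 := by
  have hz : ∀ x, cosWave θ (0, x) = 𝓕 θ x := fun x => by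
    have := congrFun (cosWave_eq h.integrable 0) x
    simpa using this
  have hℓ : ∀ ℓ : ℂ →L[ℝ] ℝ, ℓ (cosWave θ (t, x₀)) = 0 := fun ℓ =>
    (isSmoothWave_cosWave ℓ h).eq_zero_of_ball (x₀ := x₀) (ρ := ρ)
      (fun x hx => by rw [hz, h0 x hx, map_zero]) (fun x _ => pd_et_cosWave_zero ℓ h x) ht htρ
  exact Complex.ext (hℓ Complex.reCLM) (hℓ Complex.imCLM)

/-! ### Duality: propagation of test functions. -/

lemma IsTest.exists_fourier_eq {Ω : Set E4} {φ : E4 → ℝ} (hφ : IsTest Ω φ) :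
    ∃ θ : 𝓢(E4, ℂ), ∀ x, 𝓕 θ x = (φ x : ℂ) := by
  have h1 : HasCompactSupport fun x => (φ x : ℂ) := hφ.compact.comp_left Complex.ofReal_zero
  have h2 : ContDiff ℝ ∞ fun x => (φ x : ℂ) := Complex.ofRealCLM.contDiff.comp hφ.smooth
  refine ⟨𝓕⁻ (h1.toSchwartzMap h2), fun x => ?_⟩
  rw [FourierTransform.fourier_fourierInv_eq]
  rfl

/-- A bounded continuous multiple of a Schwartz function is Schwartz if its Fourier transform has
compact support. -/
lemma exists_schwartz_of_hasCompactSupport_fourier {m : E4 → ℝ} (hm : Continuous m) {C : ℝ}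
    (hC : ∀ ξ, |m ξ| ≤ C) (θ : 𝓢(E4, ℂ))
    (hcs : HasCompactSupport (𝓕 fun ξ => (m ξ : ℂ) * θ ξ)) :
    ∃ θ' : 𝓢(E4, ℂ), (∀ ξ, θ' ξ = m ξ * θ ξ) ∧ ∀ x, 𝓕 θ' x = 𝓕 (fun ξ => (m ξ : ℂ) * θ ξ) x := by
  have hc : Continuous fun ξ => (m ξ : ℂ) * θ ξ := by
    have := θ.continuous; fun_prop
  have hr : RapidDecay fun ξ => (m ξ : ℂ) * θ ξ :=
    (SchwartzMap.rapidDecay θ).of_norm_le hc.aestronglyMeasurable (C := C) (k := 0) fun ξ => by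
      rw [norm_mul, Complex.norm_real, Real.norm_eq_abs, pow_zero, one_mul]
      gcongr
      exact hC ξ
  have hs : ContDiff ℝ ∞ (𝓕 fun ξ => (m ξ : ℂ) * θ ξ) :=
    Real.contDiff_fourier (N := ⊤) fun n _ => hr.moment n
  -- Smoothness of the multiplier is not needed: the transform of the product is smooth because the
  -- product decays, and has compact support, so it is Schwartz; inverting it recovers the product.
  refine ⟨𝓕⁻ (hcs.toSchwartzMap hs), fun ξ => ?_, fun x => ?_⟩
  · have h1 : Integrable (𝓕 fun ξ => (m ξ : ℂ) * θ ξ) :=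
      hs.continuous.integrable_of_hasCompactSupport hcs
    have h2 := congrFun (hc.fourierInv_fourier_eq hr.integrable h1) ξ
    rw [SchwartzMap.fourierInv_coe]
    exact h2
  · rw [FourierTransform.fourier_fourierInv_eq]
    rfl

lemma continuous_cos_mult (t : ℝ) : Continuous fun ξ : E4 => Real.cos (t * (2 * Real.pi * ‖ξ‖)) := by
  fun_prop

/-- The multiplier `sin (t √(-Δ)) / √(-Δ)`, as an average of cosines. -/
def sincMult (t : ℝ) (ξ : E4) : ℝ := ∫ s in (0 : ℝ)..t, Real.cos (s * (2 * Real.pi * ‖ξ‖))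

lemma continuous_sincMult (t : ℝ) : Continuous (sincMult t) := by
  unfold sincMult
  refine intervalIntegral.continuous_parametric_intervalIntegral_of_continuous' ?_ 0 t
  unfold Function.uncurry
  fun_prop

lemma abs_sincMult_le (t : ℝ) (ξ : E4) : |sincMult t ξ| ≤ |t| := by
  have := intervalIntegral.norm_integral_le_of_norm_le_const (a := 0) (b := t) (C := 1)
    (f := fun s => Real.cos (s * (2 * Real.pi * ‖ξ‖))) fun s _ => Real.abs_cos_le_one _
  simpa [sincMult] using this

/-- The origin is excluded because there the quotient is 0 by convention, while the integral of the
cosines is t. -/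
lemma sincMult_eq (t : ℝ) {ξ : E4} (hξ : ξ ≠ 0) :
    sincMult t ξ = Real.sin (t * (2 * Real.pi * ‖ξ‖)) / (2 * Real.pi * ‖ξ‖) := by
  have h0 : 2 * Real.pi * ‖ξ‖ ≠ 0 := by
    have := norm_ne_zero_iff.2 hξ
    have := Real.pi_ne_zero
    positivity
  rw [sincMult, intervalIntegral.integral_comp_mul_right _ h0, integral_cos]
  simp [div_eq_inv_mul]

/-- By Fubini the sine propagator is the time integral of the cosine propagator, so it inherits
finite speed of propagation from it. -/
lemma fourier_sincMult (t : ℝ) {θ : E4 → ℂ} (hθ : Integrable θ) (x : E4) :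
    𝓕 (fun ξ => (sincMult t ξ : ℂ) * θ ξ) x = ∫ s in (0 : ℝ)..t, cosWave θ (s, x) := by
  have h1 : ∀ s, cosWave θ (s, x) = ∫ ξ, Real.fourierChar (-(inner ℝ ξ x)) •
      ((Real.cos (s * (2 * Real.pi * ‖ξ‖)) : ℂ) * θ ξ) := fun s => by
    rw [← Real.fourier_eq]; exact congrFun (cosWave_eq hθ s) x
  simp_rw [h1]
  rw [intervalIntegral_integral_swap]
  · rw [Real.fourier_eq]
    refine integral_congr_ae (.of_forall fun ξ => ?_)
    simp only [sincMult, Circle.smul_def, smul_eq_mul]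
    rw [intervalIntegral.integral_const_mul, intervalIntegral.integral_mul_const,
      intervalIntegral.integral_ofReal]
  · have hi : Integrable (fun p : ℝ × E4 => ‖θ p.2‖)
        ((volume.restrict (Set.uIoc 0 t)).prod volume) := by
      have : IsFiniteMeasure (volume.restrict (Set.uIoc 0 t)) := ⟨by simp [Set.uIoc]⟩
      simpa using (integrable_const (1 : ℝ)).mul_prod hθ.norm
    refine hi.mono' ?_ (.of_forall fun p => ?_)
    · refine AEStronglyMeasurable.fun_smul ?_ (AEStronglyMeasurable.mul ?_ ?_)
      · exact (Real.continuous_fourierChar.comp (by fun_prop)).aestronglyMeasurable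
      · exact (Continuous.aestronglyMeasurable (by fun_prop))
      · exact hθ.1.comp_snd
    · simp only [Function.uncurry, Circle.norm_smul, norm_mul, Complex.norm_real,
        Real.norm_eq_abs]
      exact mul_le_of_le_one_left (norm_nonneg _) (Real.abs_cos_le_one _)

lemma cosWave_eq_zero {K : Set E4} {θ : 𝓢(E4, ℂ)} (h : ∀ x, x ∉ K → 𝓕 θ x = 0) {t : ℝ}
    (ht : 0 ≤ t) {x : E4} {ρ : ℝ} (htρ : t < ρ) (hx : ∀ y ∈ K, ρ ≤ dist y x) :
    cosWave θ (t, x) = 0 := by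
  refine cosWave_eq_zero_of_ball (SchwartzMap.rapidDecay θ) (ρ := ρ) (fun y hy => ?_) ht htρ
  rw [← SchwartzMap.fourier_coe]
  exact h y fun hyK => absurd (hx y hyK) (not_le.2 hy)

/-- The propagators map test functions in `{|x| > R + t}` to test functions in `{|x| > R}`. -/
lemma exists_propagated {K : Set E4} (hK : IsCompact K) {θ : 𝓢(E4, ℂ)}
    (h : ∀ x, x ∉ K → 𝓕 θ x = 0) {R t : ℝ} (ht : 0 ≤ t) (hKR : K ⊆ ext (R + t)) :
    ∃ θc θs : 𝓢(E4, ℂ), (∀ ξ, θc ξ = (Real.cos (t * (2 * Real.pi * ‖ξ‖)) : ℂ) * θ ξ) ∧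
      (∀ ξ, ξ ≠ 0 → θs ξ = ((Real.sin (t * (2 * Real.pi * ‖ξ‖)) / (2 * Real.pi * ‖ξ‖) : ℝ) : ℂ)
        * θ ξ) ∧
      (∀ x, x ∉ ext R → 𝓕 θc x = 0) ∧ ∀ x, x ∉ ext R → 𝓕 θs x = 0 := by
  obtain ⟨M, hM⟩ := hK.isBounded.subset_closedBall (0 : E4)
  have hout : ∀ x, x ∉ Metric.closedBall (0 : E4) (M + t + 1) → ∀ s, 0 ≤ s → s ≤ t →
      cosWave θ (s, x) = 0 := by
    intro x hx s hs hst
    refine cosWave_eq_zero h hs (ρ := t + 1) (by linarith) fun y hy => ?_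
    have h1 : dist y 0 ≤ M := hM hy
    have h2 : M + t + 1 < dist x 0 := by simpa using hx
    have := dist_triangle x y 0
    rw [dist_comm y x]
    linarith
  -- The gap between the compact set K and the sphere of radius R + t gives the strict inequality
  -- that finite speed requires.
  obtain ⟨δ, hδ, hδK⟩ : ∃ δ > 0, ∀ y ∈ K, R + t + δ ≤ ‖y‖ := by
    rcases K.eq_empty_or_nonempty with hE | hne
    · exact ⟨1, one_pos, by simp [hE]⟩
    · obtain ⟨y, hy, hmin⟩ := hK.exists_isMinOn hne continuous_norm.continuousOn
      have : R + t < ‖y‖ := hKR hy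
      exact ⟨‖y‖ - (R + t), by linarith, fun z hz => by have := hmin hz; simp at this; linarith⟩
  have hin : ∀ x, x ∉ ext R → ∀ s, 0 ≤ s → s ≤ t → cosWave θ (s, x) = 0 := by
    intro x hx s hs hst
    refine cosWave_eq_zero h hs (ρ := t + δ) (by linarith) fun y hy => ?_
    have h1 : ‖x‖ ≤ R := by simpa [ext] using hx
    have h2 := hδK y hy
    have h3 := norm_sub_norm_le y x
    rw [dist_eq_norm]
    linarith
  have hθi : Integrable θ := θ.integrable
  have hc := fun x => congrFun (cosWave_eq hθi t) x
  have hs := fun x => fourier_sincMult t hθi x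
  have hsz : ∀ x, (∀ s, 0 ≤ s → s ≤ t → cosWave θ (s, x) = 0) →
      ∫ s in (0 : ℝ)..t, cosWave θ (s, x) = 0 := fun x hx => by
    rw [intervalIntegral.integral_congr (g := fun _ => (0 : ℂ)) (fun s hs => by
      rw [Set.uIcc_of_le ht] at hs
      exact hx s hs.1 hs.2)]
    simp
  obtain ⟨θc, hc1, hc2⟩ := exists_schwartz_of_hasCompactSupport_fourier (continuous_cos_mult t)
    (fun ξ => Real.abs_cos_le_one _) θ
    (HasCompactSupport.intro (isCompact_closedBall 0 (M + t + 1)) fun x hx => by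
      rw [← hc]; exact hout x hx t ht le_rfl)
  obtain ⟨θs, hs1, hs2⟩ := exists_schwartz_of_hasCompactSupport_fourier (continuous_sincMult t)
    (abs_sincMult_le t) θ
    (HasCompactSupport.intro (isCompact_closedBall 0 (M + t + 1)) fun x hx => by
      rw [hs]; exact hsz x (hout x hx))
  refine ⟨θc, θs, hc1, fun ξ hξ => by rw [hs1, sincMult_eq t hξ], fun x hx => ?_, fun x hx => ?_⟩
  · rw [hc2, ← hc]; exact hin x hx t ht le_rfl
  · rw [hs2, hs]; exact hsz x (hin x hx)

/-- Finite speed of propagation, in weak form: outside the light cone the solution is determined by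
any `Ḣ¹` extension of the data. -/
lemma IsFreeWave.integral_mul_fourier {v₀ v₁ g : E4 → ℝ} {v : ℝ → E4 → ℝ} {F : E4 → ℂ}
    (hv : IsFreeWave v₀ v₁ v) (hg : HasFourier g F) {R t : ℝ} (ht : 0 ≤ t)
    (h0 : ∀ᵐ x : E4, x ∈ ext R → v₀ x = g x) (h1 : ∀ᵐ x : E4, x ∈ ext R → v₁ x = 0)
    {K : Set E4} (hK : IsCompact K) (hKR : K ⊆ ext (R + t)) {θ : 𝓢(E4, ℂ)}
    (hθ : ∀ x, x ∉ K → 𝓕 θ x = 0) :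
    Integrable (fun ξ => (Real.cos (t * (2 * Real.pi * ‖ξ‖)) : ℂ) * F ξ * θ ξ) ∧
    ∫ x, (v t x : ℂ) * 𝓕 θ x = ∫ ξ, (Real.cos (t * (2 * Real.pi * ‖ξ‖)) : ℂ) * F ξ * θ ξ := by
  obtain ⟨θc, θs, hc, hs, hcR, hsR⟩ := exists_propagated hK hθ ht hKR
  obtain ⟨F₀, F₁, hF₀, hF₁, hF⟩ := hv
  have hFc : ∀ G : E4 → ℂ, (fun ξ => G ξ * θc ξ) =
      fun ξ => (Real.cos (t * (2 * Real.pi * ‖ξ‖)) : ℂ) * G ξ * θ ξ := fun G => by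
    funext ξ; rw [hc]; ring
  refine ⟨by simpa only [hFc] using hg.integrable_right θc, ?_⟩
  rw [(hF t).integral_eq θ, ← hFc F, ← hg.integral_eq θc]
  -- The propagated test functions vanish off {|x| > R}; there v₀ agrees with g, and v₁ is zero.
  have e1 : ∫ x, (g x : ℂ) * 𝓕 θc x = ∫ x, (v₀ x : ℂ) * 𝓕 θc x := by
    refine integral_congr_ae ?_
    filter_upwards [h0] with x hx
    by_cases hxR : x ∈ ext R
    · rw [hx hxR]
    · simp [hcR x hxR]
  have e2 : ∫ x, (v₁ x : ℂ) * 𝓕 θs x = 0 := by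
    refine integral_eq_zero_of_ae ?_
    filter_upwards [h1] with x hx
    by_cases hxR : x ∈ ext R
    · simp [hx hxR]
    · simp [hsR x hxR]
  rw [e1, hF₀.integral_eq θc, ← add_zero (∫ ξ, F₀ ξ * θc ξ), ← e2, hF₁.integral_eq θs,
    ← integral_add (hF₀.integrable_right θc) (hF₁.integrable_right θs)]
  refine integral_congr_ae ?_
  have hne : ∀ᵐ ξ : E4, ξ ≠ 0 := by
    simp [ae_iff]
  filter_upwards [hne] with ξ hξ
  rw [hc, hs ξ hξ]
  ring

/-- A bump function equal to 1 on a ball is the Fourier transform of a Schwartz function, so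
integrability against it is integrability on the ball. -/
lemma HasFourier.locallyIntegrable {f : E4 → ℝ} {F : E4 → ℂ} (h : HasFourier f F) :
    LocallyIntegrable f := by
  intro x
  let χ : ContDiffBump x := ⟨1, 2, one_pos, one_lt_two⟩
  have hχ : IsTest Set.univ χ := ⟨χ.contDiff, χ.hasCompactSupport, Set.subset_univ _⟩
  obtain ⟨θ, hθ⟩ := hχ.exists_fourier_eq
  have hi := (h.integrable_left θ).re
  refine ⟨Metric.closedBall x 1, Metric.closedBall_mem_nhds x one_pos, ?_⟩
  refine (hi.integrableOn (s := Metric.closedBall x 1)).congr_fun (fun y hy => ?_)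
    measurableSet_closedBall
  simp [hθ, χ.one_of_mem_closedBall hy]

/-! ### Fourier inversion in L², weak gradients and time derivatives. -/

lemma eLpNorm_two_sq {α V : Type*} [MeasurableSpace α] [NormedAddCommGroup V] (μ : Measure α)
    (f : α → V) : eLpNorm f 2 μ ^ 2 = ∫⁻ x, ‖f x‖ₑ ^ 2 ∂μ := by
  rw [eLpNorm_eq_lintegral_rpow_enorm_toReal (by norm_num) (by norm_num), ← ENNReal.rpow_natCast,
    ← ENNReal.rpow_mul]
  norm_num

lemma eLpNorm_two_le_iff {α β V W : Type*} [MeasurableSpace α] [MeasurableSpace β]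
    [NormedAddCommGroup V] [NormedAddCommGroup W] {μ : Measure α} {ν : Measure β} {f : α → V}
    {g : β → W} : eLpNorm f 2 μ ≤ eLpNorm g 2 ν ↔
      ∫⁻ x, ‖f x‖ₑ ^ 2 ∂μ ≤ ∫⁻ x, ‖g x‖ₑ ^ 2 ∂ν := by
  rw [← eLpNorm_two_sq, ← eLpNorm_two_sq]
  exact (ENNReal.pow_le_pow_left_iff two_ne_zero).symm

/-- The inverse Fourier transform on `L²`, characterized by duality. -/
lemma exists_fourierInv {h : E4 → ℂ} (hh : MemLp h 2 volume) :
    ∃ D : E4 → ℂ, MemLp D 2 volume ∧ eLpNorm D 2 volume = eLpNorm h 2 volume ∧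
      ∀ θ : 𝓢(E4, ℂ), ∫ x, D x * 𝓕 θ x = ∫ ξ, h ξ * θ ξ := by
  set H : Lp ℂ 2 (volume : Measure E4) := hh.toLp h with hH
  set D : Lp ℂ 2 (volume : Measure E4) := 𝓕⁻ H with hD
  refine ⟨D, Lp.memLp D, ?_, fun θ => ?_⟩
  · have h1 : ‖D‖ = ‖H‖ := by
      rw [← Lp.norm_fourier_eq D, hD, FourierTransform.fourier_fourierInv_eq]
    rw [Lp.norm_def, Lp.norm_def, ENNReal.toReal_eq_toReal_iff' (Lp.eLpNorm_ne_top _)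
      (Lp.eLpNorm_ne_top _)] at h1
    rw [h1]
    exact eLpNorm_congr_ae hh.coeFn_toLp
  · have h1 := Lp.fourier_toTemperedDistribution_eq D
    have h2 : 𝓕 D = H := by rw [hD, FourierTransform.fourier_fourierInv_eq]
    rw [h2] at h1
    have h3 := congrArg (fun T : 𝓢'(E4, ℂ) => T θ) h1
    simp only [TemperedDistribution.fourier_apply, Lp.toTemperedDistribution_apply,
      smul_eq_mul] at h3
    rw [show ∫ x, D x * 𝓕 θ x = ∫ x, 𝓕 θ x * D x by simp_rw [mul_comm], h3]
    refine integral_congr_ae ?_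
    filter_upwards [hh.coeFn_toLp] with ξ hξ
    rw [hξ, mul_comm]

lemma isOpen_ext (ρ : ℝ) : IsOpen (ext ρ) := isOpen_lt continuous_const continuous_norm

section TestFunctions

variable {Ω : Set E4} {φ : E4 → ℝ}

lemma IsTest.integrable_smul {V : Type*} [NormedAddCommGroup V] [NormedSpace ℝ V]
    (hφ : IsTest Ω φ) {f : E4 → V} (hf : LocallyIntegrableOn f Ω) :
    Integrable fun x => φ x • f x := by
  have h1 : IntegrableOn f (tsupport φ) := hf.integrableOn_compact_subset hφ.supp hφ.compact
  have h2 : IntegrableOn (fun x => φ x • f x) (tsupport φ) :=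
    h1.continuousOn_smul hφ.smooth.continuous.continuousOn hφ.compact
  refine (integrableOn_iff_integrable_of_support_subset fun x hx => ?_).1 h2
  refine subset_tsupport φ fun h => hx ?_
  simp [h]

lemma IsTest.pd (hφ : IsTest Ω φ) (v : E4) : IsTest Ω (pd v φ) := by
  have hs : Function.support (ExteriorWave.pd v φ) ⊆ tsupport φ := fun x hx => by
    by_contra h
    exact hx (pd_eq_zero_of_eventuallyEq (notMem_tsupport_iff_eventuallyEq.1 h) v)
  exact ⟨contDiff_pd hφ.smooth v, hφ.compact.mono' hs,
    (closure_minimal hs (isClosed_tsupport φ)).trans hφ.supp⟩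

lemma gradient_apply {f : E4 → ℝ} (x : E4) (j : Fin 4) :
    gradient f x j = pd (EuclideanSpace.single j 1) f x := by
  have h1 : inner ℝ (gradient f x) (EuclideanSpace.single j (1 : ℝ)) =
      fderiv ℝ f x (EuclideanSpace.single j 1) := by
    rw [gradient, InnerProductSpace.toDual_symm_apply]
  rw [pd, ← h1, EuclideanSpace.inner_single_right]
  simp

lemma IsTest.integrable_smul_gradient (hφ : IsTest Ω φ) {f : E4 → ℝ}
    (hf : LocallyIntegrableOn f Ω) : Integrable fun x => f x • gradient φ x := by
  have h := fun j => (hφ.pd (EuclideanSpace.single j 1)).integrable_smul hf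
  have h2 : Integrable fun x => (WithLp.toLp 2 fun j => (f x • gradient φ x) j : E4) := by
    refine ((EuclideanSpace.equiv (Fin 4) ℝ).symm : (Fin 4 → ℝ) →L[ℝ] E4).integrable_comp
      (φ := fun x j => (f x • gradient φ x) j) (Integrable.of_eval fun j => ?_)
    refine (h j).congr (.of_forall fun x => ?_)
    simp [gradient_apply, mul_comm]
  exact h2

/-- Weak gradients are determined componentwise. -/
lemma isWeakGrad_iff {f : E4 → ℝ} {G : E4 → E4} (hf : LocallyIntegrableOn f Ω)
    (hG : LocallyIntegrableOn G Ω) : IsWeakGrad Ω f G ↔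
      ∀ φ, IsTest Ω φ → ∀ j, ∫ x, f x * pd (EuclideanSpace.single j 1) φ x =
        -∫ x, φ x * G x j := by
  have key : ∀ φ, IsTest Ω φ → ((∫ x, f x • gradient φ x = - ∫ x, φ x • G x) ↔
      ∀ j, ∫ x, f x * pd (EuclideanSpace.single j 1) φ x = -∫ x, φ x * G x j) := by
    intro φ hφ
    have h1 : ∀ j, (∫ x, f x • gradient φ x) j =
        ∫ x, f x * pd (EuclideanSpace.single j 1) φ x := fun j => by
      refine ((EuclideanSpace.proj j : E4 →L[ℝ] ℝ).integral_comp_comm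
        (hφ.integrable_smul_gradient hf)).symm.trans ?_
      simp [gradient_apply]
    have h2 : ∀ j, (∫ x, φ x • G x) j = ∫ x, φ x * G x j := fun j => by
      refine ((EuclideanSpace.proj j : E4 →L[ℝ] ℝ).integral_comp_comm
        (hφ.integrable_smul hG)).symm.trans ?_
      simp
    constructor
    · intro h j
      rw [← h1, h, ← h2]
      simp
    · intro h
      ext j
      rw [h1, h j, ← h2]
      simp
  exact ⟨fun h φ hφ => (key φ hφ).1 (h.integral_eq φ hφ),
    fun h => ⟨hf, hG, fun φ hφ => (key φ hφ).2 (h φ hφ)⟩⟩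

lemma IsWeakGrad.ae_eq (hΩ : IsOpen Ω) {f : E4 → ℝ} {G G' : E4 → E4} (h : IsWeakGrad Ω f G)
    (h' : IsWeakGrad Ω f G') : ∀ᵐ x, x ∈ Ω → G x = G' x := by
  have := hΩ.ae_eq_zero_of_integral_contDiff_smul_eq_zero (h.locInt_grad.sub h'.locInt_grad)
    fun φ h1 h2 h3 => ?_
  · filter_upwards [this] with x hx hxΩ
    exact sub_eq_zero.1 (hx hxΩ)
  · have hφ : IsTest Ω φ := ⟨h1, h2, h3⟩
    have e1 := h.integral_eq φ hφ
    have e2 := h'.integral_eq φ hφ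
    simp only [Pi.sub_apply, smul_sub]
    rw [integral_sub (hφ.integrable_smul h.locInt_grad) (hφ.integrable_smul h'.locInt_grad)]
    rw [← neg_inj, neg_sub, neg_zero, sub_eq_zero]
    rw [e1, neg_inj] at e2
    exact e2.symm

lemma IsWeakGrad.weakGrad {f : E4 → ℝ} {G : E4 → E4} (h : IsWeakGrad Ω f G) :
    IsWeakGrad Ω f (weakGrad Ω f) := by
  have hex : ∃ g, IsWeakGrad Ω f g := ⟨G, h⟩
  rw [ExteriorWave.weakGrad, dif_pos hex]
  exact hex.choose_spec

lemma IsWeakGrad.weakGrad_ae_eq (hΩ : IsOpen Ω) {f : E4 → ℝ} {G : E4 → E4}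
    (h : IsWeakGrad Ω f G) : ExteriorWave.weakGrad Ω f =ᵐ[volume.restrict Ω] G :=
  (ae_restrict_iff' hΩ.measurableSet).2 (h.weakGrad.ae_eq hΩ h)

lemma IsWeakGrad.sub {f f' : E4 → ℝ} {G G' : E4 → E4} (h : IsWeakGrad Ω f G)
    (h' : IsWeakGrad Ω f' G') : IsWeakGrad Ω (fun x => f x - f' x) fun x => G x - G' x := by
  refine ⟨h.locInt_fun.sub h'.locInt_fun, h.locInt_grad.sub h'.locInt_grad, fun φ hφ => ?_⟩
  simp only [sub_smul, smul_sub]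
  rw [integral_sub (hφ.integrable_smul_gradient h.locInt_fun)
    (hφ.integrable_smul_gradient h'.locInt_fun), integral_sub (hφ.integrable_smul h.locInt_grad)
    (hφ.integrable_smul h'.locInt_grad), h.integral_eq φ hφ, h'.integral_eq φ hφ]
  abel

lemma IsWeakGrad.const_mul {f : E4 → ℝ} {G : E4 → E4} (h : IsWeakGrad Ω f G) (c : ℝ) :
    IsWeakGrad Ω (fun x => c * f x) fun x => c • G x := by
  refine ⟨h.locInt_fun.smul c, h.locInt_grad.smul c, fun φ hφ => ?_⟩
  have e1 : ∀ x, (c * f x) • gradient φ x = c • (f x • gradient φ x) := fun x => mul_smul ..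
  have e2 : ∀ x, φ x • c • G x = c • (φ x • G x) := fun x => smul_comm ..
  simp_rw [e1, e2, integral_smul, h.integral_eq φ hφ, smul_neg]

lemma IsTimeDeriv.ae_eq (hΩ : IsOpen Ω) {u : ℝ → E4 → ℝ} {t : ℝ} {w w' : E4 → ℝ}
    (h : IsTimeDeriv Ω u t w) (h' : IsTimeDeriv Ω u t w') : ∀ᵐ x, x ∈ Ω → w x = w' x := by
  have := hΩ.ae_eq_zero_of_integral_contDiff_smul_eq_zero (h.locInt.sub h'.locInt)
    fun φ h1 h2 h3 => ?_
  · filter_upwards [this] with x hx hxΩ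
    exact sub_eq_zero.1 (hx hxΩ)
  · have hφ : IsTest Ω φ := ⟨h1, h2, h3⟩
    simp only [Pi.sub_apply, smul_sub]
    rw [integral_sub (hφ.integrable_smul h.locInt) (hφ.integrable_smul h'.locInt), sub_eq_zero]
    simp only [smul_eq_mul, mul_comm]
    exact (h.hasDerivAt φ hφ).unique (h'.hasDerivAt φ hφ)

lemma IsTimeDeriv.timeDeriv {u : ℝ → E4 → ℝ} {t : ℝ} {w : E4 → ℝ} (h : IsTimeDeriv Ω u t w) :
    IsTimeDeriv Ω u t (timeDeriv Ω u t) := by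
  have hex : ∃ w, IsTimeDeriv Ω u t w := ⟨w, h⟩
  rw [ExteriorWave.timeDeriv, dif_pos hex]
  exact hex.choose_spec

lemma IsTimeDeriv.timeDeriv_ae_eq (hΩ : IsOpen Ω) {u : ℝ → E4 → ℝ} {t : ℝ} {w : E4 → ℝ}
    (h : IsTimeDeriv Ω u t w) : ExteriorWave.timeDeriv Ω u t =ᵐ[volume.restrict Ω] w :=
  (ae_restrict_iff' hΩ.measurableSet).2 (h.timeDeriv.ae_eq hΩ h)

end TestFunctions

/-! ### Representation on the Fourier side and Plancherel bounds. -/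

/-- In the open set `Ω`, the function `f` is the inverse Fourier transform of `F`, tested against
functions supported in `Ω`. -/
structure RepOn (Ω : Set E4) (f : E4 → ℝ) (F : E4 → ℂ) : Prop where
  locInt : LocallyIntegrableOn f Ω
  integrable : ∀ θ : 𝓢(E4, ℂ), Integrable fun ξ => F ξ * θ ξ
  rep : ∀ (φ : E4 → ℝ) (θ : 𝓢(E4, ℂ)), IsTest Ω φ → (∀ x, 𝓕 θ x = (φ x : ℂ)) →
    ((∫ x, f x * φ x : ℝ) : ℂ) = ∫ ξ, F ξ * θ ξ

lemma RepOn.sub {Ω : Set E4} {f f' : E4 → ℝ} {F F' : E4 → ℂ} (h : RepOn Ω f F)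
    (h' : RepOn Ω f' F') : RepOn Ω (fun x => f x - f' x) fun ξ => F ξ - F' ξ := by
  refine ⟨h.locInt.sub h'.locInt, fun θ => ?_, fun φ θ hφ hθ => ?_⟩
  · refine ((h.integrable θ).sub (h'.integrable θ)).congr (.of_forall fun ξ => ?_)
    simp [sub_mul]
  · have e1 := hφ.integrable_smul h.locInt
    have e2 := hφ.integrable_smul h'.locInt
    simp only [smul_eq_mul, mul_comm] at e1 e2
    simp only [sub_mul]
    rw [integral_sub (h.integrable θ) (h'.integrable θ), ← h.rep φ θ hφ hθ, ← h'.rep φ θ hφ hθ,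
      ← Complex.ofReal_sub, integral_sub]
    · simpa only [mul_comm] using e1
    · simpa only [mul_comm] using e2

/-- The density of the gradient on the Fourier side. -/
def freq (F : E4 → ℂ) (ξ : E4) : ℂ := ((2 * Real.pi * ‖ξ‖ : ℝ) : ℂ) * F ξ

lemma memLp_freq {F : E4 → ℂ} (hF : MemLp (fun ξ => (‖ξ‖ : ℂ) * F ξ) 2 volume) :
    MemLp (freq F) 2 volume := by
  refine (hF.const_mul (2 * Real.pi : ℂ)).ae_eq (.of_forall fun ξ => ?_)
  simp only [freq]
  push_cast
  ring

lemma MemLp.bounded_mul {h : E4 → ℂ} (hh : MemLp h 2 volume) {m : E4 → ℂ}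
    (hm : AEStronglyMeasurable m volume) (hb : ∀ ξ, ‖m ξ‖ ≤ 1) :
    MemLp (fun ξ => m ξ * h ξ) 2 volume :=
  hh.of_le (hm.mul hh.1) (.of_forall fun ξ => by
    rw [norm_mul]; exact mul_le_of_le_one_left (norm_nonneg _) (hb ξ))

lemma eLpNorm_bounded_mul_le {h m : E4 → ℂ} (hb : ∀ ξ, ‖m ξ‖ ≤ 1) :
    eLpNorm (fun ξ => m ξ * h ξ) 2 volume ≤ eLpNorm h 2 volume :=
  eLpNorm_mono fun ξ => by
    rw [norm_mul]; exact mul_le_of_le_one_left (norm_nonneg _) (hb ξ)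

lemma norm_coord_div_le (j : Fin 4) (ξ : E4) : ‖((ξ j / ‖ξ‖ : ℝ) : ℂ)‖ ≤ 1 := by
  rw [Complex.norm_real, norm_div, norm_norm]
  exact div_le_one_of_le₀ (PiLp.norm_apply_le ξ j) (norm_nonneg _)

lemma measurable_coord_div (j : Fin 4) :
    AEStronglyMeasurable (fun ξ : E4 => Complex.I * ((ξ j / ‖ξ‖ : ℝ) : ℂ)) volume := by
  refine Measurable.aestronglyMeasurable (Measurable.const_mul ?_ _)
  exact Complex.measurable_ofReal.comp (Measurable.div (by fun_prop) (by fun_prop))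

/-- Factors the symbol of ∂_j as a Riesz multiplier, bounded by one, times `freq F`; at ξ = 0 both
sides vanish. -/
lemma coord_mul_freq (F : E4 → ℂ) (j : Fin 4) (ξ : E4) :
    Complex.I * ((ξ j / ‖ξ‖ : ℝ) : ℂ) * freq F ξ =
      (2 * Real.pi * Complex.I) * ((ξ j : ℝ) : ℂ) * F ξ := by
  unfold freq
  rcases eq_or_ne ξ 0 with rfl | h
  · simp
  · have : (‖ξ‖ : ℂ) ≠ 0 := by exact_mod_cast norm_ne_zero_iff.2 h
    push_cast
    field_simp

lemma MemLp.locallyIntegrable_two {V : Type*} [NormedAddCommGroup V] {f : E4 → V}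
    (hf : MemLp f 2 volume) : LocallyIntegrable f :=
  hf.locallyIntegrable (by norm_num)

lemma MemLp.integrable_mul_schwartz {h : E4 → ℂ} (hh : MemLp h 2 volume) (θ : 𝓢(E4, ℂ)) :
    Integrable fun x => h x * θ x :=
  hh.integrable_mul (θ.memLp 2 volume)

/-- The derivatives of a function represented in `Ω` by an element of `Ḣ¹`, on the Fourier side. -/
theorem RepOn.exists_fourier_deriv {Ω : Set E4} {f : E4 → ℝ} {F : E4 → ℂ} (h : RepOn Ω f F)
    (hF : MemLp (freq F) 2 volume) : ∃ D : Fin 4 → E4 → ℂ, (∀ j, MemLp (D j) 2 volume) ∧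
      ∫⁻ x, ∑ j, ‖D j x‖ₑ ^ 2 = ∫⁻ ξ, ‖freq F ξ‖ₑ ^ 2 ∧
      ∀ (φ : E4 → ℝ) (j : Fin 4), IsTest Ω φ →
        ((∫ x, f x * ExteriorWave.pd (EuclideanSpace.single j 1) φ x : ℝ) : ℂ) =
          -∫ x, D j x * (φ x : ℂ) := by
  have hb : ∀ (j : Fin 4) (ξ : E4), ‖Complex.I * ((ξ j / ‖ξ‖ : ℝ) : ℂ)‖ ≤ 1 := fun j ξ => by
    rw [norm_mul, Complex.norm_I, one_mul]; exact norm_coord_div_le j ξ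
  have hh : ∀ j : Fin 4, MemLp (fun ξ => Complex.I * ((ξ j / ‖ξ‖ : ℝ) : ℂ) * freq F ξ) 2 volume :=
    fun j => MemLp.bounded_mul hF (measurable_coord_div j) (hb j)
  -- The squared moduli of the four Riesz multipliers sum to one away from the origin, where `freq
  -- F` vanishes anyway; hence the identity of L² norms.
  choose D hD2 hDn hD using fun j => exists_fourierInv (hh j)
  refine ⟨D, hD2, ?_, fun φ j hφ => ?_⟩
  · have e2 : ∀ ξ, ∑ j : Fin 4, ‖Complex.I * ((ξ j / ‖ξ‖ : ℝ) : ℂ) * freq F ξ‖ₑ ^ 2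
        = ‖freq F ξ‖ₑ ^ 2 := by
      intro ξ
      simp only [← ofReal_norm]
      simp only [← ENNReal.ofReal_pow (norm_nonneg _)]
      rw [← ENNReal.ofReal_sum_of_nonneg fun j _ => by positivity]
      congr 1
      simp only [norm_mul, Complex.norm_I, one_mul, mul_pow, Complex.norm_real, norm_div,
        norm_norm, div_pow]
      rw [← Finset.sum_mul, ← Finset.sum_div, ← EuclideanSpace.norm_sq_eq]
      rcases eq_or_ne ξ 0 with rfl | hξ
      · simp [freq]
      · rw [div_self (pow_ne_zero 2 (norm_ne_zero_iff.2 hξ)), one_mul]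
    calc ∫⁻ x, ∑ j, ‖D j x‖ₑ ^ 2 = ∑ j, ∫⁻ x, ‖D j x‖ₑ ^ 2 :=
        lintegral_finsetSum' _ fun j _ => (hD2 j).1.enorm.pow_const 2
      _ = ∑ j : Fin 4, ∫⁻ ξ, ‖Complex.I * ((ξ j / ‖ξ‖ : ℝ) : ℂ) * freq F ξ‖ₑ ^ 2 :=
        Finset.sum_congr rfl fun j _ => by rw [← eLpNorm_two_sq, hDn j, eLpNorm_two_sq]
      _ = ∫⁻ ξ, ∑ j : Fin 4, ‖Complex.I * ((ξ j / ‖ξ‖ : ℝ) : ℂ) * freq F ξ‖ₑ ^ 2 :=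
        (lintegral_finsetSum' _ fun j _ => (hh j).1.enorm.pow_const 2).symm
      _ = _ := lintegral_congr e2
  have h1 : HasCompactSupport fun x => (φ x : ℂ) := hφ.compact.comp_left Complex.ofReal_zero
  have h2 : ContDiff ℝ ∞ fun x => (φ x : ℂ) := Complex.ofRealCLM.contDiff.comp hφ.smooth
  set φc : 𝓢(E4, ℂ) := h1.toSchwartzMap h2 with hφc
  set e : E4 := EuclideanSpace.single j 1 with he
  have hθ : ∀ x, 𝓕 (𝓕⁻ φc) x = (φ x : ℂ) := fun x => by
    rw [FourierTransform.fourier_fourierInv_eq]; rfl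
  have hder : ∀ x, (LineDeriv.lineDerivOp e φc : 𝓢(E4, ℂ)) x = ((pd e φ x : ℝ) : ℂ) := fun x => by
    rw [SchwartzMap.lineDerivOp_apply_eq_fderiv]
    change fderiv ℝ (Complex.ofRealCLM ∘ φ) x e = _
    rw [(Complex.ofRealCLM.hasFDerivAt.comp x
      (hφ.smooth.differentiable (by simp) x).hasFDerivAt).fderiv]
    rfl
  have hθ' : ∀ x, 𝓕 (𝓕⁻ (LineDeriv.lineDerivOp e φc : 𝓢(E4, ℂ))) x = ((pd e φ x : ℝ) : ℂ) :=
    fun x => by rw [FourierTransform.fourier_fourierInv_eq]; exact hder x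
  have hmul : ∀ ξ, (𝓕⁻ (LineDeriv.lineDerivOp e φc : 𝓢(E4, ℂ))) ξ =
      -(2 * Real.pi * Complex.I) * ((ξ j : ℝ) : ℂ) * (𝓕⁻ φc) ξ := fun ξ => by
    rw [SchwartzMap.fourierInv_lineDerivOp_eq]
    have ht : (fun x : E4 => inner ℝ x e).HasTemperateGrowth := by fun_prop
    rw [smul_apply, SchwartzMap.smulLeftCLM_apply_apply ht]
    simp [he, EuclideanSpace.inner_single_right]
    ring
  have e3 := h.rep _ _ (hφ.pd e) hθ'
  have e4 : ∫ ξ, F ξ * (𝓕⁻ (LineDeriv.lineDerivOp e φc : 𝓢(E4, ℂ))) ξ =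
      -∫ x, D j x * (φ x : ℂ) := by
    rw [show ∫ x, D j x * (φ x : ℂ) = ∫ x, D j x * 𝓕 (𝓕⁻ φc) x by simp_rw [hθ], hD,
      ← integral_neg]
    refine integral_congr_ae (.of_forall fun ξ => ?_)
    simp only [hmul, coord_mul_freq]
    ring
  exact e3.trans e4

/-- A function represented in `Ω` by an element of `Ḣ¹` has a weak gradient, controlled by
Plancherel's theorem. -/
theorem RepOn.exists_isWeakGrad {Ω : Set E4} {f : E4 → ℝ} {F : E4 → ℂ} (h : RepOn Ω f F)
    (hF : MemLp (freq F) 2 volume) : ∃ G : E4 → E4, IsWeakGrad Ω f G ∧ MemLp G 2 volume ∧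
      eLpNorm G 2 volume ≤ eLpNorm (freq F) 2 volume ∧
      (Ω = Set.univ → eLpNorm G 2 volume = eLpNorm (freq F) 2 volume) := by
  obtain ⟨D, hD2, hDn, hDφ⟩ := h.exists_fourier_deriv hF
  -- Pairing with real test functions in Ω only sees the real parts. Outside Ω the `D j` need not be
  -- real, so in general only an inequality of norms survives; it becomes an equality when Ω is the
  -- whole space.
  set G : E4 → E4 := fun x => WithLp.toLp 2 fun j => (D j x).re with hG
  have hGm : AEStronglyMeasurable G volume := by
    have h1 : AEMeasurable (fun x => fun j => (D j x).re) (volume : Measure E4) :=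
      aemeasurable_pi_lambda _ fun j => (hD2 j).1.aemeasurable.re
    exact ((EuclideanSpace.equiv (Fin 4) ℝ).symm.continuous.measurable.comp_aemeasurable
      h1).aestronglyMeasurable
  have hle : eLpNorm G 2 volume ≤ eLpNorm (freq F) 2 volume := by
    rw [eLpNorm_two_le_iff, ← hDn]
    refine lintegral_mono fun x => ?_
    have : ‖G x‖ ^ 2 ≤ ∑ j, ‖D j x‖ ^ 2 := by
      rw [EuclideanSpace.real_norm_sq_eq]
      refine Finset.sum_le_sum fun j _ => ?_
      rw [← sq_abs]
      gcongr
      exact Complex.abs_re_le_norm _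
    simp only [← ofReal_norm]
    simp only [← ENNReal.ofReal_pow (norm_nonneg _)]
    rw [← ENNReal.ofReal_sum_of_nonneg fun j _ => by positivity]
    exact ENNReal.ofReal_le_ofReal this
  have hG2 : MemLp G 2 volume := ⟨hGm, hle.trans_lt hF.2⟩
  have hDi : ∀ (φ : E4 → ℝ) (j : Fin 4), IsTest Ω φ →
      Integrable fun x => D j x * (φ x : ℂ) := fun φ j hφ =>
    MemLp.integrable_mul_schwartz (hD2 j)
      ((hφ.compact.comp_left Complex.ofReal_zero : HasCompactSupport fun x => (φ x : ℂ)).toSchwartzMap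
        (Complex.ofRealCLM.contDiff.comp hφ.smooth))
  refine ⟨G, ?_, hG2, hle, fun hΩ => ?_⟩
  · rw [isWeakGrad_iff h.locInt ((MemLp.locallyIntegrable_two hG2).locallyIntegrableOn _)]
    intro φ hφ j
    have e5 := congrArg Complex.re (hDφ φ j hφ)
    rw [Complex.ofReal_re, Complex.neg_re] at e5
    rw [e5, neg_inj]
    change Complex.reCLM _ = _
    rw [← Complex.reCLM.integral_comp_comm (hDi φ j hφ)]
    refine integral_congr_ae (.of_forall fun x => ?_)
    simp [hG, mul_comm]
  · subst hΩ
    have him : ∀ j, ∀ᵐ x, (D j x).im = 0 := fun j => by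
      refine ae_eq_zero_of_integral_contDiff_smul_eq_zero
        (MemLp.locallyIntegrable_two (hD2 j).im) fun φ h1 h2 => ?_
      have hφ : IsTest Set.univ φ := ⟨h1, h2, Set.subset_univ _⟩
      have e5 := congrArg Complex.im (hDφ φ j hφ)
      rw [Complex.ofReal_im, Complex.neg_im, zero_eq_neg] at e5
      change Complex.imCLM _ = _ at e5
      rw [← Complex.imCLM.integral_comp_comm (hDi φ j hφ)] at e5
      rw [← e5]
      refine integral_congr_ae (.of_forall fun x => ?_)
      simp [mul_comm]
    have hsq : eLpNorm G 2 volume ^ 2 = eLpNorm (freq F) 2 volume ^ 2 := by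
      rw [eLpNorm_two_sq, eLpNorm_two_sq, ← hDn]
      refine lintegral_congr_ae ?_
      filter_upwards [ae_all_iff.2 him] with x hx
      have : ‖G x‖ ^ 2 = ∑ j, ‖D j x‖ ^ 2 := by
        rw [EuclideanSpace.real_norm_sq_eq]
        refine Finset.sum_congr rfl fun j _ => ?_
        rw [Complex.sq_norm, Complex.normSq_apply, hx j]
        simp [hG, sq]
      simp only [← ofReal_norm]
      simp only [← ENNReal.ofReal_pow (norm_nonneg _)]
      rw [← ENNReal.ofReal_sum_of_nonneg fun j _ => by positivity, this]
    refine le_antisymm hle ?_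
    exact (ENNReal.pow_le_pow_left_iff two_ne_zero).1 hsq.ge

/-- Plancherel's theorem for the weak gradient. -/
lemma RepOn.eLpNorm_freq {f : E4 → ℝ} {F : E4 → ℂ} (h : RepOn Set.univ f F)
    (hF : MemLp (freq F) 2 volume) {G : E4 → E4} (hG : IsWeakGrad Set.univ f G) :
    eLpNorm (freq F) 2 volume = eLpNorm G 2 volume := by
  obtain ⟨G', h1, -, -, h2⟩ := h.exists_isWeakGrad hF
  rw [← h2 rfl]
  refine eLpNorm_congr_ae ?_
  filter_upwards [h1.ae_eq isOpen_univ hG] with x hx using hx trivial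

lemma aestronglyMeasurable_of_freq {F : E4 → ℂ} (hF : AEStronglyMeasurable (freq F) volume) :
    AEStronglyMeasurable F volume := by
  have h1 : AEStronglyMeasurable (fun ξ : E4 => ((2 * Real.pi * ‖ξ‖ : ℝ) : ℂ)⁻¹ * freq F ξ)
      volume := by
    refine AEStronglyMeasurable.mul (Measurable.aestronglyMeasurable ?_) hF
    exact (Complex.measurable_ofReal.comp (by fun_prop)).inv
  refine h1.congr ?_
  have hne : ∀ᵐ ξ : E4, ξ ≠ 0 := by simp [ae_iff]
  filter_upwards [hne] with ξ hξ
  have : ((2 * Real.pi * ‖ξ‖ : ℝ) : ℂ) ≠ 0 := by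
    have := norm_ne_zero_iff.2 hξ
    have := Real.pi_ne_zero
    exact_mod_cast (by positivity : (2 * Real.pi * ‖ξ‖ : ℝ) ≠ 0)
  rw [freq, inv_mul_cancel_left₀ this]

/-- The analogous statement for time derivatives. -/
theorem exists_isTimeDeriv {Ω : Set E4} {u : ℝ → E4 → ℝ} {F : E4 → ℂ} {t : ℝ}
    (hi : ∀ θ : 𝓢(E4, ℂ), Integrable fun ξ => F ξ * θ ξ)
    (hu : ∀ (φ : E4 → ℝ) (θ : 𝓢(E4, ℂ)), IsTest Ω φ → (∀ x, 𝓕 θ x = (φ x : ℂ)) →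
      ∀ᶠ s in 𝓝 t, ((∫ x, u s x * φ x : ℝ) : ℂ) =
        ∫ ξ, (Real.cos (s * (2 * Real.pi * ‖ξ‖)) : ℂ) * F ξ * θ ξ)
    (hF : MemLp (freq F) 2 volume) : ∃ w : E4 → ℝ, IsTimeDeriv Ω u t w ∧ MemLp w 2 volume ∧
      eLpNorm w 2 volume ≤ eLpNorm (freq F) 2 volume := by
  -- The time derivative of cos (2π s‖ξ‖) F is -sin (2π s‖ξ‖) `freq F`, dominated by ‖`freq F`‖
  -- uniformly in s.
  set m : E4 → ℂ := fun ξ => ((-Real.sin (t * (2 * Real.pi * ‖ξ‖)) : ℝ) : ℂ) with hm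
  have hmb : ∀ ξ, ‖m ξ‖ ≤ 1 := fun ξ => by
    rw [hm, Complex.norm_real, norm_neg]; exact Real.abs_sin_le_one _
  have hmc : Continuous m := by fun_prop
  have hh := MemLp.bounded_mul hF hmc.aestronglyMeasurable hmb
  obtain ⟨D, hD2, hDn, hD⟩ := exists_fourierInv hh
  have hle : eLpNorm (fun x => (D x).re) 2 volume ≤ eLpNorm (freq F) 2 volume := by
    refine le_trans (eLpNorm_mono (g := D) fun x => ?_) (hDn.trans_le (eLpNorm_bounded_mul_le hmb))
    exact Complex.abs_re_le_norm _
  have hw2 : MemLp (fun x => (D x).re) 2 volume :=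
    ⟨Complex.continuous_re.comp_aestronglyMeasurable hD2.1, hle.trans_lt hF.2⟩
  refine ⟨fun x => (D x).re, ⟨(MemLp.locallyIntegrable_two hw2).locallyIntegrableOn _,
    fun φ hφ => ?_⟩, hw2, hle⟩
  obtain ⟨θ, hθ⟩ := hφ.exists_fourier_eq
  have hFm := aestronglyMeasurable_of_freq hF.1
  have hmeas : ∀ s : ℝ, AEStronglyMeasurable (fun ξ =>
      (Real.cos (s * (2 * Real.pi * ‖ξ‖)) : ℂ) * F ξ * θ ξ) volume := fun s =>
    ((Continuous.aestronglyMeasurable (by fun_prop)).mul hFm).mul θ.continuous.aestronglyMeasurable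
  have hder := (hasDerivAt_integral_of_dominated_loc_of_deriv_le
    (F := fun (s : ℝ) ξ => (Real.cos (s * (2 * Real.pi * ‖ξ‖)) : ℂ) * F ξ * θ ξ)
    (F' := fun (s : ℝ) ξ => ((-Real.sin (s * (2 * Real.pi * ‖ξ‖)) : ℝ) : ℂ) * freq F ξ * θ ξ)
    (bound := fun ξ => ‖freq F ξ * θ ξ‖) (μ := volume) (x₀ := t)
    (s := Set.univ) univ_mem (.of_forall hmeas) ?_
    ((hmc.aestronglyMeasurable.mul hF.1).mul θ.continuous.aestronglyMeasurable) ?_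
    (MemLp.integrable_mul_schwartz hF θ).norm ?_).2
  · have e1 : ∫ ξ, m ξ * freq F ξ * θ ξ = ∫ x, D x * (φ x : ℂ) := by
      rw [← hD θ]; simp_rw [hθ]
    have hDi : Integrable fun x => D x * (φ x : ℂ) := by
      have := hφ.integrable_smul ((MemLp.locallyIntegrable_two hD2).locallyIntegrableOn _)
      refine this.congr (.of_forall fun x => ?_)
      simp [mul_comm]
    have e2 : HasDerivAt (fun s => ((∫ x, u s x * φ x : ℝ) : ℂ)) (∫ x, D x * (φ x : ℂ)) t := by
      rw [← e1]
      exact hder.congr_of_eventuallyEq (hu φ θ hφ hθ)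
    have e3 := Complex.reCLM.hasFDerivAt.comp_hasDerivAt t e2
    have e4 : Complex.reCLM (∫ x, D x * (φ x : ℂ)) = ∫ x, (D x).re * φ x := by
      rw [← Complex.reCLM.integral_comp_comm hDi]
      simp
    rw [e4] at e3
    exact e3
  · refine (hi θ).norm.mono' (hmeas t) (.of_forall fun ξ => ?_)
    rw [mul_assoc, norm_mul, Complex.norm_real]
    exact mul_le_of_le_one_left (norm_nonneg _) (Real.abs_cos_le_one _)
  · refine .of_forall fun ξ s _ => ?_
    rw [mul_assoc, norm_mul, Complex.norm_real, norm_neg]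
    exact mul_le_of_le_one_left (norm_nonneg _) (Real.abs_sin_le_one _)
  · refine .of_forall fun ξ s _ => ?_
    have h1 : HasDerivAt (fun s : ℝ => Real.cos (s * (2 * Real.pi * ‖ξ‖)))
        (-Real.sin (s * (2 * Real.pi * ‖ξ‖)) * (2 * Real.pi * ‖ξ‖)) s := by
      simpa using ((hasDerivAt_id s).mul_const (2 * Real.pi * ‖ξ‖)).cos
    have h2 := ((h1.ofReal_comp).mul_const (F ξ)).mul_const (θ ξ)
    refine h2.congr_deriv ?_
    simp only [freq]
    push_cast
    ring

/-- `u` is represented in `{|x| > R + t}` by the solution with data `(𝓕⁻¹ F, 0)`. -/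
structure ExtRep (R : ℝ) (u : ℝ → E4 → ℝ) (F : E4 → ℂ) : Prop where
  repOn : ∀ t, 0 ≤ t →
    RepOn (ext (t + R)) (u t) fun ξ => (Real.cos (t * (2 * Real.pi * ‖ξ‖)) : ℂ) * F ξ

/-- Whatever extension of the data defines u, finite speed in weak form lets F, the transform of the
chosen extension g, represent u outside the cone. -/
lemma IsExteriorFreeWave.extRep {R : ℝ} {u₀ g : E4 → ℝ} {u : ℝ → E4 → ℝ} {F : E4 → ℂ}
    (hu : IsExteriorFreeWave R u₀ (fun _ => 0) u) (hg : HasFourier g F)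
    (h0 : ∀ᵐ x : E4, x ∈ ext R → u₀ x = g x) : ExtRep R u F := by
  obtain ⟨v₀, v₁, v, -, -, hv, hv₀, hv₁, huv⟩ := hu
  have hv₀' : ∀ᵐ x : E4, x ∈ ext R → v₀ x = g x := by
    filter_upwards [h0, hv₀] with x h1 h2 hx
    rw [h2 hx, h1 hx]
  refine ⟨fun t ht => ?_⟩
  have huv' := huv t ht
  rw [add_comm R t] at huv'
  refine ⟨?_, fun θ => ?_, fun φ θ hφ hθ => ?_⟩
  · obtain ⟨F₀, F₁, -, -, hF⟩ := hv
    have h1 : LocallyIntegrableOn (v t) (ext (t + R)) :=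
      (hF t).locallyIntegrable.locallyIntegrableOn _
    intro x hx
    obtain ⟨s, hs, hi⟩ := h1 x hx
    refine ⟨s ∩ ext (t + R), inter_mem hs self_mem_nhdsWithin, ?_⟩
    refine (hi.mono_set Set.inter_subset_left).congr ?_
    refine ae_restrict_of_ae_restrict_of_subset Set.inter_subset_right ?_
    refine (ae_restrict_iff' (isOpen_ext _).measurableSet).2 ?_
    filter_upwards [huv'] with x hx hx' using (hx hx').symm
  · refine (hg.integrable_right θ).mono ?_ (.of_forall fun ξ => ?_)
    · simp only [mul_assoc]
      exact (Continuous.aestronglyMeasurable (by fun_prop)).mul (hg.integrable_right θ).1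
    · rw [mul_assoc, norm_mul, Complex.norm_real]
      exact mul_le_of_le_one_left (norm_nonneg _) (Real.abs_cos_le_one _)
  · have h2 := (hv.integral_mul_fourier hg ht hv₀' hv₁ hφ.compact
      (hφ.supp.trans_eq (by rw [add_comm])) (θ := θ) fun x hx => by
        rw [hθ, image_eq_zero_of_notMem_tsupport hx, Complex.ofReal_zero]).2
    rw [← h2, ← integral_complex_ofReal]
    refine integral_congr_ae ?_
    filter_upwards [huv'] with x hx
    by_cases hxt : x ∈ ext (t + R)
    · simp [hθ, hx hxt]
    · have : φ x = 0 := image_eq_zero_of_notMem_tsupport fun h => hxt (hφ.supp h)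
      simp [hθ, this]

lemma ExtRep.sub {R : ℝ} {u u' : ℝ → E4 → ℝ} {F F' : E4 → ℂ} (h : ExtRep R u F)
    (h' : ExtRep R u' F') : ExtRep R (fun t x => u t x - u' t x) fun ξ => F ξ - F' ξ :=
  ⟨fun t ht => by simpa only [mul_sub] using (h.repOn t ht).sub (h'.repOn t ht)⟩

lemma freq_cos (F : E4 → ℂ) (t : ℝ) :
    (freq fun ξ => (Real.cos (t * (2 * Real.pi * ‖ξ‖)) : ℂ) * F ξ) =
      fun ξ => (Real.cos (t * (2 * Real.pi * ‖ξ‖)) : ℂ) * freq F ξ := by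
  funext ξ; simp only [freq]; ring

lemma norm_cos_le (t : ℝ) (ξ : E4) : ‖(Real.cos (t * (2 * Real.pi * ‖ξ‖)) : ℂ)‖ ≤ 1 := by
  rw [Complex.norm_real]; exact Real.abs_cos_le_one _

lemma ExtRep.exists_isWeakGrad {R : ℝ} {u : ℝ → E4 → ℝ} {F : E4 → ℂ} (h : ExtRep R u F)
    (hF : MemLp (freq F) 2 volume) {t : ℝ} (ht : 0 ≤ t) :
    ∃ G : E4 → E4, IsWeakGrad (ext (t + R)) (u t) G ∧ MemLp G 2 volume ∧
      eLpNorm G 2 volume ≤ eLpNorm (freq F) 2 volume := by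
  obtain ⟨G, h1, h2, h3, -⟩ := (h.repOn t ht).exists_isWeakGrad (by
    rw [freq_cos]
    exact MemLp.bounded_mul hF (Continuous.aestronglyMeasurable (by fun_prop)) (norm_cos_le t))
  refine ⟨G, h1, h2, h3.trans ?_⟩
  rw [freq_cos]
  exact eLpNorm_bounded_mul_le (norm_cos_le t)

/-- The compact support keeps a distance from the sphere of radius t + R, so a test function stays
admissible at nearby times on both sides of t; t > 0 keeps those times nonnegative. -/
lemma IsTest.eventually_ext {R t : ℝ} {φ : E4 → ℝ} (hφ : IsTest (ext (t + R)) φ) (ht : 0 < t) :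
    ∀ᶠ s in 𝓝 t, 0 ≤ s ∧ IsTest (ext (s + R)) φ := by
  obtain ⟨δ, hδ, hsub⟩ : ∃ δ > 0, tsupport φ ⊆ ext (t + R + δ) := by
    rcases (tsupport φ).eq_empty_or_nonempty with hE | hne
    · exact ⟨1, one_pos, by simp [hE]⟩
    · obtain ⟨y, hy, hmin⟩ := hφ.compact.isCompact.exists_isMinOn hne continuous_norm.continuousOn
      have h1 : t + R < ‖y‖ := hφ.supp hy
      refine ⟨(‖y‖ - (t + R)) / 2, by linarith, fun z hz => ?_⟩
      have h2 : ‖y‖ ≤ ‖z‖ := hmin hz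
      simp only [ext, Set.mem_ofPred_eq]
      linarith
  filter_upwards [Ioo_mem_nhds ht (lt_add_of_pos_right t hδ)] with s hs
  refine ⟨hs.1.le, hφ.smooth, hφ.compact, hsub.trans fun x hx => ?_⟩
  have : t + R + δ < ‖x‖ := hx
  simp only [ext, Set.mem_ofPred_eq]
  linarith [hs.2]

lemma ExtRep.exists_isTimeDeriv {R : ℝ} {u : ℝ → E4 → ℝ} {F : E4 → ℂ} (h : ExtRep R u F)
    (hi : ∀ θ : 𝓢(E4, ℂ), Integrable fun ξ => F ξ * θ ξ)
    (hF : MemLp (freq F) 2 volume) {t : ℝ} (ht : 0 < t) :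
    ∃ w : E4 → ℝ, IsTimeDeriv (ext (t + R)) u t w ∧ MemLp w 2 volume ∧
      eLpNorm w 2 volume ≤ eLpNorm (freq F) 2 volume := by
  refine ExteriorWave.exists_isTimeDeriv hi (fun φ θ hφ hθ => ?_) hF
  filter_upwards [hφ.eventually_ext ht] with s hs
  exact (h.repOn s hs.1).rep φ θ hs.2 hθ

/-! ### Divergence theorem along characteristics, primitives in time, and the weight. -/

section Characteristics

lemma pd_add_dir {V : Type*} [NormedAddCommGroup V] [NormedSpace ℝ V] (v w : V) (u : V → ℝ)
    (p : V) : pd (v + w) u p = pd v u p + pd w u p := map_add _ _ _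

lemma pd_sub_dir {V : Type*} [NormedAddCommGroup V] [NormedSpace ℝ V] (v w : V) (u : V → ℝ)
    (p : V) : pd (v - w) u p = pd v u p - pd w u p := map_sub _ _ _

lemma pd_eq_of_hasDerivAt {V : Type*} [NormedAddCommGroup V] [NormedSpace ℝ V] {v : V} {u : V → ℝ}
    {p : V} {γ : ℝ → V} {c : ℝ} (hu : DifferentiableAt ℝ u p) (hγ : HasDerivAt γ v 0)
    (h0 : γ 0 = p) (h : HasDerivAt (fun s => u (γ s)) c 0) : pd v u p = c := by
  subst h0
  exact (hu.hasFDerivAt.comp_hasDerivAt 0 hγ).unique h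

/-- The forward outgoing direction of the plane. -/
abbrev dout : ℝ × ℝ := (1, 0) + (0, 1)

/-- The forward incoming direction of the plane. -/
abbrev din : ℝ × ℝ := (1, 0) - (0, 1)

/-- The outgoing strip `{R ≤ r - t ≤ M}` for times in `[T₁, T₂]`. -/
def strip (R M T₁ T₂ : ℝ) : Set (ℝ × ℝ) := {p | p.1 ∈ Set.Icc T₁ T₂ ∧ p.2 - p.1 ∈ Set.Icc R M}

/-- The divergence theorem in an outgoing strip. -/
theorem integral_le_integral_of_flux {R M T₁ T₂ : ℝ} (hT : T₁ ≤ T₂) (hM : R ≤ M)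
    {k₁ k₂ D : ℝ × ℝ → ℝ} (h₁ : ∀ p ∈ strip R M T₁ T₂, DifferentiableAt ℝ k₁ p)
    (h₂ : ∀ p ∈ strip R M T₁ T₂, DifferentiableAt ℝ k₂ p)
    (hD : ∀ p ∈ strip R M T₁ T₂, pd dout k₁ p + pd din k₂ p = D p)
    (hDc : ContinuousOn D (strip R M T₁ T₂)) (hD0 : ∀ p ∈ strip R M T₁ T₂, 0 ≤ D p)
    (hM0 : ∀ t ∈ Set.Icc T₁ T₂, k₂ (t, M + t) = 0)
    (hR0 : ∀ t ∈ Set.Icc T₁ T₂, k₂ (t, R + t) ≤ 0) :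
    ∫ η in R..M, (k₁ (T₁, η + T₁) + k₂ (T₁, η + T₁)) ≤
      ∫ η in R..M, (k₁ (T₂, η + T₂) + k₂ (T₂, η + T₂)) := by
  -- In the coordinates (t, η) with η = r - t, the outgoing direction is ∂_t and the incoming one is
  -- ∂_t - 2 ∂_η; the field becomes (k₁ + k₂, -2 k₂) on a rectangle.
  let σ : ℝ × ℝ → ℝ × ℝ := fun p => (p.1, p.2 + p.1)
  have hσ : ∀ p, HasFDerivAt σ ((ContinuousLinearMap.fst ℝ ℝ ℝ).prod
      (ContinuousLinearMap.snd ℝ ℝ ℝ + ContinuousLinearMap.fst ℝ ℝ ℝ)) p := fun p =>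
    hasFDerivAt_fst.prodMk (hasFDerivAt_snd.add hasFDerivAt_fst)
  have hmaps : Set.MapsTo σ (Set.uIcc T₁ T₂ ×ˢ Set.uIcc R M) (strip R M T₁ T₂) := by
    rintro ⟨t, η⟩ ⟨h1, h2⟩
    rw [Set.uIcc_of_le hT] at h1
    rw [Set.uIcc_of_le hM] at h2
    exact ⟨h1, by simpa [σ] using h2⟩
  have hIoo : ∀ p ∈ Set.Ioo (min T₁ T₂) (max T₁ T₂) ×ˢ Set.Ioo (min R M) (max R M),
      p ∈ Set.uIcc T₁ T₂ ×ˢ Set.uIcc R M := fun p hp =>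
    ⟨Set.Ioo_subset_Icc_self hp.1, Set.Ioo_subset_Icc_self hp.2⟩
  set f : ℝ × ℝ → ℝ := fun p => k₁ (σ p) + k₂ (σ p) with hf
  set g : ℝ × ℝ → ℝ := fun p => -2 * k₂ (σ p) with hg
  have hf' : ∀ p, σ p ∈ strip R M T₁ T₂ → HasFDerivAt f _ p := fun p hp =>
    ((h₁ _ hp).hasFDerivAt.comp p (hσ p)).add ((h₂ _ hp).hasFDerivAt.comp p (hσ p))
  have hg' : ∀ p, σ p ∈ strip R M T₁ T₂ → HasFDerivAt g _ p := fun p hp =>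
    ((h₂ _ hp).hasFDerivAt.comp p (hσ p)).const_mul (-2)
  have hcont : ∀ h : ℝ × ℝ → ℝ, (∀ p, σ p ∈ strip R M T₁ T₂ → DifferentiableAt ℝ h p) →
      ContinuousOn h (Set.uIcc T₁ T₂ ×ˢ Set.uIcc R M) := fun h hh p hp =>
    (hh p (hmaps hp)).continuousAt.continuousWithinAt
  have hdiv : ∀ p, σ p ∈ strip R M T₁ T₂ →
      fderiv ℝ f p (1, 0) + fderiv ℝ g p (0, 1) = D (σ p) := by
    intro p hp
    rw [(hf' p hp).fderiv, (hg' p hp).fderiv, ← hD _ hp]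
    have e1 : ((1 : ℝ), (1 : ℝ)) = dout := by simp
    have e2 : pd din k₂ (σ p) = pd dout k₂ (σ p) - 2 * pd (0, 1) k₂ (σ p) := by
      rw [pd_add_dir, pd_sub_dir]; ring
    rw [e2]
    simp [pd]
    ring
  have hDσ : ContinuousOn (fun p => D (σ p)) (Set.uIcc T₁ T₂ ×ˢ Set.uIcc R M) :=
    hDc.comp (Continuous.continuousOn (by fun_prop)) hmaps
  have key := integral2_divergence_prod_of_hasFDerivAt f g (fderiv ℝ f) (fderiv ℝ g) T₁ R T₂ M
    (hcont f fun p hp => (hf' p hp).differentiableAt)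
    (hcont g fun p hp => (hg' p hp).differentiableAt)
    (fun p hp => (hf' p (hmaps (hIoo p hp))).differentiableAt.hasFDerivAt)
    (fun p hp => (hg' p (hmaps (hIoo p hp))).differentiableAt.hasFDerivAt) (by
      refine ContinuousOn.integrableOn_compact (isCompact_uIcc.prod isCompact_uIcc) ?_
      exact hDσ.congr fun p hp => hdiv p (hmaps hp))
  have hL : 0 ≤ ∫ x in T₁..T₂, ∫ y in R..M,
      fderiv ℝ f (x, y) (1, 0) + fderiv ℝ g (x, y) (0, 1) := by
    refine intervalIntegral.integral_nonneg hT fun t ht =>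
      intervalIntegral.integral_nonneg hM fun η hη => ?_
    have : σ (t, η) ∈ strip R M T₁ T₂ :=
      hmaps ⟨by rwa [Set.uIcc_of_le hT], by rwa [Set.uIcc_of_le hM]⟩
    rw [hdiv _ this]
    exact hD0 _ this
  have hgM : ∫ t in T₁..T₂, g (t, M) = 0 := by
    rw [intervalIntegral.integral_congr (g := fun _ => 0), intervalIntegral.integral_zero]
    intro t ht
    rw [Set.uIcc_of_le hT] at ht
    simp [hg, σ, hM0 t ht]
  have hgR : 0 ≤ ∫ t in T₁..T₂, g (t, R) :=
    intervalIntegral.integral_nonneg hT fun t ht => by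
      have := hR0 t ht
      simp only [hg, σ]
      linarith
  simp only [hf, σ] at key
  linarith

/-- The primitive in time of a smooth function. -/
def timePrimitive (f : ℝ × ℝ → ℝ) (p : ℝ × ℝ) : ℝ := ∫ s in (0 : ℝ)..p.1, f (s, p.2)

lemma continuous_timePrimitive {f : ℝ × ℝ → ℝ} (hf : Continuous f) :
    Continuous (timePrimitive f) := by
  unfold timePrimitive
  refine intervalIntegral.continuous_parametric_intervalIntegral_of_continuous (μ := volume)
    (f := fun p s => f (s, p.2)) ?_ continuous_fst
  unfold Function.uncurry
  fun_prop

lemma hasDerivAt_timePrimitive_snd {f : ℝ × ℝ → ℝ} (hf : ContDiff ℝ ∞ f) (t r : ℝ) :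
    HasDerivAt (fun r => timePrimitive f (t, r)) (timePrimitive (pd (0, 1) f) (t, r)) r := by
  have hd : ∀ r s, HasDerivAt (fun r : ℝ => f (s, r)) (pd (0, 1) f (s, r)) r := fun r s =>
    hasDerivAt_comp_curve hf ((hasDerivAt_const r s).prodMk (hasDerivAt_id r))
  have hc := (contDiff_pd hf (0, 1)).continuous
  have hf' := hf.continuous
  have h := fun a b => hasDerivAt_integral_of_isCompact (μ := (volume : Measure ℝ))
    (isCompact_Icc (a := a) (b := b)) isCompact_Icc.measure_lt_top
    (k := fun q => f (q.2, q.1)) (k' := fun q => pd (0, 1) f (q.2, q.1)) (by fun_prop)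
    (by fun_prop) (fun r s => hd r s) r
  unfold timePrimitive
  rcases le_total 0 t with ht | ht
  · simpa only [intervalIntegral.integral_of_le ht, ← integral_Icc_eq_integral_Ioc] using h 0 t
  · simpa only [intervalIntegral.integral_of_ge ht, ← integral_Icc_eq_integral_Ioc] using (h t 0).fun_neg

lemma hasDerivAt_timePrimitive_fst {f : ℝ × ℝ → ℝ} (hf : Continuous f) (t r : ℝ) :
    HasDerivAt (fun t => timePrimitive f (t, r)) (f (t, r)) t := by
  have hc : Continuous fun s : ℝ => f (s, r) := by fun_prop
  exact intervalIntegral.integral_hasDerivAt_right (hc.intervalIntegrable _ _)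
    (hc.stronglyMeasurableAtFilter _ _) hc.continuousAt

lemma hasFDerivAt_timePrimitive {f : ℝ × ℝ → ℝ} (hf : ContDiff ℝ ∞ f) (p : ℝ × ℝ) :
    HasFDerivAt (timePrimitive f)
      ((ContinuousLinearMap.toSpanSingleton ℝ (f p)).coprod
        (ContinuousLinearMap.toSpanSingleton ℝ (timePrimitive (pd (0, 1) f) p))) p := by
  have hc := continuous_timePrimitive (contDiff_pd hf (0, 1)).continuous
  refine (hasStrictFDerivAt_uncurry_coprod (f := fun t r => timePrimitive f (t, r))
    (f₁ := fun t r => ContinuousLinearMap.toSpanSingleton ℝ (f (t, r)))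
    (f₂ := fun t r => ContinuousLinearMap.toSpanSingleton ℝ (timePrimitive (pd (0, 1) f) (t, r)))
    (.of_forall fun v => (hasDerivAt_timePrimitive_fst hf.continuous v.1 v.2).hasFDerivAt)
    (.of_forall fun v => (hasDerivAt_timePrimitive_snd hf v.1 v.2).hasFDerivAt)
    ?_ ?_).hasFDerivAt
  · exact ((ContinuousLinearMap.toSpanSingletonCLE (𝕜 := ℝ) (E := ℝ)).continuous.comp
      hf.continuous).continuousAt
  · exact ((ContinuousLinearMap.toSpanSingletonCLE (𝕜 := ℝ) (E := ℝ)).continuous.comp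
      hc).continuousAt

/-- The polynomial weight of the exterior energy estimate. -/
def weight (y : ℝ) : ℝ := 1 - 53 / 50 * y + 2 * y ^ 2 - 4 / 3 * y ^ 3

/-- The opposite of the derivative of `weight`. -/
def weight' (y : ℝ) : ℝ := 53 / 50 - 4 * y + 4 * y ^ 2

lemma hasDerivAt_weight (y : ℝ) : HasDerivAt weight (-weight' y) y := by
  have := (((hasDerivAt_const y (1 : ℝ)).sub ((hasDerivAt_id y).const_mul (53 / 50))).add
    ((hasDerivAt_pow 2 y).const_mul 2)).sub ((hasDerivAt_pow 3 y).const_mul (4 / 3))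
  refine this.congr_deriv ?_
  simp [weight']
  ring

lemma weight_le_one {y : ℝ} (h0 : 0 ≤ y) : weight y ≤ 1 := by
  unfold weight; nlinarith [mul_nonneg h0 (sq_nonneg (y - 3 / 4))]

/-- The difference of the two sides has positive coefficients in the Bernstein basis of degree ten
on [0, 1]. After division by (1 + y²)⁴ the statement is the Riccati inequality required by
`flux_nonneg`, with w the opposite of the derivative of g. -/
lemma weight_sub_sq_le {y : ℝ} (h0 : 0 ≤ y) (h1 : y ≤ 1) :
    (weight y - y * (1 + y ^ 2) ^ 2) ^ 2 ≤ weight' y * (1 + y ^ 2) ^ 4 := by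
  have hz : 0 ≤ 1 - y := by linarith
  have : weight' y * (1 + y ^ 2) ^ 4 - (weight y - y * (1 + y ^ 2) ^ 2) ^ 2 =
      3 / 50 * (1 - y) ^ 10 + 18 / 25 * y * (1 - y) ^ 9 + 9441 / 2500 * y ^ 2 * (1 - y) ^ 8
      + 19496 / 1875 * y ^ 3 * (1 - y) ^ 7 + 36661 / 1875 * y ^ 4 * (1 - y) ^ 6
      + 49072 / 1875 * y ^ 5 * (1 - y) ^ 5 + 63623 / 2250 * y ^ 6 * (1 - y) ^ 4
      + 139016 / 5625 * y ^ 7 * (1 - y) ^ 3 + 11962 / 625 * y ^ 8 * (1 - y) ^ 2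
      + 63263 / 5625 * y ^ 9 * (1 - y) + 122519 / 22500 * y ^ 10 := by
    unfold weight weight'; ring
  have h2 : 0 ≤ weight' y * (1 + y ^ 2) ^ 4 - (weight y - y * (1 + y ^ 2) ^ 2) ^ 2 := by
    rw [this]; positivity
  linarith

end Characteristics

/-! ### The radial wave equation: energy, pointwise decay and the potential. -/

/-- Smooth solutions of the radial wave equation in dimension four, at rest for `t = 0` and
supported in `{r ≤ t + M}`. -/
structure IsRadialWave (M : ℝ) (U : ℝ × ℝ → ℝ) : Prop where
  smooth : ContDiff ℝ ∞ U
  wave : ∀ t r, 0 < r → r * pd (1, 0) (pd (1, 0) U) (t, r) =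
    r * pd (0, 1) (pd (0, 1) U) (t, r) + 3 * pd (0, 1) U (t, r)
  init : ∀ r, 0 < r → pd (1, 0) U (0, r) = 0
  supp : ∀ t r, 0 ≤ t → t + M ≤ r → U (t, r) = 0

lemma hasDerivAt_line {V : Type*} [NormedAddCommGroup V] [NormedSpace ℝ V] (p v : V) (s : ℝ) :
    HasDerivAt (fun s : ℝ => p + s • v) v s := by
  simpa using ((hasDerivAt_id s).smul_const v).const_add p

lemma hasDerivAt_comp_line {V : Type*} [NormedAddCommGroup V] [NormedSpace ℝ V] {u : V → ℝ}
    (hu : ContDiff ℝ ∞ u) (p v : V) : HasDerivAt (fun s : ℝ => u (p + s • v)) (pd v u p) 0 := by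
  simpa using hasDerivAt_comp_curve hu (hasDerivAt_line p v 0)

lemma hasDerivAt_line_of_differentiableAt {V : Type*} [NormedAddCommGroup V] [NormedSpace ℝ V]
    {u : V → ℝ} {p : V} (hu : DifferentiableAt ℝ u p) (v : V) :
    HasDerivAt (fun s : ℝ => u (p + s • v)) (pd v u p) 0 :=
  hu.hasFDerivAt.comp_hasDerivAt_of_eq 0 (hasDerivAt_line p v 0) (by simp)

lemma pd_eq_of_hasDerivAt_line {V : Type*} [NormedAddCommGroup V] [NormedSpace ℝ V] {v : V}
    {u : V → ℝ} {p : V} {c : ℝ} (hu : DifferentiableAt ℝ u p)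
    (h : HasDerivAt (fun s : ℝ => u (p + s • v)) c 0) : pd v u p = c :=
  pd_eq_of_hasDerivAt hu (hasDerivAt_line p v 0) (by simp) h

lemma hasDerivAt_snd_line (p v : ℝ × ℝ) : HasDerivAt (fun s : ℝ => (p + s • v).2) v.2 0 :=
  by simpa using ((hasDerivAt_id (0 : ℝ)).mul_const v.2).const_add p.2

lemma hasDerivAt_fst_line (p v : ℝ × ℝ) : HasDerivAt (fun s : ℝ => (p + s • v).1) v.1 0 :=
  by simpa using ((hasDerivAt_id (0 : ℝ)).mul_const v.1).const_add p.1

lemma deriv_eq_zero_of_right {f : ℝ → ℝ} {c : ℝ} (h : HasDerivAt f c 0)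
    (h0 : ∀ s, 0 ≤ s → f s = 0) : c = 0 := by
  have h1 : HasDerivWithinAt f 0 (Set.Ici 0) 0 :=
    (hasDerivWithinAt_const (0 : ℝ) (Set.Ici 0) (0 : ℝ)).congr (fun s hs => h0 s hs) (h0 0 le_rfl)
  exact (uniqueDiffWithinAt_Ici (0 : ℝ)).eq_deriv _ h.hasDerivWithinAt h1

lemma sq_intervalIntegral_le {f : ℝ → ℝ} (hf : Continuous f) {a b : ℝ} (hab : a ≤ b) :
    (∫ x in a..b, f x) ^ 2 ≤ (b - a) * ∫ x in a..b, f x ^ 2 := by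
  rcases hab.eq_or_lt with rfl | h
  · simp
  set m := (∫ x in a..b, f x) / (b - a) with hm
  have h0 : 0 < b - a := sub_pos.2 h
  have h1 : 0 ≤ ∫ x in a..b, (f x - m) ^ 2 :=
    intervalIntegral.integral_nonneg hab fun x _ => sq_nonneg _
  have h2 : ∫ x in a..b, (f x - m) ^ 2 =
      (∫ x in a..b, f x ^ 2) - 2 * m * (∫ x in a..b, f x) + m ^ 2 * (b - a) := by
    have e : ∀ x, (f x - m) ^ 2 = f x ^ 2 - 2 * m * f x + m ^ 2 := fun x => by ring
    simp_rw [e]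
    rw [intervalIntegral.integral_add, intervalIntegral.integral_sub,
      intervalIntegral.integral_const_mul, intervalIntegral.integral_const, smul_eq_mul]
    · ring
    all_goals exact Continuous.intervalIntegrable (by fun_prop) _ _
  have h3 : ∫ x in a..b, f x = m * (b - a) := by rw [hm]; field_simp
  rw [h3] at h2 ⊢
  nlinarith

namespace IsRadialWave

variable {M R : ℝ} {U : ℝ × ℝ → ℝ}

lemma pd_snd_eq_zero (h : IsRadialWave M U) {t r : ℝ} (ht : 0 ≤ t) (hr : t + M ≤ r) :
    pd (0, 1) U (t, r) = 0 :=
  deriv_eq_zero_of_right (hasDerivAt_comp_line h.smooth (t, r) (0, 1)) fun s hs => by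
    simpa using h.supp t (r + s) ht (by linarith)

lemma pd_fst_eq_zero (h : IsRadialWave M U) {t r : ℝ} (ht : 0 ≤ t) (hr : t + M ≤ r) :
    pd (1, 0) U (t, r) = 0 := by
  have h1 : pd dout U (t, r) = 0 :=
    deriv_eq_zero_of_right (hasDerivAt_comp_line h.smooth (t, r) dout) fun s hs => by
      simpa using h.supp (t + s) (r + s) (by linarith) (by linarith)
  rw [pd_add_dir, h.pd_snd_eq_zero ht hr, add_zero] at h1
  exact h1

/-- The exterior energy density in the radial variable. -/
def dens (U : ℝ × ℝ → ℝ) (p : ℝ × ℝ) : ℝ := p.2 ^ 3 * (pd (1, 0) U p ^ 2 + pd (0, 1) U p ^ 2)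

/-- The exterior energy. -/
def energy (U : ℝ × ℝ → ℝ) (R M t : ℝ) : ℝ := ∫ η in R..M, dens U (t, η + t)

lemma continuous_dens (h : IsRadialWave M U) : Continuous (dens U) := by
  have h1 := (contDiff_pd h.smooth (1, 0)).continuous
  have h2 := (contDiff_pd h.smooth (0, 1)).continuous
  unfold dens; fun_prop

lemma dens_nonneg {p : ℝ × ℝ} (hp : 0 ≤ p.2) : 0 ≤ dens U p := by unfold dens; positivity

/-- The outgoing derivative of r³ (U_t - U_r)² and the incoming derivative of r³ (U_t + U_r)² cancel
by the wave equation, and the flux through r = t + R has a sign. -/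
lemma energy_anti (h : IsRadialWave M U) (hR : 0 < R) (hM : R ≤ M) {T₁ T₂ : ℝ} (h0 : 0 ≤ T₁)
    (hT : T₁ ≤ T₂) : energy U R M T₂ ≤ energy U R M T₁ := by
  have c1 := contDiff_pd h.smooth (1, 0)
  have c2 := contDiff_pd h.smooth (0, 1)
  have d1 : Differentiable ℝ (pd (1, 0) U) := c1.differentiable (by simp)
  have d2 : Differentiable ℝ (pd (0, 1) U) := c2.differentiable (by simp)
  let k₁ : ℝ × ℝ → ℝ := fun p => -(p.2 ^ 3 * (pd (1, 0) U p - pd (0, 1) U p) ^ 2 / 2)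
  let k₂ : ℝ × ℝ → ℝ := fun p => -(p.2 ^ 3 * (pd (1, 0) U p + pd (0, 1) U p) ^ 2 / 2)
  have key := integral_le_integral_of_flux (R := R) (M := M) hT hM (k₁ := k₁) (k₂ := k₂)
    (D := fun _ => 0)
    (fun p _ => by fun_prop) (fun p _ => by fun_prop) ?_ continuousOn_const (fun _ _ => le_rfl)
    ?_ ?_
  · have e : ∀ p : ℝ × ℝ, k₁ p + k₂ p = -dens U p := fun p => by
      simp only [k₁, k₂, dens]; ring
    simp only [e, intervalIntegral.integral_neg] at key
    unfold energy
    linarith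
  · rintro ⟨t, r⟩ ⟨⟨ht, -⟩, hr, -⟩
    simp only at ht hr
    have hr0 : 0 < r := by linarith
    have w := h.wave t r hr0
    have hcomm : pd (0, 1) (pd (1, 0) U) (t, r) = pd (1, 0) (pd (0, 1) U) (t, r) := by
      rw [pd_comm h.smooth]
    have a1 := (((hasDerivAt_snd_line (t, r) dout).pow 3).mul
      (((hasDerivAt_comp_line c1 (t, r) dout).sub (hasDerivAt_comp_line c2 (t, r) dout)).pow
        2)).div_const 2 |>.neg
    have a2 := (((hasDerivAt_snd_line (t, r) din).pow 3).mul
      (((hasDerivAt_comp_line c1 (t, r) din).add (hasDerivAt_comp_line c2 (t, r) din)).pow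
        2)).div_const 2 |>.neg
    rw [pd_eq_of_hasDerivAt_line (u := k₁) (by fun_prop) a1,
      pd_eq_of_hasDerivAt_line (u := k₂) (by fun_prop) a2]
    simp only [pd_add_dir, pd_sub_dir, hcomm, zero_smul, add_zero, Pi.pow_apply, Pi.add_apply,
      Pi.sub_apply]
    simp
    linear_combination (-2 * r ^ 2 * pd (1, 0) U (t, r)) * w
  · intro t ht
    have ht0 : 0 ≤ t := h0.trans ht.1
    simp [k₂, h.pd_fst_eq_zero ht0 (add_comm M t).ge.ge.le, h.pd_snd_eq_zero ht0 (add_comm M t).ge.ge.le]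
  · intro t ht
    have : 0 ≤ R + t := by linarith [h0.trans ht.1]
    simp only [k₂, Left.neg_nonpos_iff]
    positivity

/-- Cauchy–Schwarz in the strip. -/
lemma sq_integral_mul_le (h : IsRadialWave M U) (hR : 0 < R) {t r : ℝ} (ht : 0 ≤ t)
    (hr : R ≤ r - t) (hr' : r - t ≤ M) {f : ℝ → ℝ} (hf : Continuous f) {c : ℝ} (hc : 0 ≤ c)
    (hfd : ∀ ρ, r ≤ ρ → f ρ ^ 2 * c ≤ dens U (t, ρ)) :
    (∫ ρ in r..(t + M), f ρ) ^ 2 * c ≤ (M - R) * energy U R M t := by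
  have hd := h.continuous_dens
  have hdt : Continuous fun ρ => dens U (t, ρ) := by fun_prop
  have hrM : r ≤ t + M := by linarith
  have h1 := sq_intervalIntegral_le hf hrM
  have h2 : (∫ ρ in r..(t + M), f ρ ^ 2) * c ≤ ∫ ρ in r..(t + M), dens U (t, ρ) := by
    rw [← intervalIntegral.integral_mul_const]
    exact intervalIntegral.integral_mono_on hrM (Continuous.intervalIntegrable (by fun_prop) _ _)
      (hdt.intervalIntegrable _ _) fun ρ hρ => hfd ρ hρ.1
  have h3 : ∫ ρ in r..(t + M), dens U (t, ρ) ≤ energy U R M t := by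
    have e : energy U R M t = ∫ ρ in (R + t)..(t + M), dens U (t, ρ) := by
      rw [energy, intervalIntegral.integral_comp_add_right (fun ρ => dens U (t, ρ)), add_comm M t]
    rw [e, ← intervalIntegral.integral_add_adjacent_intervals (hdt.intervalIntegrable (R + t) r)
      (hdt.intervalIntegrable _ _)]
    have : 0 ≤ ∫ ρ in (R + t)..r, dens U (t, ρ) :=
      intervalIntegral.integral_nonneg (by linarith) fun ρ hρ =>
        dens_nonneg (by simp only; linarith [hρ.1])
    linarith
  have h4 : 0 ≤ ∫ ρ in r..(t + M), f ρ ^ 2 :=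
    intervalIntegral.integral_nonneg hrM fun ρ _ => sq_nonneg _
  calc (∫ ρ in r..(t + M), f ρ) ^ 2 * c
      ≤ ((t + M - r) * ∫ ρ in r..(t + M), f ρ ^ 2) * c := by gcongr
    _ = (t + M - r) * ((∫ ρ in r..(t + M), f ρ ^ 2) * c) := by ring
    _ ≤ (M - R) * energy U R M t := by
      have : 0 ≤ (∫ ρ in r..(t + M), f ρ ^ 2) * c := by positivity
      exact mul_le_mul (by linarith) (h2.trans h3) this (by linarith)

/-- U is the integral of -U_r from r out to the edge r = t + M, where U vanishes; the weight ρ³ ≥ r³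
of the energy gives the decay r^(-3/2). -/
lemma sq_mul_le (h : IsRadialWave M U) (hR : 0 < R) {t r : ℝ} (ht : 0 ≤ t)
    (hr : R ≤ r - t) (hr' : r - t ≤ M) : U (t, r) ^ 2 * r ^ 3 ≤ (M - R) * energy U R M t := by
  have c2 := (contDiff_pd h.smooth (0, 1)).continuous
  have hi : ∫ ρ in r..(t + M), pd (0, 1) U (t, ρ) = U (t, t + M) - U (t, r) := by
    refine intervalIntegral.integral_eq_sub_of_hasDerivAt (f := fun ρ => U (t, ρ)) (fun ρ _ => ?_)
      (Continuous.intervalIntegrable (by fun_prop) _ _)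
    exact hasDerivAt_comp_curve h.smooth ((hasDerivAt_const ρ t).prodMk (hasDerivAt_id ρ))
  have := h.sq_integral_mul_le hR ht hr hr' (f := fun ρ => pd (0, 1) U (t, ρ)) (by fun_prop)
    (c := r ^ 3) (by have : 0 ≤ r := by linarith
                     positivity) fun ρ hρ => by
      have h0 : 0 ≤ r := by linarith
      have h1 : r ^ 3 ≤ ρ ^ 3 := by gcongr
      have h2 := mul_le_mul_of_nonneg_left h1 (sq_nonneg (pd (0, 1) U (t, ρ)))
      have h3 : 0 ≤ ρ ^ 3 := by have := h0.trans hρ; positivity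
      have h4 := mul_nonneg h3 (sq_nonneg (pd (1, 0) U (t, ρ)))
      simp only [dens]
      linarith
  rw [hi, h.supp t (t + M) ht le_rfl] at this
  linarith

/-- The source of the potential of a radial wave. -/
def source (U : ℝ × ℝ → ℝ) (p : ℝ × ℝ) : ℝ := p.2 * pd (0, 1) U p + 2 * U p

lemma contDiff_source (h : IsRadialWave M U) : ContDiff ℝ ∞ (source U) := by
  have h1 := contDiff_pd h.smooth (0, 1)
  have h2 := h.smooth
  unfold source; fun_prop

/-- A function `W` with `W_t = r U_r + 2 U` and `W_r = r U_t`. -/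
def potential (U : ℝ × ℝ → ℝ) : ℝ × ℝ → ℝ := timePrimitive (source U)

/-- The wave equation turns ∂_r (r U_r + 2 U) = r U_rr + 3 U_r into r U_tt, and U_t vanishes at time
zero. This is the identity W_r = r U_t. -/
lemma timePrimitive_pd_source (h : IsRadialWave M U) {t r : ℝ} (hr : 0 < r) :
    timePrimitive (pd (0, 1) (source U)) (t, r) = r * pd (1, 0) U (t, r) := by
  have c1 := contDiff_pd h.smooth (1, 0)
  have c2 := contDiff_pd h.smooth (0, 1)
  have c11 := (contDiff_pd c1 (1, 0)).continuous
  have e : ∀ s, pd (0, 1) (source U) (s, r) = r * pd (1, 0) (pd (1, 0) U) (s, r) := by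
    intro s
    have a := ((hasDerivAt_snd_line (s, r) (0, 1)).mul
      (hasDerivAt_comp_line c2 (s, r) (0, 1))).add
        ((hasDerivAt_comp_line h.smooth (s, r) (0, 1)).const_mul 2)
    rw [pd_eq_of_hasDerivAt_line (h.contDiff_source.differentiable (by simp) _) a, h.wave s r hr]
    simp
    ring
  simp only [timePrimitive, e, intervalIntegral.integral_const_mul]
  rw [intervalIntegral.integral_eq_sub_of_hasDerivAt (f := fun s => pd (1, 0) U (s, r))
    (fun s _ => hasDerivAt_comp_curve c1 ((hasDerivAt_id s).prodMk (hasDerivAt_const s r)))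
    (Continuous.intervalIntegrable (by fun_prop) _ _), h.init r hr, sub_zero]

lemma differentiable_potential (h : IsRadialWave M U) : Differentiable ℝ (potential U) :=
  fun p => (hasFDerivAt_timePrimitive h.contDiff_source p).differentiableAt

lemma pd_potential (h : IsRadialWave M U) {p : ℝ × ℝ} (hp : 0 < p.2) (v : ℝ × ℝ) :
    pd v (potential U) p = v.1 * source U p + v.2 * (p.2 * pd (1, 0) U p) := by
  have e := h.timePrimitive_pd_source (t := p.1) hp
  rw [pd, potential, (hasFDerivAt_timePrimitive h.contDiff_source p).fderiv]
  simp [e]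

lemma potential_zero (r : ℝ) : potential U (0, r) = 0 := by simp [potential, timePrimitive]

lemma potential_eq_zero (h : IsRadialWave M U) {t r : ℝ} (ht : 0 ≤ t) (hr : t + M ≤ r) :
    potential U (t, r) = 0 := by
  unfold potential timePrimitive
  rw [intervalIntegral.integral_congr (g := fun _ => 0), intervalIntegral.integral_zero]
  intro s hs
  simp only at hs
  rw [Set.uIcc_of_le ht] at hs
  simp [source, h.supp s r hs.1 (by linarith [hs.2]),
    h.pd_snd_eq_zero hs.1 (show s + M ≤ r by linarith [hs.2])]

/-- The argument of `sq_mul_le` with W_r = r U_t in place of U_r: two powers of the weight go into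
r² U_t², which leaves a single factor r. -/
lemma sq_potential_mul_le (h : IsRadialWave M U) (hR : 0 < R) {t r : ℝ} (ht : 0 ≤ t)
    (hr : R ≤ r - t) (hr' : r - t ≤ M) :
    potential U (t, r) ^ 2 * r ≤ (M - R) * energy U R M t := by
  have c1 := (contDiff_pd h.smooth (1, 0)).continuous
  have hi : ∫ ρ in r..(t + M), ρ * pd (1, 0) U (t, ρ) =
      potential U (t, t + M) - potential U (t, r) := by
    refine intervalIntegral.integral_eq_sub_of_hasDerivAt (f := fun ρ => potential U (t, ρ))
      (fun ρ hρ => ?_) (Continuous.intervalIntegrable (by fun_prop) _ _)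
    rw [Set.uIcc_of_le (by linarith)] at hρ
    have := hasDerivAt_timePrimitive_snd h.contDiff_source t ρ
    rwa [h.timePrimitive_pd_source (by linarith [hρ.1])] at this
  have := h.sq_integral_mul_le hR ht hr hr' (f := fun ρ => ρ * pd (1, 0) U (t, ρ)) (by fun_prop)
    (c := r) (by linarith) fun ρ hρ => by
      have h0 : 0 ≤ r := by linarith
      have h3 : 0 ≤ ρ ^ 3 := by have := h0.trans hρ; positivity
      have h4 := mul_nonneg h3 (sq_nonneg (pd (0, 1) U (t, ρ)))
      have h5 := mul_le_mul_of_nonneg_left hρ (sq_nonneg (ρ * pd (1, 0) U (t, ρ)))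
      simp only [dens]
      nlinarith
  rw [hi, h.potential_eq_zero ht le_rfl] at this
  linarith

end IsRadialWave

lemma differentiableAt_div {V : Type*} [NormedAddCommGroup V] [NormedSpace ℝ V] {f g : V → ℝ}
    {p : V} (hf : DifferentiableAt ℝ f p) (hg : DifferentiableAt ℝ g p) (h0 : g p ≠ 0) :
    DifferentiableAt ℝ (fun p => f p / g p) p := by
  simpa only [div_eq_mul_inv] using hf.fun_mul (hg.fun_inv h0)

/-! ### The weighted flux estimate for the potential. -/

namespace IsRadialWave

variable {M R : ℝ} {U : ℝ × ℝ → ℝ}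

/-- The ratio of the null coordinates. -/
def nullRatio (p : ℝ × ℝ) : ℝ := √((p.2 - p.1) / (p.2 + p.1))

/-- The incoming derivative of `√r W`, multiplied by `√r`. -/
def incoming (U : ℝ × ℝ → ℝ) (p : ℝ × ℝ) : ℝ :=
  p.2 * source U p - potential U p / 2 - p.2 ^ 2 * pd (1, 0) U p

lemma differentiable_incoming (h : IsRadialWave M U) : Differentiable ℝ (incoming U) := by
  have d1 : Differentiable ℝ (pd (1, 0) U) :=
    (contDiff_pd h.smooth (1, 0)).differentiable (by simp)
  have d2 : Differentiable ℝ (source U) := h.contDiff_source.differentiable (by simp)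
  have d3 := h.differentiable_potential
  unfold incoming
  fun_prop

/-- As W solves the radial wave equation in dimension two, V = √r W satisfies V_tt - V_rr = V / (4
r²). This is the same equation written for √r (V_t - V_r). -/
lemma pd_dout_incoming (h : IsRadialWave M U) {p : ℝ × ℝ} (hp : 0 < p.2) :
    pd dout (incoming U) p = incoming U p / (2 * p.2) + potential U p / (4 * p.2) := by
  obtain ⟨t, r⟩ := p
  simp only at hp
  have c1 := contDiff_pd h.smooth (1, 0)
  have c2 := contDiff_pd h.smooth (0, 1)
  have w := h.wave t r hp
  have hcomm : pd (0, 1) (pd (1, 0) U) (t, r) = pd (1, 0) (pd (0, 1) U) (t, r) := by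
    rw [pd_comm h.smooth]
  have aW : HasDerivAt (fun s : ℝ => potential U ((t, r) + s • dout))
      (pd dout (potential U) (t, r)) 0 :=
    hasDerivAt_line_of_differentiableAt (h.differentiable_potential _) _
  have aS := ((hasDerivAt_snd_line (t, r) dout).mul (hasDerivAt_comp_line c2 (t, r) dout)).add
    ((hasDerivAt_comp_line h.smooth (t, r) dout).const_mul 2)
  have a := (((hasDerivAt_snd_line (t, r) dout).mul aS).sub (aW.div_const 2)).sub
    (((hasDerivAt_snd_line (t, r) dout).pow 2).mul (hasDerivAt_comp_line c1 (t, r) dout))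
  rw [pd_eq_of_hasDerivAt_line (h.differentiable_incoming _) a, h.pd_potential hp]
  simp only [pd_add_dir, hcomm, incoming, source, Pi.pow_apply, Pi.add_apply, Pi.mul_apply]
  simp
  field_simp
  linear_combination (-16 * r ^ 2) * w

lemma pd_din_potential (h : IsRadialWave M U) {p : ℝ × ℝ} (hp : 0 < p.2) :
    pd din (potential U) p = incoming U p / p.2 + potential U p / (2 * p.2) := by
  rw [h.pd_potential hp, incoming]
  simp
  field_simp
  ring

/-- With ξ = r + t and y² = (r - t)/(r + t) one has r = ξ (1 + y²)/2. Setting k = g/(1 + y²)² - y,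
the hypothesis is k² ≤ w, and completing the square in W leaves a square plus a multiple of w - k².
-/
lemma flux_nonneg {ξ y Q W g w : ℝ} (hξ : 0 < ξ) (hy : 0 < y)
    (hg : (g - y * (1 + y ^ 2) ^ 2) ^ 2 ≤ w * (1 + y ^ 2) ^ 4) :
    0 ≤ w * y * Q ^ 2 / (ξ * (ξ * (1 + y ^ 2) / 2)) + g * Q * W / (2 * (ξ * (1 + y ^ 2) / 2) ^ 2)
      - 2 * y * W * Q / ξ ^ 2 + y * (ξ * (1 + y ^ 2) / 2) * W ^ 2 / (y ^ 2 * ξ * ξ ^ 2) := by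
  set k := (g - y * (1 + y ^ 2) ^ 2) / (1 + y ^ 2) ^ 2 with hk
  have hm : 0 < 1 + y ^ 2 := by positivity
  have hkw : k ^ 2 ≤ w := by
    rw [hk, div_pow, div_le_iff₀ (by positivity)]
    calc _ ≤ _ := hg
      _ = _ := by ring
  have hgk : g = (k + y) * (1 + y ^ 2) ^ 2 := by rw [hk]; field_simp; ring
  have e : w * y * Q ^ 2 / (ξ * (ξ * (1 + y ^ 2) / 2)) + g * Q * W / (2 * (ξ * (1 + y ^ 2) / 2) ^ 2)
      - 2 * y * W * Q / ξ ^ 2 + y * (ξ * (1 + y ^ 2) / 2) * W ^ 2 / (y ^ 2 * ξ * ξ ^ 2) =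
      ((2 * k * y * Q + (1 + y ^ 2) * W) ^ 2 + 4 * (w - k ^ 2) * (y * Q) ^ 2) /
        (2 * y * (1 + y ^ 2) * ξ ^ 2) := by
    rw [hgk]
    field_simp
    ring
  rw [e]
  have : 0 ≤ w - k ^ 2 := sub_nonneg.2 hkw
  positivity

lemma continuous_incoming (h : IsRadialWave M U) : Continuous (incoming U) :=
  h.differentiable_incoming.continuous

/-- The outgoing part of the data controls the solution in the exterior of the cone. -/
theorem integral_source_le (h : IsRadialWave M U) (hR : 0 < R) (hM : R ≤ M) {T : ℝ}
    (hT : 0 ≤ T) : 3 / 5 * ∫ η in R..M, η * source U (0, η) ^ 2 ≤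
      ∫ η in R..M, incoming U (T, η + T) ^ 2 / (η + T) := by
  have dQ := h.differentiable_incoming
  have dW := h.differentiable_potential
  have hS : ∀ p ∈ strip R M 0 T, 0 < p.2 - p.1 ∧ 0 < p.2 + p.1 ∧ 0 < p.2 ∧
      0 < nullRatio p ∧ nullRatio p ≤ 1 ∧ nullRatio p ^ 2 * (p.2 + p.1) = p.2 - p.1 := by
    rintro ⟨t, r⟩ ⟨⟨h1, -⟩, h2, -⟩
    simp only at h1 h2 ⊢
    have h3 : 0 < r - t := by linarith
    have h4 : 0 < r + t := by linarith
    refine ⟨h3, h4, by linarith, Real.sqrt_pos.2 (by positivity), ?_, ?_⟩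
    · exact Real.sqrt_le_one.2 ((div_le_one h4).2 (by linarith))
    · simp only [nullRatio]
      rw [Real.sq_sqrt (by positivity)]
      field_simp
  have dy : ∀ p ∈ strip R M 0 T, DifferentiableAt ℝ nullRatio p := fun p hp => by
    obtain ⟨h1, h2, -⟩ := hS p hp
    unfold nullRatio
    have := h2.ne'
    have h3 : (p.2 - p.1) / (p.2 + p.1) ≠ 0 := by positivity
    exact (differentiableAt_div (f := fun p : ℝ × ℝ => p.2 - p.1)
      (g := fun p => p.2 + p.1) (by fun_prop) (by fun_prop) h2.ne').sqrt h3
  -- Adding k₂ costs nothing: it is zero at t = 0, where W = 0, and nonpositive later and on the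
  -- inner boundary. Its incoming derivative contributes a positive multiple of W², which absorbs
  -- the cross terms Q W.
  let k₁ : ℝ × ℝ → ℝ := fun p => weight (nullRatio p) * (incoming U p ^ 2 / p.2)
  let k₂ : ℝ × ℝ → ℝ := fun p =>
    -(nullRatio p * (p.2 * potential U p ^ 2) / (p.2 + p.1) ^ 2)
  let D : ℝ × ℝ → ℝ := fun p =>
    weight' (nullRatio p) * nullRatio p * incoming U p ^ 2 / ((p.2 + p.1) * p.2) +
      weight (nullRatio p) * incoming U p * potential U p / (2 * p.2 ^ 2)
      - 2 * nullRatio p * potential U p * incoming U p / (p.2 + p.1) ^ 2 +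
      nullRatio p * p.2 * potential U p ^ 2 / ((p.2 - p.1) * (p.2 + p.1) ^ 2)
  have dw : Differentiable ℝ weight := fun y => (hasDerivAt_weight y).differentiableAt
  have cw : Continuous weight := dw.continuous
  have cw' : Continuous weight' := by unfold weight'; fun_prop
  have hk₁ : ∀ p ∈ strip R M 0 T, DifferentiableAt ℝ k₁ p := fun p hp => by
    obtain ⟨h1, h2, h3, -⟩ := hS p hp
    exact ((dw _).comp p (dy p hp)).mul (differentiableAt_div (f := fun p => incoming U p ^ 2)
      (g := fun p => p.2) (by fun_prop) (by fun_prop) h3.ne')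
  have hk₂ : ∀ p ∈ strip R M 0 T, DifferentiableAt ℝ k₂ p := fun p hp => by
    obtain ⟨h1, h2, h3, -⟩ := hS p hp
    have := dy p hp
    exact (differentiableAt_div (f := fun p => nullRatio p * (p.2 * potential U p ^ 2))
      (g := fun p => (p.2 + p.1) ^ 2) (by fun_prop) (by fun_prop) (by positivity)).fun_neg
  have hline : ∀ (v p : ℝ × ℝ), p ∈ strip R M 0 T → HasDerivAt
      (fun s : ℝ => nullRatio (p + s • v)) ((v.2 - v.1) / (2 * nullRatio p * (p.2 + p.1)) -
        (v.2 + v.1) * nullRatio p / (2 * (p.2 + p.1))) 0 := by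
    intro v p hp
    obtain ⟨h1, h2, h3, h4, h5, h6⟩ := hS p hp
    have a := ((hasDerivAt_snd_line p v).sub (hasDerivAt_fst_line p v)).div
      ((hasDerivAt_snd_line p v).add (hasDerivAt_fst_line p v)) (by simpa using h2.ne')
    have b := a.sqrt (by simpa using ⟨h1.ne', h2.ne'⟩)
    refine b.congr_deriv ?_
    have e : √((p.2 - p.1) / (p.2 + p.1)) = nullRatio p := rfl
    simp only [Pi.div_apply, Pi.sub_apply, Pi.add_apply, zero_smul, add_zero, e]
    rw [← h6]
    field_simp
  have hDk : ∀ p ∈ strip R M 0 T, pd dout k₁ p + pd din k₂ p = D p := by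
    intro p hp
    obtain ⟨h1, h2, h3, h4, h5, h6⟩ := hS p hp
    have aQ := hasDerivAt_line_of_differentiableAt (dQ p) dout
    have aW := hasDerivAt_line_of_differentiableAt (dW p) din
    have aw := HasDerivAt.comp (h := fun s : ℝ => nullRatio (p + s • dout)) 0
      (hasDerivAt_weight (nullRatio (p + (0 : ℝ) • dout))) (hline dout p hp)
    have a1 := aw.mul ((aQ.pow 2).div (hasDerivAt_snd_line p dout) (by simpa using h3.ne'))
    have a2 := (((hline din p hp).mul ((hasDerivAt_snd_line p din).mul (aW.pow 2))).div
      (((hasDerivAt_snd_line p din).add (hasDerivAt_fst_line p din)).pow 2)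
      (by simpa using h2.ne')).neg
    rw [pd_eq_of_hasDerivAt_line (u := k₁) (hk₁ p hp) a1,
      pd_eq_of_hasDerivAt_line (u := k₂) (hk₂ p hp) a2, h.pd_dout_incoming h3,
      h.pd_din_potential h3]
    simp only [D, Function.comp_apply, Pi.pow_apply, Pi.add_apply, Pi.mul_apply, Pi.div_apply,
      zero_smul, add_zero]
    simp only [Prod.fst_add, Prod.snd_add, Prod.fst_sub, Prod.snd_sub]
    rw [← h6]
    field_simp
    ring
  have hDc : ContinuousOn D (strip R M 0 T) := by
    have c1 : ContinuousOn nullRatio (strip R M 0 T) := fun p hp =>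
      (dy p hp).continuousAt.continuousWithinAt
    have c2 : ContinuousOn (fun p => weight (nullRatio p)) (strip R M 0 T) :=
      cw.comp_continuousOn c1
    have c3 : ContinuousOn (fun p => weight' (nullRatio p)) (strip R M 0 T) :=
      cw'.comp_continuousOn c1
    have c4 := dQ.continuous
    have c5 := dW.continuous
    refine ContinuousOn.add (ContinuousOn.sub (ContinuousOn.add ?_ ?_) ?_) ?_
    · refine ContinuousOn.div (by fun_prop) (by fun_prop) fun p hp => ?_
      obtain ⟨h1, h2, h3, -⟩ := hS p hp
      positivity
    · refine ContinuousOn.div (by fun_prop) (by fun_prop) fun p hp => ?_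
      obtain ⟨h1, h2, h3, -⟩ := hS p hp
      positivity
    · refine ContinuousOn.div (by fun_prop) (by fun_prop) fun p hp => ?_
      obtain ⟨h1, h2, h3, -⟩ := hS p hp
      positivity
    · refine ContinuousOn.div (by fun_prop) (by fun_prop) fun p hp => ?_
      obtain ⟨h1, h2, h3, -⟩ := hS p hp
      positivity
  have hD0 : ∀ p ∈ strip R M 0 T, 0 ≤ D p := by
    intro p hp
    obtain ⟨h1, h2, h3, h4, h5, h6⟩ := hS p hp
    have hr : p.2 = (p.2 + p.1) * (1 + nullRatio p ^ 2) / 2 := by linarith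
    have := flux_nonneg (ξ := p.2 + p.1) (Q := incoming U p) (W := potential U p) h2 h4
      (weight_sub_sq_le h4.le h5)
    rw [← hr, h6] at this
    exact this
  have key := integral_le_integral_of_flux hT hM hk₁ hk₂ hDk hDc hD0
    (fun t ht => by simp [k₂, h.potential_eq_zero ht.1 (add_comm M t).ge.ge.le])
    (fun t ht => by
      have : 0 ≤ R + t := by linarith [ht.1]
      simp only [k₂, Left.neg_nonpos_iff]
      exact div_nonneg (mul_nonneg (Real.sqrt_nonneg _) (by positivity)) (by positivity))
  have hmem : ∀ η ∈ Set.Icc R M, ∀ t ∈ Set.Icc 0 T, (t, η + t) ∈ strip R M 0 T :=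
    fun η hη t ht => ⟨ht, by simpa using hη⟩
  have hkc : ∀ t ∈ Set.Icc 0 T,
      ContinuousOn (fun η => k₁ (t, η + t) + k₂ (t, η + t)) (Set.Icc R M) := fun t ht => by
    have e : ContinuousOn (fun p => k₁ p + k₂ p) (strip R M 0 T) := fun p hp =>
      ((hk₁ p hp).add (hk₂ p hp)).continuousAt.continuousWithinAt
    exact e.comp (Continuous.continuousOn (f := fun η : ℝ => (t, η + t)) (by fun_prop))
      fun η hη => hmem η hη t ht
  refine le_trans ?_ (key.trans ?_)
  · rw [← intervalIntegral.integral_const_mul]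
    refine intervalIntegral.integral_mono_on hM ?_
      ((hkc 0 ⟨le_rfl, hT⟩).intervalIntegrable_of_Icc hM) fun η hη => ?_
    · have := h.contDiff_source.continuous
      exact Continuous.intervalIntegrable (by fun_prop) _ _
    · have hη0 : 0 < η := hR.trans_le hη.1
      -- At t = 0 one has y = 1, W = 0 and U_t = 0, and the weight at 1 is 91/150, slightly above
      -- 3/5.
      have e1 : nullRatio (0, η) = 1 := by simp [nullRatio, hη0.ne']
      simp only [k₁, k₂, add_zero, e1, incoming, potential_zero, h.init η hη0, weight]
      have e2 : (η * source U (0, η) - 0 / 2 - η ^ 2 * 0) ^ 2 / η = η * source U (0, η) ^ 2 := by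
        field_simp
        ring
      rw [e2]
      have : 0 ≤ η * source U (0, η) ^ 2 := by positivity
      norm_num
      linarith
  · refine intervalIntegral.integral_mono_on hM
      ((hkc T ⟨hT, le_rfl⟩).intervalIntegrable_of_Icc hM) ?_ fun η hη => ?_
    · refine ContinuousOn.intervalIntegrable_of_Icc hM ?_
      have := dQ.continuous
      refine ContinuousOn.div (by fun_prop) (by fun_prop) fun η hη => ?_
      have := hη.1
      linarith
    · obtain ⟨h1, h2, h3, h4, h5, h6⟩ := hS _ (hmem η hη T ⟨hT, le_rfl⟩)
      have e1 : k₂ (T, η + T) ≤ 0 := by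
        simp only [k₂, Left.neg_nonpos_iff]
        have : 0 ≤ η + T := h3.le
        exact div_nonneg (mul_nonneg (Real.sqrt_nonneg _) (by positivity)) (by positivity)
      have e2 : k₁ (T, η + T) ≤ 1 * (incoming U (T, η + T) ^ 2 / (η + T)) :=
        mul_le_mul_of_nonneg_right (weight_le_one h4.le) (div_nonneg (sq_nonneg _) h3.le)
      linarith

end IsRadialWave

/-! ### Equipartition and the limit of the exterior energy. -/

namespace IsRadialWave

variable {M R : ℝ} {U : ℝ × ℝ → ℝ}

lemma energy_nonneg (hR : 0 < R) (hM : R ≤ M) {t : ℝ} (ht : 0 ≤ t) : 0 ≤ energy U R M t :=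
  intervalIntegral.integral_nonneg hM fun η hη => dens_nonneg (by simp only; linarith [hη.1])

/-- The outgoing derivative of `r ^ (3 / 2) U`, multiplied by `r ^ (1 / 2)` and up to a
lower-order term. -/
def outgoing (U : ℝ × ℝ → ℝ) (p : ℝ × ℝ) : ℝ :=
  p.2 * (pd (1, 0) U p + pd (0, 1) U p) + 3 / 2 * U p

/-- The function V = r^(3/2) U satisfies V_tt - V_rr = -(3/4) V / r², and √r `outgoing U` is V_t +
V_r. -/
lemma hasDerivAt_sqrt_mul_outgoing (h : IsRadialWave M U) {p : ℝ × ℝ} (hp : 0 < p.2) :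
    HasDerivAt (fun s : ℝ => √(p + s • din).2 * outgoing U (p + s • din))
      (-(3 / 4) * (U p / √p.2)) 0 := by
  obtain ⟨t, r⟩ := p
  simp only at hp
  have c1 := contDiff_pd h.smooth (1, 0)
  have c2 := contDiff_pd h.smooth (0, 1)
  have w := h.wave t r hp
  have hcomm : pd (0, 1) (pd (1, 0) U) (t, r) = pd (1, 0) (pd (0, 1) U) (t, r) := by
    rw [pd_comm h.smooth]
  have a := ((hasDerivAt_snd_line (t, r) din).sqrt (by simpa using hp.ne')).mul
    (((hasDerivAt_snd_line (t, r) din).mul ((hasDerivAt_comp_line c1 (t, r) din).add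
      (hasDerivAt_comp_line c2 (t, r) din))).add
      ((hasDerivAt_comp_line h.smooth (t, r) din).const_mul (3 / 2)))
  refine a.congr_deriv ?_
  obtain ⟨q, hq, rfl⟩ : ∃ q : ℝ, 0 < q ∧ q ^ 2 = r := ⟨√r, Real.sqrt_pos.2 hp, Real.sq_sqrt hp.le⟩
  simp only [pd_sub_dir, hcomm, Pi.mul_apply, Pi.add_apply, zero_smul, add_zero]
  simp [Real.sqrt_sq hq.le]
  field_simp
  linear_combination (16 * q ^ 2) * w

/-- Integration of `hasDerivAt_sqrt_mul_outgoing` along the incoming characteristic, from the edge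
where U and its derivatives vanish. It lasts at most M/2, and U/√r is O(t⁻²) on it by `sq_mul_le`.
-/
lemma sq_outgoing_mul_le (h : IsRadialWave M U) (hR : 0 < R) (hM : R ≤ M) {t r : ℝ} (ht : M ≤ t)
    (hr : R ≤ r - t) (hr' : r - t ≤ M) :
    r * outgoing U (t, r) ^ 2 ≤ (3 / 8 * M / t ^ 2) ^ 2 * ((M - R) * energy U R M 0) := by
  set C := (M - R) * energy U R M 0 with hC
  have hC0 : 0 ≤ C := mul_nonneg (by linarith) (energy_nonneg hR hM le_rfl)
  have ht0 : 0 < t := by linarith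
  -- The time at which the incoming characteristic through (t, r) leaves the edge r = t + M.
  set τ := (r + t - M) / 2 with hτ
  have hτ0 : 0 ≤ τ := by rw [hτ]; linarith
  set γ : ℝ → ℝ × ℝ := fun s => (τ, τ + M) + s • din with hγ
  set S : ℝ → ℝ := fun s => √(γ s).2 * outgoing U (γ s) with hS
  have hγe : ∀ s, γ s = (τ + s, τ + M - s) := fun s => by
    simp [hγ, sub_eq_add_neg]
  have hL0 : 0 ≤ t - τ := by rw [hτ]; linarith
  have hLM : t - τ ≤ M / 2 := by rw [hτ]; linarith
  have hder : ∀ s ∈ Set.Icc 0 (t - τ), HasDerivWithinAt S (-(3 / 4) * (U (γ s) / √(γ s).2))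
      (Set.Icc 0 (t - τ)) s := by
    intro s hs
    have hp : 0 < (γ s).2 := by
      rw [hγe]; simp only; linarith [hs.2]
    have h1 := h.hasDerivAt_sqrt_mul_outgoing hp
    rw [show (0 : ℝ) = s - s by ring] at h1
    have h2 := h1.comp_sub_const s s
    have e : (fun x => √(γ s + (x - s) • din).2 * outgoing U (γ s + (x - s) • din)) = S := by
      funext x
      have : γ s + (x - s) • din = γ x := by simp only [hγ, sub_smul]; abel
      rw [this]
    rw [e] at h2
    exact h2.hasDerivWithinAt
  have hbound : ∀ s ∈ Set.Ico 0 (t - τ), ‖-(3 / 4) * (U (γ s) / √(γ s).2)‖ ≤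
      3 / 4 * (√C / t ^ 2) := by
    intro s hs
    rw [hγe]
    simp only
    set ρ := τ + M - s with hρ
    have hρt : t ≤ ρ := by rw [hρ]; linarith [hs.2]
    have hρ0 : 0 < ρ := ht0.trans_le hρt
    have h1 : U (τ + s, ρ) ^ 2 * ρ ^ 3 ≤ C := (h.sq_mul_le hR (by linarith [hs.1])
      (by linarith [hs.2]) (by linarith [hs.1])).trans
        (mul_le_mul_of_nonneg_left (h.energy_anti hR hM le_rfl (by linarith [hs.1]))
          (by linarith))
    rw [norm_mul, norm_neg, Real.norm_of_nonneg (by norm_num : (0 : ℝ) ≤ 3 / 4)]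
    refine mul_le_mul_of_nonneg_left ?_ (by norm_num)
    refine abs_le_of_sq_le_sq ?_ (by positivity)
    rw [div_pow, div_pow, Real.sq_sqrt hρ0.le, Real.sq_sqrt hC0,
      div_le_div_iff₀ hρ0 (by positivity)]
    have h2 : (t ^ 2) ^ 2 ≤ ρ ^ 3 * ρ := by
      calc (t ^ 2) ^ 2 = t ^ 4 := by ring
        _ ≤ ρ ^ 4 := by gcongr
        _ = ρ ^ 3 * ρ := by ring
    calc U (τ + s, ρ) ^ 2 * (t ^ 2) ^ 2 ≤ U (τ + s, ρ) ^ 2 * (ρ ^ 3 * ρ) := by gcongr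
      _ = U (τ + s, ρ) ^ 2 * ρ ^ 3 * ρ := by ring
      _ ≤ C * ρ := by gcongr
  have hmv := norm_image_sub_le_of_norm_deriv_le_segment' hder hbound (t - τ) ⟨hL0, le_rfl⟩
  have hS0 : S 0 = 0 := by
    have hb : τ + M ≤ τ + M := le_rfl
    simp [hS, hγ, outgoing, h.pd_fst_eq_zero hτ0 hb, h.pd_snd_eq_zero hτ0 hb,
      h.supp τ (τ + M) hτ0 hb]
  have hr0 : 0 < r := by linarith
  have hS1 : S (t - τ) = √r * outgoing U (t, r) := by
    have : γ (t - τ) = (t, r) := by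
      rw [hγe]; ext <;> simp only <;> rw [hτ] <;> ring
    simp only [hS, this]
  rw [hS0, hS1, sub_zero, sub_zero] at hmv
  have h3 : 3 / 4 * (√C / t ^ 2) * (t - τ) ≤ 3 / 8 * M / t ^ 2 * √C := by
    calc 3 / 4 * (√C / t ^ 2) * (t - τ) ≤ 3 / 4 * (√C / t ^ 2) * (M / 2) := by gcongr
      _ = _ := by ring
  have h4 := pow_le_pow_left₀ (norm_nonneg _) (hmv.trans h3) 2
  rwa [Real.norm_eq_abs, sq_abs, mul_pow, mul_pow, Real.sq_sqrt hr0.le, Real.sq_sqrt hC0] at h4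

/-- Removes the lower-order term of `outgoing`, which `sq_mul_le` controls; the constants add up to
2 · 9/64 + 9/2 < 5. -/
lemma sq_add_mul_le (h : IsRadialWave M U) (hR : 0 < R) (hM : R ≤ M) {t r : ℝ} (ht : M ≤ t)
    (hr : R ≤ r - t) (hr' : r - t ≤ M) :
    r ^ 3 * (pd (1, 0) U (t, r) + pd (0, 1) U (t, r)) ^ 2 ≤
      5 * ((M - R) * energy U R M 0) / t ^ 2 := by
  have h1 := h.sq_outgoing_mul_le hR hM ht hr hr'
  have ht0 : 0 < t := by linarith
  have h2 := (h.sq_mul_le hR ht0.le hr hr').trans (mul_le_mul_of_nonneg_left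
    (h.energy_anti hR hM le_rfl ht0.le) (by linarith))
  set C := (M - R) * energy U R M 0 with hC
  have hC0 : 0 ≤ C := mul_nonneg (by linarith) (energy_nonneg hR hM le_rfl)
  set X := pd (1, 0) U (t, r) + pd (0, 1) U (t, r) with hX
  have hrt : t ≤ r := by linarith
  have hr0 : 0 < r := by linarith
  have e : outgoing U (t, r) = r * X + 3 / 2 * U (t, r) := rfl
  have h3 : r ^ 3 * X ^ 2 ≤ 2 * (r * outgoing U (t, r) ^ 2) + 9 / 2 * (r * U (t, r) ^ 2) := by
    rw [e]
    have := mul_nonneg hr0.le (sq_nonneg (r * X + 3 * U (t, r)))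
    nlinarith
  have h4 : r * U (t, r) ^ 2 ≤ C / t ^ 2 := by
    rw [le_div_iff₀ (by positivity)]
    calc r * U (t, r) ^ 2 * t ^ 2 ≤ r * U (t, r) ^ 2 * r ^ 2 := by gcongr
      _ = U (t, r) ^ 2 * r ^ 3 := by ring
      _ ≤ C := h2
  have h5 : (3 / 8 * M / t ^ 2) ^ 2 * C ≤ 9 / 64 * (C / t ^ 2) := by
    have : (M / t) ^ 2 ≤ 1 := by
      rw [sq_le_one_iff₀ (by have := hR.trans_le hM; positivity)]
      exact div_le_one_of_le₀ ht ht0.le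
    calc (3 / 8 * M / t ^ 2) ^ 2 * C = 9 / 64 * (C / t ^ 2) * (M / t) ^ 2 := by
          field_simp
          ring
      _ ≤ 9 / 64 * (C / t ^ 2) * 1 := by gcongr
      _ = _ := mul_one _
  have h6 : 0 ≤ C / t ^ 2 := by positivity
  have : 5 * C / t ^ 2 = 5 * (C / t ^ 2) := by ring
  rw [this]
  linarith

/-- In U_t² - U_r² = (U_t + U_r)(U_t - U_r) the first factor, with its weight r^(3/2), is O(1/t);
the arithmetic-geometric inequality is balanced by the factor t. -/
lemma abs_integral_sub_le (h : IsRadialWave M U) (hR : 0 < R) (hM : R ≤ M) {t : ℝ} (ht : M ≤ t) :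
    |∫ η in R..M, (η + t) ^ 3 * (pd (1, 0) U (t, η + t) ^ 2 - pd (0, 1) U (t, η + t) ^ 2)| ≤
      (5 * ((M - R) * energy U R M 0) * (M - R) + 2 * energy U R M 0) / (2 * t) := by
  have ht0 : 0 < t := by linarith
  have hd := h.continuous_dens
  have hE := h.energy_anti hR hM le_rfl ht0.le
  set K := 5 * ((M - R) * energy U R M 0) with hK
  have h1 : ∀ η ∈ Set.Icc R M,
      ‖(η + t) ^ 3 * (pd (1, 0) U (t, η + t) ^ 2 - pd (0, 1) U (t, η + t) ^ 2)‖ ≤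
        (K + 2 * dens U (t, η + t)) / (2 * t) := by
    intro η hη
    have h2 := h.sq_add_mul_le hR hM (r := η + t) ht (by linarith [hη.1]) (by linarith [hη.2])
    have hr0 : 0 < η + t := by linarith [hη.1]
    rw [le_div_iff₀ (by positivity), norm_mul, Real.norm_of_nonneg (by positivity),
      sq_sub_sq, norm_mul, Real.norm_eq_abs, Real.norm_eq_abs]
    rw [le_div_iff₀ (by positivity)] at h2
    simp only [dens]
    set a := pd (1, 0) U (t, η + t)
    set b := pd (0, 1) U (t, η + t)
    have h3 : |a + b| * |a - b| * (2 * t) ≤ (a + b) ^ 2 * t ^ 2 + 2 * (a ^ 2 + b ^ 2) := by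
      have := sq_nonneg (|a + b| * t - |a - b|)
      have e1 := sq_abs (a + b)
      have e2 := sq_abs (a - b)
      nlinarith [sq_nonneg (a + b)]
    calc (η + t) ^ 3 * (|a + b| * |a - b|) * (2 * t)
        = (η + t) ^ 3 * (|a + b| * |a - b| * (2 * t)) := by ring
      _ ≤ (η + t) ^ 3 * ((a + b) ^ 2 * t ^ 2 + 2 * (a ^ 2 + b ^ 2)) := by gcongr
      _ = (η + t) ^ 3 * (a + b) ^ 2 * t ^ 2 + 2 * ((η + t) ^ 3 * (a ^ 2 + b ^ 2)) := by ring
      _ ≤ _ := by gcongr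
  have h2 := intervalIntegral.norm_integral_le_of_norm_le hM
    (.of_forall fun η hη => h1 η (Set.Ioc_subset_Icc_self hη))
    (Continuous.intervalIntegrable (μ := volume) (by fun_prop) R M)
  refine h2.trans ?_
  rw [intervalIntegral.integral_div, intervalIntegral.integral_add
    (Continuous.intervalIntegrable (by fun_prop) _ _)
    (Continuous.intervalIntegrable (by fun_prop) _ _), intervalIntegral.integral_const,
    intervalIntegral.integral_const_mul, smul_eq_mul]
  refine div_le_div_of_nonneg_right ?_ (by positivity)
  have : ∫ η in R..M, dens U (t, η + t) = energy U R M t := rfl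
  rw [this]
  linarith

/-- The leading part of Q is r² (U_r - U_t), whose square over r is at most 2 `dens`. The remainder
2 r U - W/2 is of lower order by the pointwise bounds, and Young's inequality with parameter t makes
all errors O(1/t). -/
lemma integral_incoming_le (h : IsRadialWave M U) (hR : 0 < R) (hM : R ≤ M) {t : ℝ} (ht : 0 < t) :
    ∫ η in R..M, incoming U (t, η + t) ^ 2 / (η + t) ≤
      2 * (1 + t⁻¹) * energy U R M t +
        (M - R) * (9 * ((M - R) * energy U R M 0)) * ((1 + t) / t ^ 2) := by
  have hd := h.continuous_dens
  have hE := h.energy_anti hR hM le_rfl ht.le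
  have hCm : (M - R) * energy U R M t ≤ (M - R) * energy U R M 0 :=
    mul_le_mul_of_nonneg_left hE (by linarith)
  set C := (M - R) * energy U R M 0 with hC
  have h1 : ∀ η ∈ Set.Icc R M, incoming U (t, η + t) ^ 2 / (η + t) ≤
      2 * (1 + t⁻¹) * dens U (t, η + t) + 9 * C * ((1 + t) / t ^ 2) := by
    intro η hη
    set r := η + t with hr
    have hrt : t ≤ r := by linarith [hη.1]
    have hr0 : 0 < r := by linarith
    have hU := (h.sq_mul_le hR (r := r) ht.le (by linarith [hη.1]) (by linarith [hη.2])).trans hCm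
    have hW := (h.sq_potential_mul_le hR (r := r) ht.le (by linarith [hη.1])
      (by linarith [hη.2])).trans hCm
    have hC0 : 0 ≤ C := le_trans (by positivity) hU
    simp only [incoming, dens, source]
    set a := pd (1, 0) U (t, r)
    set b := pd (0, 1) U (t, r)
    set u := U (t, r)
    set W := potential U (t, r)
    set Z := 2 * r * u - W / 2 with hZ
    have e : r * (r * b + 2 * u) - W / 2 - r ^ 2 * a = r ^ 2 * (b - a) + Z := by rw [hZ]; ring
    have hZb : Z ^ 2 / r ≤ 9 * C / t ^ 2 := by
      rw [div_le_div_iff₀ hr0 (by positivity)]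
      have z1 : Z ^ 2 ≤ 8 * (r ^ 2 * u ^ 2) + W ^ 2 / 2 := by
        rw [hZ]; nlinarith [sq_nonneg (2 * r * u + W / 2)]
      have z2 : (r ^ 2 * u ^ 2) * t ^ 2 ≤ C * r := by
        calc (r ^ 2 * u ^ 2) * t ^ 2 ≤ (r ^ 2 * u ^ 2) * r ^ 2 := by gcongr
          _ = u ^ 2 * r ^ 3 * r := by ring
          _ ≤ C * r := by gcongr
      have z3 : W ^ 2 * t ^ 2 ≤ C * r := by
        calc W ^ 2 * t ^ 2 ≤ W ^ 2 * r ^ 2 := by gcongr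
          _ = W ^ 2 * r * r := by ring
          _ ≤ C * r := by gcongr
      have z4 : 0 ≤ C * r := by positivity
      nlinarith [mul_le_mul_of_nonneg_right z1 (sq_nonneg t)]
    have hyoung : (r ^ 2 * (b - a) + Z) ^ 2 ≤
        (1 + t⁻¹) * (r ^ 2 * (b - a)) ^ 2 + (1 + t) * Z ^ 2 := by
      have e2 : (1 + t⁻¹) * (r ^ 2 * (b - a)) ^ 2 + (1 + t) * Z ^ 2 -
          (r ^ 2 * (b - a) + Z) ^ 2 = (r ^ 2 * (b - a) - t * Z) ^ 2 / t := by
        field_simp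
        ring
      have : 0 ≤ (r ^ 2 * (b - a) - t * Z) ^ 2 / t := by positivity
      linarith
    rw [e]
    calc (r ^ 2 * (b - a) + Z) ^ 2 / r
        ≤ ((1 + t⁻¹) * (r ^ 2 * (b - a)) ^ 2 + (1 + t) * Z ^ 2) / r := by gcongr
      _ = (1 + t⁻¹) * (r ^ 3 * (b - a) ^ 2) + (1 + t) * (Z ^ 2 / r) := by
          field_simp
      _ ≤ (1 + t⁻¹) * (r ^ 3 * (2 * (a ^ 2 + b ^ 2))) + (1 + t) * (9 * C / t ^ 2) := by
          gcongr
          nlinarith [sq_nonneg (a + b)]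
      _ = _ := by ring
  have hQ := h.continuous_incoming
  have h2 := intervalIntegral.integral_mono_on hM (by
      refine ContinuousOn.intervalIntegrable_of_Icc (μ := volume) hM ?_
      refine ContinuousOn.div (by fun_prop) (by fun_prop) fun η hη => ?_
      have := hη.1
      linarith) (Continuous.intervalIntegrable (μ := volume) (by fun_prop) _ _) h1
  refine h2.trans (le_of_eq ?_)
  rw [intervalIntegral.integral_add (Continuous.intervalIntegrable (by fun_prop) _ _)
    (Continuous.intervalIntegrable (by fun_prop) _ _), intervalIntegral.integral_const_mul,
    intervalIntegral.integral_const, smul_eq_mul]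
  have : ∫ η in R..M, dens U (t, η + t) = energy U R M t := rfl
  rw [this]
  ring

/-- Equipartition of the exterior energy and the lower bound of its limit. -/
theorem exists_tendsto (h : IsRadialWave M U) (hR : 0 < R) (hM : R ≤ M) : ∃ ℓ : ℝ,
    Tendsto (fun t => ∫ η in R..M, (η + t) ^ 3 * pd (0, 1) U (t, η + t) ^ 2) atTop (𝓝 ℓ) ∧
    Tendsto (fun t => ∫ η in R..M, (η + t) ^ 3 * pd (1, 0) U (t, η + t) ^ 2) atTop (𝓝 ℓ) ∧
    3 / 20 * ∫ η in R..M, η * source U (0, η) ^ 2 ≤ ℓ := by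
  have c1 := (contDiff_pd h.smooth (1, 0)).continuous
  have c2 := (contDiff_pd h.smooth (0, 1)).continuous
  -- Monotonicity is known for nonnegative times only; freezing the energy before time zero makes it
  -- antitone on the whole line.
  set e : ℝ → ℝ := fun t => energy U R M (max t 0) with he
  have hanti : Antitone e := fun s t hst =>
    h.energy_anti hR hM (le_max_right _ _) (max_le_max_right 0 hst)
  have hbdd : BddBelow (Set.range e) :=
    ⟨0, by rintro _ ⟨t, rfl⟩; exact energy_nonneg hR hM (le_max_right _ _)⟩
  set L := ⨅ t, e t with hL
  have hE : Tendsto (fun t => energy U R M t) atTop (𝓝 L) := by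
    refine (tendsto_atTop_ciInf hanti hbdd).congr' ?_
    filter_upwards [eventually_ge_atTop 0] with t ht
    simp [he, max_eq_left ht]
  have hdiff : Tendsto (fun t => ∫ η in R..M, (η + t) ^ 3 *
      (pd (1, 0) U (t, η + t) ^ 2 - pd (0, 1) U (t, η + t) ^ 2)) atTop (𝓝 0) := by
    refine squeeze_zero_norm' (a := fun t =>
      (5 * ((M - R) * energy U R M 0) * (M - R) + 2 * energy U R M 0) / (2 * t)) ?_ ?_
    · filter_upwards [eventually_ge_atTop M] with t ht using h.abs_integral_sub_le hR hM ht
    · exact (tendsto_id.const_mul_atTop two_pos).const_div_atTop _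
  have hi : ∀ (t : ℝ) (f : ℝ → ℝ), Continuous f → IntervalIntegrable f volume R M :=
    fun t f hf => hf.intervalIntegrable _ _
  refine ⟨L / 2, ?_, ?_, ?_⟩
  · have := (hE.sub hdiff).div_const 2
    rw [sub_zero] at this
    refine this.congr fun t => ?_
    rw [energy, ← intervalIntegral.integral_sub, ← intervalIntegral.integral_div]
    · refine intervalIntegral.integral_congr fun η _ => ?_
      simp only [dens]; ring
    · exact hi t _ (by have := h.continuous_dens; fun_prop)
    · exact hi t _ (by fun_prop)
  · have := (hE.add hdiff).div_const 2
    rw [add_zero] at this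
    refine this.congr fun t => ?_
    rw [energy, ← intervalIntegral.integral_add, ← intervalIntegral.integral_div]
    · refine intervalIntegral.integral_congr fun η _ => ?_
      simp only [dens]; ring
    · exact hi t _ (by have := h.continuous_dens; fun_prop)
    · exact hi t _ (by fun_prop)
  -- The two estimates on Q give 3/5 of the initial integral ≤ 2 L in the limit, and the common
  -- limit of the two halves is L/2.
  · have hlim : Tendsto (fun t : ℝ => 2 * (1 + t⁻¹) * energy U R M t +
        (M - R) * (9 * ((M - R) * energy U R M 0)) * ((1 + t) / t ^ 2)) atTop (𝓝 (2 * L)) := by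
      have h1 : Tendsto (fun t : ℝ => t⁻¹) atTop (𝓝 0) := tendsto_inv_atTop_zero
      have h2 : Tendsto (fun t : ℝ => (1 + t) / t ^ 2) atTop (𝓝 0) := by
        have := (h1.mul h1).add h1
        rw [mul_zero, add_zero] at this
        refine this.congr' ?_
        filter_upwards [eventually_gt_atTop 0] with t ht
        field_simp
      have := (((h1.const_add 1).const_mul 2).mul hE).add
        (h2.const_mul ((M - R) * (9 * ((M - R) * energy U R M 0))))
      simpa using this
    have := ge_of_tendsto hlim (by
      filter_upwards [eventually_gt_atTop 0] with t ht
      exact (h.integral_source_le hR hM ht.le).trans (h.integral_incoming_le hR hM ht))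
    linarith

end IsRadialWave

/-! ### Radial functions on ℝ⁴ and their profiles. -/

/-- Invariance under the isometries of `ℝ⁴`. -/
def NormInvariant {α : Type*} (f : E4 → α) : Prop := ∀ x y, ‖x‖ = ‖y‖ → f x = f y

/-- The reflection in the hyperplane orthogonal to x - y. -/
lemma exists_isometry {x y : E4} (h : ‖x‖ = ‖y‖) : ∃ A : E4 ≃ₗᵢ[ℝ] E4, A x = y :=
  ⟨_, Submodule.reflection_sub h⟩

lemma NormInvariant.comp_isometry {α : Type*} {f : E4 → α} (h : NormInvariant f)
    (A : E4 ≃ₗᵢ[ℝ] E4) : f ∘ A = f := funext fun x => h _ _ (A.norm_map x)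

lemma NormInvariant.of_isometry {α : Type*} {f : E4 → α}
    (h : ∀ (A : E4 ≃ₗᵢ[ℝ] E4) x, f (A x) = f x) : NormInvariant f := fun x y hxy => by
  obtain ⟨A, rfl⟩ := exists_isometry hxy
  exact (h A x).symm

lemma NormInvariant.fourier {f : E4 → ℂ} (h : NormInvariant f) : NormInvariant (𝓕 f) :=
  .of_isometry fun A x => by rw [← Real.fourier_comp_linearIsometry, h.comp_isometry A]

lemma NormInvariant.neg {α : Type*} {f : E4 → α} (h : NormInvariant f) (x : E4) : f (-x) = f x :=
  h _ _ (norm_neg x)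

/-- The real part of an even real Fourier integral is represented by its density. -/
lemma repOn_fourier {a : E4 → ℂ} (ha : Integrable a) (him : ∀ x, (𝓕 a x).im = 0)
    (hev : ∀ x, 𝓕 a (-x) = 𝓕 a x) (Ω : Set E4) : RepOn Ω (fun x => (𝓕 a x).re) a := by
  have hc : Continuous (𝓕 a) := VectorFourier.fourierIntegral_continuous
    Real.continuous_fourierChar (innerSL ℝ).continuous₂ ha
  refine ⟨(Complex.continuous_re.comp hc).locallyIntegrable.locallyIntegrableOn _, fun θ => ?_,
    fun φ θ hφ hθ => ?_⟩
  · obtain ⟨C, hC⟩ := θ.decay 0 0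
    have hC' : ∀ x, ‖θ x‖ ≤ C := fun x => by simpa using hC.2 x
    refine ha.mul_bdd (c := C) θ.continuous.aestronglyMeasurable (.of_forall hC')
  · have h1 : ((∫ x, (𝓕 a x).re * φ x : ℝ) : ℂ) = ∫ x, 𝓕 a x * 𝓕 θ x := by
      rw [← integral_complex_ofReal]
      refine integral_congr_ae (.of_forall fun x => ?_)
      simp only [hθ, Complex.ofReal_mul]
      rw [show ((𝓕 a x).re : ℂ) = 𝓕 a x from Complex.ext (by simp) (by simp [him])]
    -- Evenness of 𝓕 a permits replacing 𝓕 θ by 𝓕⁻ θ; the self-adjointness of 𝓕 then returns θ.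
    have h2 : ∫ x, 𝓕 a x * 𝓕 θ x = ∫ x, 𝓕 a x * 𝓕⁻ θ x := by
      rw [← integral_neg_eq_self]
      refine integral_congr_ae (.of_forall fun x => ?_)
      simp only [hev]
      congr 1
    have h3 := VectorFourier.integral_fourierIntegral_smul_eq_flip (L := innerₗ E4)
      Real.continuous_fourierChar continuous_inner ha ((𝓕⁻ θ : 𝓢(E4, ℂ)).integrable (μ := volume))
    rw [h1, h2]
    have h4 : ∀ ξ, 𝓕 (⇑(𝓕⁻ θ : 𝓢(E4, ℂ))) ξ = θ ξ := fun ξ => by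
      rw [← SchwartzMap.fourier_coe, FourierTransform.fourier_fourierInv_eq]
    simp only [smul_eq_mul, flip_innerₗ] at h3
    refine h3.trans (integral_congr_ae (.of_forall fun ξ => ?_))
    simp only [← h4]
    rfl

lemma continuous_gradient_iff {f : E4 → ℝ} {Ω : Set E4}
    (h : ∀ j, ContinuousOn (pd (EuclideanSpace.single j 1) f) Ω) : ContinuousOn (gradient f) Ω := by
  have h1 : ContinuousOn (fun x => WithLp.toLp 2 fun j => gradient f x j) Ω := by
    refine (PiLp.continuous_toLp 2 _).comp_continuousOn (continuousOn_pi.2 fun j => ?_)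
    exact (h j).congr fun x _ => gradient_apply x j
  exact h1

/-- The classical gradient is a weak gradient. -/
lemma isWeakGrad_gradient {f : E4 → ℝ} {Ω : Set E4} (hΩ : IsOpen Ω) (hf : ContDiffOn ℝ ∞ f Ω) :
    IsWeakGrad Ω f (gradient f) := by
  have hpc : ∀ v, ContinuousOn (pd v f) Ω := fun v =>
    (hf.continuousOn_fderiv_of_isOpen hΩ (by simp)).clm_apply continuousOn_const
  have hl : LocallyIntegrableOn f Ω := hf.continuousOn.locallyIntegrableOn hΩ.measurableSet
  refine (isWeakGrad_iff hl ((continuous_gradient_iff fun j => hpc _).locallyIntegrableOn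
    hΩ.measurableSet)).2 fun φ hφ j => ?_
  have h1 := hφ.integrable_smul ((hpc (EuclideanSpace.single j 1)).locallyIntegrableOn
    (μ := volume) hΩ.measurableSet)
  have h2 := (hφ.pd (EuclideanSpace.single j 1)).integrable_smul hl
  have h3 := hφ.integrable_smul hl
  simp only [smul_eq_mul, mul_comm] at h1 h2 h3
  have := integral_mul_fderiv_eq_neg_fderiv_mul_of_integrable (μ := (volume : Measure E4))
    (f := f) (g := φ) (v := EuclideanSpace.single j 1)
    (by simpa only [mul_comm, pd] using h1) (by simpa only [mul_comm, pd] using h2)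
    (by simpa only [mul_comm] using h3)
    (fun x hx => (hf.differentiableOn (by simp)).differentiableAt (hΩ.mem_nhds (hφ.supp hx)))
    (fun x _ => hφ.smooth.differentiable (by simp) x)
  simp only [pd, gradient_apply] at this ⊢
  simpa only [mul_comm] using this

/-- The classical time derivative is a time derivative in the sense of distributions. -/
lemma isTimeDeriv_pd {u : ℝ × E4 → ℝ} (hu : ContDiff ℝ ∞ u) (Ω : Set E4) (t : ℝ) :
    IsTimeDeriv Ω (fun t x => u (t, x)) t fun x => pd et u (t, x) := by
  have h1 := (contDiff_pd hu et).continuous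
  have h0 := hu.continuous
  refine ⟨(Continuous.locallyIntegrable (by fun_prop)).locallyIntegrableOn _, fun φ hφ => ?_⟩
  have hφc := hφ.smooth.continuous
  have key := hasDerivAt_integral_of_isCompact (μ := (volume : Measure E4)) hφ.compact.isCompact
    hφ.compact.isCompact.measure_lt_top (k := fun p => u p * φ p.2)
    (k' := fun p => pd et u p * φ p.2) (by fun_prop) (by fun_prop) (fun s x =>
      (hasDerivAt_comp_curve hu ((hasDerivAt_id s).prodMk (hasDerivAt_const s x))).mul_const (φ x)) t
  have e : ∀ f : E4 → ℝ, ∫ x in tsupport φ, f x * φ x = ∫ x, f x * φ x := fun f =>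
    setIntegral_eq_integral_of_forall_compl_eq_zero fun x hx => by
      rw [image_eq_zero_of_notMem_tsupport hx, mul_zero]
  have e1 : (fun s => ∫ x in tsupport φ, u (s, x) * φ x) = fun s => ∫ x, u (s, x) * φ x :=
    funext fun s => e fun x => u (s, x)
  have e2 := e fun x => pd et u (t, x)
  rw [e1, e2] at key
  exact key

/-- The area of the unit sphere of `ℝ⁴`. -/
def sphereArea : ℝ := 4 * (volume : Measure E4).real (Metric.ball 0 1)

lemma sphereArea_pos : 0 < sphereArea :=
  mul_pos (by norm_num) (ENNReal.toReal_pos (Metric.measure_ball_pos _ _ one_pos).ne'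
    measure_ball_lt_top.ne)

/-- Integration in polar coordinates in an exterior region. -/
lemma integral_ext_norm {ρ : ℝ} (hρ : 0 ≤ ρ) (h : ℝ → ℝ) :
    ∫ x in ext ρ, h ‖x‖ = sphereArea * ∫ r in Set.Ioi ρ, r ^ 3 * h r := by
  have h1 : ∫ x in ext ρ, h ‖x‖ = ∫ x : E4, (Set.Ioi ρ).indicator h ‖x‖ := by
    rw [← integral_indicator (isOpen_ext ρ).measurableSet]
    refine integral_congr_ae (.of_forall fun x => ?_)
    by_cases hx : ρ < ‖x‖ <;> simp [Set.indicator, ext, hx]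
  rw [h1, integral_fun_norm_addHaar volume ((Set.Ioi ρ).indicator h)]
  have h2 : ∀ y, y ^ (Module.finrank ℝ E4 - 1) • (Set.Ioi ρ).indicator h y =
      (Set.Ioi ρ).indicator (fun r => r ^ 3 * h r) y := fun y => by
    by_cases hy : ρ < y <;> simp [Set.indicator, hy]
  simp only [h2]
  rw [setIntegral_indicator measurableSet_Ioi, Set.inter_eq_right.2 (Set.Ioi_subset_Ioi hρ)]
  simp [sphereArea]
  ring

lemma integrableOn_ext_norm {ρ : ℝ} {h : ℝ → ℝ}
    (hi : IntegrableOn (fun r => r ^ 3 * h r) (Set.Ioi ρ)) :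
    IntegrableOn (fun x : E4 => h ‖x‖) (ext ρ) := by
  have h1 : Integrable fun x : E4 => (Set.Ioi ρ).indicator h ‖x‖ := by
    rw [integrable_fun_norm_addHaar volume (f := (Set.Ioi ρ).indicator h)]
    have h2 : ∀ y, y ^ (Module.finrank ℝ E4 - 1) • (Set.Ioi ρ).indicator h y =
        (Set.Ioi ρ).indicator (fun r => r ^ 3 * h r) y := fun y => by
      by_cases hy : ρ < y <;> simp [Set.indicator, hy]
    simp only [h2]
    exact ((integrable_indicator_iff measurableSet_Ioi).2 hi).integrableOn
  rw [← integrable_indicator_iff (isOpen_ext ρ).measurableSet]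
  refine h1.congr (.of_forall fun x => ?_)
  by_cases hx : ρ < ‖x‖ <;> simp [Set.indicator, ext, hx]

lemma pd_smul_dir {V : Type*} [NormedAddCommGroup V] [NormedSpace ℝ V] (c : ℝ) (v : V) (u : V → ℝ)
    (p : V) : pd (c • v) u p = c * pd v u p := map_smul _ _ _

/-- A point of the unit sphere. -/
abbrev axis : E4 := EuclideanSpace.single 0 1

lemma norm_smul_axis {r : ℝ} (hr : 0 ≤ r) : ‖r • axis‖ = r := by
  simp [norm_smul, abs_of_nonneg hr]

/-- The radial profile of a function of `(t, x)`. -/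
def profile (u : ℝ × E4 → ℝ) (p : ℝ × ℝ) : ℝ := u (p.1, p.2 • axis)

lemma contDiff_profile {u : ℝ × E4 → ℝ} (hu : ContDiff ℝ ∞ u) : ContDiff ℝ ∞ (profile u) := by
  unfold profile; fun_prop

lemma hasDerivAt_profile_curve (p v : ℝ × ℝ) :
    HasDerivAt (fun s : ℝ => (((p + s • v).1, (p + s • v).2 • axis) : ℝ × E4))
      (v.1, v.2 • axis) 0 :=
  (hasDerivAt_fst_line p v).prodMk ((hasDerivAt_snd_line p v).smul_const axis)

lemma pd_profile {u : ℝ × E4 → ℝ} (hu : ContDiff ℝ ∞ u) (v p : ℝ × ℝ) :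
    pd v (profile u) p = pd (v.1, v.2 • axis) u (p.1, p.2 • axis) := by
  refine pd_eq_of_hasDerivAt_line ((contDiff_profile hu).differentiable (by simp) p) ?_
  have := hasDerivAt_comp_curve hu (hasDerivAt_profile_curve p v)
  simpa using! this

lemma pd_fst_profile {u : ℝ × E4 → ℝ} (hu : ContDiff ℝ ∞ u) :
    pd (1, 0) (profile u) = profile (pd et u) := by
  funext p; rw [pd_profile hu]; simp [profile]

lemma pd_snd_profile {u : ℝ × E4 → ℝ} (hu : ContDiff ℝ ∞ u) :
    pd (0, 1) (profile u) = profile (pd (es 0) u) := by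
  funext p; rw [pd_profile hu]; simp [profile]

section Radial

variable {u : ℝ × E4 → ℝ}

lemma profile_norm (hr : ∀ t, NormInvariant fun x => u (t, x)) (t : ℝ) (x : E4) :
    profile u (t, ‖x‖) = u (t, x) :=
  hr t _ _ (norm_smul_axis (norm_nonneg x))

lemma norm_rotation {j : Fin 4} (hj : j ≠ 0) {r : ℝ} (hr0 : 0 ≤ r) (a : ℝ) :
    ‖(r * Real.cos a) • axis + (r * Real.sin a) • EuclideanSpace.single j (1 : ℝ)‖ = r := by
  rw [← sq_eq_sq₀ (norm_nonneg _) hr0, norm_add_sq_real]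
  have : inner ℝ axis (EuclideanSpace.single j (1 : ℝ)) = 0 := by
    simp [EuclideanSpace.inner_single_left, hj.symm]
  rw [inner_smul_left, inner_smul_right, this]
  simp only [norm_smul, mul_pow, Real.norm_eq_abs, sq_abs, PiLp.norm_single, norm_one]
  nlinarith [Real.sin_sq_add_cos_sq a]

/-- A radial function is constant on circles in the plane of the axes 0 and j, so its angular
derivative vanishes identically there. -/
lemma rotation_deriv (hu : ContDiff ℝ ∞ u) (hr : ∀ t, NormInvariant fun x => u (t, x)) (t : ℝ)
    {j : Fin 4} (hj : j ≠ 0) {r : ℝ} (hr0 : 0 ≤ r) (a : ℝ) :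
    HasDerivAt (fun a => (((t, (r * Real.cos a) • axis +
        (r * Real.sin a) • EuclideanSpace.single j (1 : ℝ)) : ℝ × E4)))
      ((-(r * Real.sin a)) • es 0 + (r * Real.cos a) • es j) a ∧
    -(r * Real.sin a) * pd (es 0) u (t, (r * Real.cos a) • axis +
        (r * Real.sin a) • EuclideanSpace.single j (1 : ℝ)) +
      r * Real.cos a * pd (es j) u (t, (r * Real.cos a) • axis +
        (r * Real.sin a) • EuclideanSpace.single j (1 : ℝ)) = 0 := by
  have h1 : HasDerivAt (fun a => (((t, (r * Real.cos a) • axis +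
        (r * Real.sin a) • EuclideanSpace.single j (1 : ℝ)) : ℝ × E4)))
      ((-(r * Real.sin a)) • es 0 + (r * Real.cos a) • es j) a := by
    have := (hasDerivAt_const a t).prodMk
      ((((Real.hasDerivAt_cos a).const_mul r).smul_const axis).add
        (((Real.hasDerivAt_sin a).const_mul r).smul_const (EuclideanSpace.single j (1 : ℝ))))
    refine this.congr_deriv ?_
    ext <;> simp
  refine ⟨h1, ?_⟩
  have h2 := hasDerivAt_comp_curve hu h1
  rw [pd_add_dir, pd_smul_dir, pd_smul_dir] at h2
  have h3 : (fun a => u (t, (r * Real.cos a) • axis +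
      (r * Real.sin a) • EuclideanSpace.single j (1 : ℝ))) = fun _ => u (t, r • axis) :=
    funext fun a => hr t _ _ (by rw [norm_rotation hj hr0, norm_smul_axis hr0])
  rw [h3] at h2
  exact h2.unique (hasDerivAt_const a _)

/-- The angular identity of `rotation_deriv`, differentiated once more at angle zero. Three such
identities turn the Laplacian on the axis into U_rr + 3 U_r / r without polar coordinates. -/
lemma mul_pd_pd_es (hu : ContDiff ℝ ∞ u) (hr : ∀ t, NormInvariant fun x => u (t, x)) (t : ℝ)
    {j : Fin 4} (hj : j ≠ 0) {r : ℝ} (hr0 : 0 < r) :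
    r * pd (es j) (pd (es j) u) (t, r • axis) = pd (es 0) u (t, r • axis) := by
  have h1 := (rotation_deriv hu hr t hj hr0.le 0).1
  have hA := hasDerivAt_comp_curve (contDiff_pd hu (es 0)) h1
  have hB := hasDerivAt_comp_curve (contDiff_pd hu (es j)) h1
  have h2 := (((Real.hasDerivAt_sin 0).const_mul r).neg.mul hA).add
    (((Real.hasDerivAt_cos 0).const_mul r).mul hB)
  have h3 : ((-fun a => r * Real.sin a) * fun a => pd (es 0) u (t, (r * Real.cos a) • axis +
        (r * Real.sin a) • EuclideanSpace.single j (1 : ℝ))) +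
      ((fun a => r * Real.cos a) * fun a => pd (es j) u (t, (r * Real.cos a) • axis +
        (r * Real.sin a) • EuclideanSpace.single j (1 : ℝ))) = fun _ => 0 :=
    funext fun a => (rotation_deriv hu hr t hj hr0.le a).2
  rw [h3] at h2
  have h4 := h2.unique (hasDerivAt_const 0 (0 : ℝ))
  rw [pd_add_dir, pd_smul_dir, pd_smul_dir, pd_add_dir, pd_smul_dir, pd_smul_dir] at h4
  simp only [Pi.neg_apply, Real.sin_zero, Real.cos_zero, mul_one, mul_zero, neg_zero, zero_mul,
    zero_smul, add_zero, zero_add] at h4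
  have h5 : r * (r * pd (es j) (pd (es j) u) (t, r • axis) - pd (es 0) u (t, r • axis)) = 0 := by
    linarith
  rcases mul_eq_zero.1 h5 with h | h
  · exact absurd h hr0.ne'
  · linarith

/-- The profile of a smooth radial wave solves the radial wave equation. -/
theorem IsSmoothWave.isRadialWave (hu : IsSmoothWave u) (hr : ∀ t, NormInvariant fun x => u (t, x))
    (h0 : ∀ x, pd et u (0, x) = 0) {M : ℝ} (hs : ∀ t x, 0 ≤ t → t + M ≤ ‖x‖ → u (t, x) = 0)
    (hM : 0 ≤ M) : IsRadialWave M (profile u) where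
  smooth := contDiff_profile hu.smooth
  wave t r hr0 := by
    have hsm := hu.smooth
    rw [pd_fst_profile hsm, pd_fst_profile (contDiff_pd hsm _), pd_snd_profile hsm,
      pd_snd_profile (contDiff_pd hsm _)]
    simp only [profile]
    rw [hu.wave, Fin.sum_univ_four]
    have h1 := mul_pd_pd_es hsm hr t (j := 1) (by decide) hr0
    have h2 := mul_pd_pd_es hsm hr t (j := 2) (by decide) hr0
    have h3 := mul_pd_pd_es hsm hr t (j := 3) (by decide) hr0
    linarith
  init r _ := by rw [pd_fst_profile hu.smooth]; exact h0 _
  supp t r ht htr := hs t _ ht (by rwa [norm_smul_axis (by linarith)])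

lemma pd_et_eq_profile (hu : ContDiff ℝ ∞ u) (hr : ∀ t, NormInvariant fun x => u (t, x)) (t : ℝ)
    (x : E4) : pd et u (t, x) = pd (1, 0) (profile u) (t, ‖x‖) := by
  have h1 := hasDerivAt_comp_curve hu ((hasDerivAt_id t).prodMk (hasDerivAt_const t x))
  have h2 := hasDerivAt_comp_curve (contDiff_profile hu)
    ((hasDerivAt_id t).prodMk (hasDerivAt_const t ‖x‖))
  simp only [id, profile_norm hr] at h1 h2
  exact h1.unique h2

lemma hasGradientAt_norm {x : E4} (hx : x ≠ 0) : HasGradientAt (fun x : E4 => ‖x‖) (‖x‖⁻¹ • x) x := by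
  have h1 : HasFDerivAt (fun x : E4 => ‖x‖ ^ 2) (2 • innerSL ℝ x) x := by
    simpa using (hasFDerivAt_id x).norm_sq
  have hx0 := norm_ne_zero_iff.2 hx
  have h2 := h1.sqrt (by positivity)
  simp only [Real.sqrt_sq (norm_nonneg _)] at h2
  rw [hasGradientAt_iff_hasFDerivAt]
  convert! h2 using 1
  ext v
  simp
  field_simp

lemma gradient_eq_profile (hu : ContDiff ℝ ∞ u) (hr : ∀ t, NormInvariant fun x => u (t, x)) (t : ℝ)
    {x : E4} (hx : x ≠ 0) : gradient (fun x => u (t, x)) x =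
      (pd (0, 1) (profile u) (t, ‖x‖) * ‖x‖⁻¹) • x := by
  have h1 : HasDerivAt (fun r => profile u (t, r)) (pd (0, 1) (profile u) (t, ‖x‖)) ‖x‖ :=
    hasDerivAt_comp_curve (contDiff_profile hu)
      ((hasDerivAt_const ‖x‖ t).prodMk (hasDerivAt_id ‖x‖))
  have h2 := h1.comp_hasFDerivAt x (hasGradientAt_norm hx).hasFDerivAt
  have h3 : HasGradientAt (fun x => u (t, x))
      ((pd (0, 1) (profile u) (t, ‖x‖) * ‖x‖⁻¹) • x) x := by
    rw [hasGradientAt_iff_hasFDerivAt]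
    have e : ((fun r => profile u (t, r)) ∘ fun x : E4 => ‖x‖) = fun x => u (t, x) :=
      funext fun x => profile_norm hr t x
    rw [← e]
    refine h2.congr_fderiv ?_
    ext v
    simp
    ring
  exact h3.gradient

lemma norm_gradient_eq_profile (hu : ContDiff ℝ ∞ u) (hr : ∀ t, NormInvariant fun x => u (t, x))
    (t : ℝ) {x : E4} (hx : x ≠ 0) :
    ‖gradient (fun x => u (t, x)) x‖ = ‖pd (0, 1) (profile u) (t, ‖x‖)‖ := by
  have := norm_ne_zero_iff.2 hx
  rw [gradient_eq_profile hu hr t hx, norm_smul, norm_mul, norm_inv, norm_norm]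
  field_simp

/-- Polar coordinates and the shift η = r - t bring the exterior norms at all times to the fixed
interval [R, M]. -/
lemma lintegral_ext_eq_ofReal {V : Type*} [NormedAddCommGroup V] {R M t : ℝ} (hR : 0 < R)
    (hM : R ≤ M) (ht : 0 ≤ t) {h : ℝ → ℝ} (hc : Continuous h) (hz : ∀ r, t + M ≤ r → h r = 0)
    {f : E4 → V} (hf : ∀ᵐ x ∂volume.restrict (ext (t + R)), ‖f x‖ = ‖h ‖x‖‖) :
    ∫⁻ x in ext (t + R), ‖f x‖ₑ ^ 2 =
      ENNReal.ofReal (sphereArea * ∫ η in R..M, (η + t) ^ 3 * h (η + t) ^ 2) := by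
  have h1 : ∫⁻ x in ext (t + R), ‖f x‖ₑ ^ 2 =
      ∫⁻ x in ext (t + R), ENNReal.ofReal (h ‖x‖ ^ 2) := by
    refine lintegral_congr_ae ?_
    filter_upwards [hf] with x hx
    rw [← ofReal_norm, hx, ← ENNReal.ofReal_pow (norm_nonneg _), Real.norm_eq_abs, sq_abs]
  have hdisj : Disjoint (Set.Ioc (t + R) (t + M)) (Set.Ioi (t + M)) :=
    Set.disjoint_left.2 fun r h1 h2 => absurd h1.2 (not_le.2 h2)
  have hun : Set.Ioc (t + R) (t + M) ∪ Set.Ioi (t + M) = Set.Ioi (t + R) :=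
    Set.Ioc_union_Ioi_eq_Ioi (by linarith)
  have hi1 : IntegrableOn (fun r => r ^ 3 * h r ^ 2) (Set.Ioc (t + R) (t + M)) :=
    (Continuous.integrableOn_Icc (by fun_prop)).mono_set Set.Ioc_subset_Icc_self
  have hz2 : Set.EqOn (fun r => r ^ 3 * h r ^ 2) (fun _ => 0) (Set.Ioi (t + M)) := fun r hr => by
    simp [hz r (le_of_lt hr)]
  have hi2 : IntegrableOn (fun r => r ^ 3 * h r ^ 2) (Set.Ioi (t + M)) :=
    (integrableOn_congr_fun hz2 measurableSet_Ioi).2 integrableOn_zero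
  have hi : IntegrableOn (fun r => r ^ 3 * h r ^ 2) (Set.Ioi (t + R)) := by
    rw [← hun]; exact hi1.union hi2
  have hρ : 0 ≤ t + R := by linarith
  rw [h1, ← ofReal_integral_eq_lintegral_ofReal (integrableOn_ext_norm hi)
    (.of_forall fun x => sq_nonneg _), integral_ext_norm hρ (fun r => h r ^ 2), ← hun,
    setIntegral_union hdisj measurableSet_Ioi hi1 hi2, setIntegral_congr_fun measurableSet_Ioi hz2]
  rw [integral_zero, add_zero, ← intervalIntegral.integral_of_le (by linarith),
    intervalIntegral.integral_comp_add_right (fun r => r ^ 3 * h r ^ 2), add_comm R, add_comm M]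

lemma gradNormSq_eq_profile (hu : IsSmoothWave u) (hr : ∀ t, NormInvariant fun x => u (t, x))
    {M : ℝ} (hw : IsRadialWave M (profile u)) {R : ℝ} (hR : 0 < R) (hM : R ≤ M) {t : ℝ}
    (ht : 0 ≤ t) : gradNormSq (t + R) (fun x => u (t, x)) = ENNReal.ofReal
      (sphereArea * ∫ η in R..M, (η + t) ^ 3 * pd (0, 1) (profile u) (t, η + t) ^ 2) := by
  have hsm := hu.smooth
  have hc := (contDiff_pd hw.smooth (0, 1)).continuous
  refine lintegral_ext_eq_ofReal hR hM ht (h := fun r => pd (0, 1) (profile u) (t, r))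
    (by fun_prop) (fun r hrM => hw.pd_snd_eq_zero ht hrM) ?_
  have hg := isWeakGrad_gradient (f := fun x => u (t, x)) (isOpen_ext (t + R))
    (by fun_prop)
  filter_upwards [hg.weakGrad_ae_eq (isOpen_ext _), ae_restrict_mem (isOpen_ext (t + R)).measurableSet]
    with x hx hxe
  rw [hx]
  have : 0 < ‖x‖ := lt_trans (by linarith) hxe
  exact norm_gradient_eq_profile hsm hr t (norm_pos_iff.1 this)

lemma timeDerivNormSq_eq_profile (hu : IsSmoothWave u)
    (hr : ∀ t, NormInvariant fun x => u (t, x)) {M : ℝ} (hw : IsRadialWave M (profile u)) {R : ℝ}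
    (hR : 0 < R) (hM : R ≤ M) {t : ℝ} (ht : 0 ≤ t) :
    timeDerivNormSq (t + R) (fun t x => u (t, x)) t = ENNReal.ofReal
      (sphereArea * ∫ η in R..M, (η + t) ^ 3 * pd (1, 0) (profile u) (t, η + t) ^ 2) := by
  have hc := (contDiff_pd hw.smooth (1, 0)).continuous
  refine lintegral_ext_eq_ofReal hR hM ht (h := fun r => pd (1, 0) (profile u) (t, r))
    (by fun_prop) (fun r hrM => hw.pd_fst_eq_zero ht hrM) ?_
  have hg := isTimeDeriv_pd hu.smooth (ext (t + R)) t
  filter_upwards [hg.timeDeriv_ae_eq (isOpen_ext _)] with x hx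
  rw [hx, pd_et_eq_profile hu.smooth hr]

end Radial

/-! ### The gradient of 1/r² and the orthogonal projection. -/

/-- The gradient of `1 / r²`. -/
def gradInvSq (x : E4) : E4 := (-2 * (‖x‖ ^ 4)⁻¹) • x

lemma hasGradientAt_invSq {x : E4} (hx : x ≠ 0) : HasGradientAt invSq (gradInvSq x) x := by
  have h0 := norm_ne_zero_iff.2 hx
  have h1 : HasDerivAt (fun r : ℝ => 1 / r ^ 2) (-2 * (‖x‖ ^ 3)⁻¹) ‖x‖ := by
    have := ((hasDerivAt_pow 2 ‖x‖).inv (pow_ne_zero 2 h0))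
    simp only [one_div]
    refine this.congr_deriv ?_
    simp
    field_simp
  have h2 := h1.comp_hasFDerivAt x (hasGradientAt_norm hx).hasFDerivAt
  rw [hasGradientAt_iff_hasFDerivAt]
  refine h2.congr_fderiv ?_
  ext v
  simp [gradInvSq]
  field_simp

lemma norm_gradInvSq (x : E4) : ‖gradInvSq x‖ = ‖2 * (‖x‖ ^ 3)⁻¹‖ := by
  rcases eq_or_ne x 0 with rfl | hx
  · simp [gradInvSq]
  · have h0 := norm_ne_zero_iff.2 hx
    rw [gradInvSq, norm_smul, norm_mul, norm_mul]
    simp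
    field_simp

lemma contDiffOn_invSq {R : ℝ} (hR : 0 ≤ R) : ContDiffOn ℝ ∞ invSq (ext R) := by
  have h1 : ContDiff ℝ ∞ fun x : E4 => ‖x‖ ^ 2 := contDiff_norm_sq ℝ
  refine contDiffOn_const.div h1.contDiffOn fun x hx => ?_
  have : 0 < ‖x‖ := hR.trans_lt hx
  positivity

lemma isWeakGrad_invSq {R : ℝ} (hR : 0 ≤ R) : IsWeakGrad (ext R) invSq gradInvSq := by
  have h := isWeakGrad_gradient (isOpen_ext R) (contDiffOn_invSq hR)
  have e : ∀ x ∈ ext R, gradient invSq x = gradInvSq x := fun x hx =>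
    (hasGradientAt_invSq (norm_pos_iff.1 (hR.trans_lt hx))).gradient
  refine ⟨h.locInt_fun, ?_, fun φ hφ => ?_⟩
  · intro x hx
    obtain ⟨s, hs, hi⟩ := h.locInt_grad x hx
    refine ⟨s ∩ ext R, Filter.inter_mem hs self_mem_nhdsWithin, ?_⟩
    refine ((hi.mono_set Set.inter_subset_left).congr ?_)
    have hm : ∀ᵐ y ∂volume.restrict (s ∩ ext R), y ∈ ext R := by
      refine ae_mono (Measure.restrict_mono Set.inter_subset_right le_rfl) ?_
      exact ae_restrict_mem (isOpen_ext R).measurableSet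
    filter_upwards [hm] with y hy using e y hy
  · rw [h.integral_eq φ hφ]
    congr 1
    refine integral_congr_ae (.of_forall fun x => ?_)
    by_cases hx : x ∈ ext R
    · simp only [e x hx]
    · simp [image_eq_zero_of_notMem_tsupport fun h => hx (hφ.supp h)]

lemma integral_ext_norm_of_support {R M : ℝ} (hR : 0 ≤ R) (hM : R ≤ M) {h : ℝ → ℝ}
    (hz : ∀ r, M ≤ r → h r = 0) :
    ∫ x in ext R, h ‖x‖ = sphereArea * ∫ r in R..M, r ^ 3 * h r := by
  rw [integral_ext_norm hR, intervalIntegral.integral_of_le hM]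
  congr 1
  refine (setIntegral_eq_of_subset_of_forall_sdiff_eq_zero measurableSet_Ioi
    Set.Ioc_subset_Ioi_self fun r hr => ?_)
  have : M ≤ r := by
    by_contra hlt
    exact hr.2 ⟨hr.1, (not_le.1 hlt).le⟩
  simp [hz r this]

lemma integral_norm_gradInvSq {R : ℝ} (hR : 0 < R) :
    IntegrableOn (fun x : E4 => (2 * (‖x‖ ^ 3)⁻¹) ^ 2) (ext R) ∧
    ∫ x in ext R, (2 * (‖x‖ ^ 3)⁻¹) ^ 2 = sphereArea * (2 / R ^ 2) := by
  have e : Set.EqOn (fun r : ℝ => r ^ 3 * (2 * (r ^ 3)⁻¹) ^ 2) (fun r => 4 * r ^ (-3 : ℝ))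
      (Set.Ioi R) := fun r hr => by
    have hr0 : 0 < r := hR.trans hr
    simp only
    rw [Real.rpow_neg hr0.le, show (3 : ℝ) = ((3 : ℕ) : ℝ) by norm_num, Real.rpow_natCast]
    field_simp
    norm_num
  have hi : IntegrableOn (fun r : ℝ => 4 * r ^ (-3 : ℝ)) (Set.Ioi R) :=
    (integrableOn_Ioi_rpow_of_lt (by norm_num) hR).const_mul 4
  refine ⟨integrableOn_ext_norm (h := fun r => (2 * (r ^ 3)⁻¹) ^ 2)
    ((integrableOn_congr_fun e measurableSet_Ioi).2 hi), ?_⟩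
  rw [integral_ext_norm hR.le (fun r => (2 * (r ^ 3)⁻¹) ^ 2),
    setIntegral_congr_fun measurableSet_Ioi e, integral_const_mul,
    integral_Ioi_rpow_of_lt (by norm_num) hR]
  congr 1
  rw [show (-3 : ℝ) + 1 = -((2 : ℕ) : ℝ) by norm_num, Real.rpow_neg hR.le, Real.rpow_natCast]
  field_simp
  norm_num

lemma aestronglyMeasurable_gradInvSq (R : ℝ) :
    AEStronglyMeasurable gradInvSq (volume.restrict (ext R)) := by
  have : Measurable gradInvSq := by unfold gradInvSq; fun_prop
  exact this.aestronglyMeasurable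

lemma memLp_gradInvSq {R : ℝ} (hR : 0 < R) : MemLp gradInvSq 2 (volume.restrict (ext R)) := by
  rw [memLp_two_iff_integrable_sq_norm (aestronglyMeasurable_gradInvSq R)]
  refine (integral_norm_gradInvSq hR).1.congr (.of_forall fun x => ?_)
  simp only [norm_gradInvSq]
  rw [Real.norm_eq_abs, sq_abs]

section Projection

variable {R : ℝ}

/-- Vector fields in `L²(|x| > R)`. -/
abbrev ExtField (R : ℝ) : Type := Lp E4 2 (volume.restrict (ext R))

lemma inner_toLp {a b : E4 → E4} (ha : MemLp a 2 (volume.restrict (ext R)))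
    (hb : MemLp b 2 (volume.restrict (ext R))) :
    inner ℝ (ha.toLp a : ExtField R) (hb.toLp b) = ∫ x in ext R, inner ℝ (a x) (b x) := by
  rw [L2.inner_def]
  refine integral_congr_ae ?_
  filter_upwards [ha.coeFn_toLp, hb.coeFn_toLp] with x h1 h2
  rw [h1, h2]

/-- The gradient of `1 / r²` as an element of `L²(|x| > R)`. -/
def fieldInvSq (hR : 0 < R) : ExtField R := (memLp_gradInvSq hR).toLp gradInvSq

lemma inner_fieldInvSq (hR : 0 < R) :
    inner ℝ (fieldInvSq hR) (fieldInvSq hR) = sphereArea * (2 / R ^ 2) := by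
  rw [fieldInvSq, inner_toLp, ← (integral_norm_gradInvSq hR).2]
  refine integral_congr_ae (.of_forall fun x => ?_)
  simp only [real_inner_self_eq_norm_sq, norm_gradInvSq]
  rw [Real.norm_eq_abs, sq_abs]

/-- The orthogonal projection parallel to the gradient of `1 / r²`. -/
def fieldPerp (hR : 0 < R) (X : ExtField R) : ExtField R :=
  X - (inner ℝ X (fieldInvSq hR) / inner ℝ (fieldInvSq hR) (fieldInvSq hR)) • fieldInvSq hR

lemma continuous_fieldPerp (hR : 0 < R) : Continuous (fieldPerp hR) := by
  unfold fieldPerp; fun_prop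

lemma norm_fieldPerp_sq (hR : 0 < R) (X : ExtField R) :
    ‖fieldPerp hR X‖ ^ 2 = inner ℝ X X - inner ℝ X (fieldInvSq hR) ^ 2 /
      inner ℝ (fieldInvSq hR) (fieldInvSq hR) := by
  have h0 : inner ℝ (fieldInvSq hR) (fieldInvSq hR) ≠ 0 := by
    rw [inner_fieldInvSq]
    have := sphereArea_pos
    positivity
  rw [fieldPerp, ← real_inner_self_eq_norm_sq, inner_sub_left, inner_sub_right, inner_sub_right,
    inner_smul_left, inner_smul_right, inner_smul_left, inner_smul_right,
    real_inner_comm X (fieldInvSq hR)]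
  simp only [conj_trivial]
  field_simp
  ring

lemma gradNormSq_eq_of_isWeakGrad {f : E4 → ℝ} {D : E4 → E4} (h : IsWeakGrad (ext R) f D) :
    gradNormSq R f = eLpNorm D 2 (volume.restrict (ext R)) ^ 2 := by
  rw [eLpNorm_two_sq]
  refine lintegral_congr_ae ?_
  filter_upwards [h.weakGrad_ae_eq (isOpen_ext R)] with x hx
  rw [hx]

/-- Passing to gradients as elements of L²(|x| > R) makes the projection a continuous map of a
Hilbert space, which is what the final limit needs. -/
lemma gradNormSq_projPerp (hR : 0 < R) {f : E4 → ℝ} {D : E4 → E4} (h : IsWeakGrad (ext R) f D)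
    (hD : MemLp D 2 (volume.restrict (ext R))) :
    gradNormSq R (projPerp R f) = ENNReal.ofReal (‖fieldPerp hR (hD.toLp D)‖ ^ 2) := by
  have hi := isWeakGrad_invSq hR.le
  have e1 := h.weakGrad_ae_eq (isOpen_ext R)
  have e2 := hi.weakGrad_ae_eq (isOpen_ext R)
  have i1 : innerHDot1 R f invSq = inner ℝ (hD.toLp D : ExtField R) (fieldInvSq hR) := by
    rw [fieldInvSq, inner_toLp]
    refine integral_congr_ae ?_
    filter_upwards [e1, e2] with x h1 h2
    rw [h1, h2]
  have i2 : innerHDot1 R invSq invSq = inner ℝ (fieldInvSq hR) (fieldInvSq hR) := by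
    rw [fieldInvSq, inner_toLp]
    refine integral_congr_ae ?_
    filter_upwards [e2] with x h2
    rw [h2]
  set c := innerHDot1 R f invSq / innerHDot1 R invSq invSq with hc
  have hp : IsWeakGrad (ext R) (projPerp R f) fun x => D x - c • gradInvSq x :=
    h.sub (hi.const_mul c)
  rw [gradNormSq_eq_of_isWeakGrad hp, fieldPerp, ← i1, ← i2, ← hc, fieldInvSq,
    ← MemLp.toLp_const_smul, ← MemLp.toLp_sub, Lp.norm_toLp,
    ENNReal.ofReal_pow ENNReal.toReal_nonneg, ENNReal.ofReal_toReal]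
  · rfl
  · exact (hD.sub ((memLp_gradInvSq hR).const_smul c)).2.ne

end Projection

/-! ### The estimate for radial test data. -/

section TestData

variable {g : E4 → ℝ}

/-- The Fourier transform of a test function. -/
def testFourier (hg : ContDiff ℝ ∞ g) (hc : HasCompactSupport g) : 𝓢(E4, ℂ) :=
  𝓕 ((hc.comp_left Complex.ofReal_zero : HasCompactSupport fun x => (g x : ℂ)).toSchwartzMap
    (Complex.ofRealCLM.contDiff.comp hg))

variable (hg : ContDiff ℝ ∞ g) (hc : HasCompactSupport g)

lemma normInvariant_testFourier (hr : NormInvariant g) : NormInvariant (testFourier hg hc) := by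
  have h : NormInvariant fun x => (g x : ℂ) := fun x y hxy => by simp only [hr x y hxy]
  exact h.fourier

/-- A radial function is even, so the Fourier transform is its own inverse on it. -/
lemma fourier_testFourier (hr : NormInvariant g) (x : E4) :
    𝓕 (testFourier hg hc : E4 → ℂ) x = (g x : ℂ) := by
  have h1 : 𝓕 (testFourier hg hc : E4 → ℂ) x = 𝓕⁻ (testFourier hg hc : 𝓢(E4, ℂ)) (-x) := by
    rw [SchwartzMap.fourierInv_coe, Real.fourierInv_eq_fourier_neg, neg_neg]
  rw [h1, testFourier, FourierTransform.fourierInv_fourier_eq]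
  change ((g (-x) : ℝ) : ℂ) = _
  rw [hr.neg]

lemma repOn_testFourier (hr : NormInvariant g) (Ω : Set E4) : RepOn Ω g (testFourier hg hc) := by
  have := repOn_fourier (testFourier hg hc).integrable
    (fun x => by rw [fourier_testFourier hg hc hr, Complex.ofReal_im])
    (fun x => by rw [fourier_testFourier hg hc hr, fourier_testFourier hg hc hr, hr.neg]) Ω
  simpa only [fourier_testFourier hg hc hr, Complex.ofReal_re] using this

/-- The free wave with radial test data. -/
def testWave (p : ℝ × E4) : ℝ := (cosWave (testFourier hg hc) p).re

lemma isSmoothWave_testWave : IsSmoothWave (testWave hg hc) :=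
  isSmoothWave_cosWave Complex.reCLM (SchwartzMap.rapidDecay _)

lemma normInvariant_cosWave (hr : NormInvariant g) (t : ℝ) :
    NormInvariant fun x => cosWave (testFourier hg hc) (t, x) := by
  rw [cosWave_eq (SchwartzMap.rapidDecay _).integrable]
  refine NormInvariant.fourier fun x y hxy => ?_
  rw [hxy, normInvariant_testFourier hg hc hr x y hxy]

/-- The imaginary part is a smooth wave with zero data, hence zero by finite speed of propagation.
-/
lemma im_cosWave_testFourier (hr : NormInvariant g) {t : ℝ} (ht : 0 ≤ t) (x : E4) :
    (cosWave (testFourier hg hc) (t, x)).im = 0 := by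
  have hR := SchwartzMap.rapidDecay (testFourier hg hc)
  refine (isSmoothWave_cosWave Complex.imCLM hR).eq_zero_of_ball (x₀ := x) (ρ := t + 1)
    (fun y _ => ?_) (fun y _ => pd_et_cosWave_zero _ hR y) ht (by linarith)
  have := congrFun (cosWave_eq hR.integrable 0) y
  simp only [zero_mul, Real.cos_zero, Complex.ofReal_one, one_mul] at this
  rw [this]
  change (𝓕 (testFourier hg hc : E4 → ℂ) y).im = 0
  rw [fourier_testFourier hg hc hr, Complex.ofReal_im]

lemma testWave_zero (hr : NormInvariant g) (x : E4) : testWave hg hc (0, x) = g x := by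
  have := congrFun (cosWave_eq (SchwartzMap.rapidDecay (testFourier hg hc)).integrable 0) x
  simp only [zero_mul, Real.cos_zero, Complex.ofReal_one, one_mul] at this
  rw [testWave, this, fourier_testFourier hg hc hr, Complex.ofReal_re]

lemma normInvariant_testWave (hr : NormInvariant g) (t : ℝ) :
    NormInvariant fun x => testWave hg hc (t, x) := fun x y hxy =>
  congrArg Complex.re (normInvariant_cosWave hg hc hr t x y hxy)

lemma extRep_testWave (hr : NormInvariant g) (R : ℝ) :
    ExtRep R (fun t x => testWave hg hc (t, x)) (testFourier hg hc) := by
  refine ⟨fun t ht => ?_⟩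
  have hR := SchwartzMap.rapidDecay (testFourier hg hc)
  have e := cosWave_eq hR.integrable t
  have hi : Integrable fun ξ => (Real.cos (t * (2 * Real.pi * ‖ξ‖)) : ℂ) * testFourier hg hc ξ :=
    hR.integrable.mono (Continuous.aestronglyMeasurable
      (by have := (testFourier hg hc).continuous; fun_prop)) (.of_forall fun ξ => by
        rw [norm_mul]
        exact mul_le_of_le_one_left (norm_nonneg _) (norm_cos_le t ξ))
  have := repOn_fourier hi (fun x => ?_) (fun x => ?_) (ext (t + R))
  · rw [← e] at this
    exact this
  · rw [← e]; exact im_cosWave_testFourier hg hc hr ht x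
  · rw [← e]; exact (normInvariant_cosWave hg hc hr t).neg x

lemma memLp_freq_schwartz (θ : 𝓢(E4, ℂ)) : MemLp (freq θ) 2 volume := by
  refine memLp_freq ?_
  have h : (fun ξ : E4 => (‖ξ‖ : ℂ) * θ ξ) = fun ξ => (‖ξ‖ : ℂ) * θ ξ := rfl
  refine (memLp_two_iff_integrable_sq_norm (Continuous.aestronglyMeasurable
    (by have := θ.continuous; fun_prop))).2 ?_
  obtain ⟨C, hC⟩ := θ.decay 0 0
  have hC' : ∀ x, ‖θ x‖ ≤ C := fun x => by simpa using hC.2 x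
  refine ((θ.integrable_pow_mul volume 2).mul_const C).mono' (Continuous.aestronglyMeasurable
    (by have := θ.continuous; fun_prop)) (.of_forall fun ξ => ?_)
  rw [norm_mul, Complex.norm_real, norm_norm, norm_pow, norm_mul, norm_norm, norm_norm, mul_pow,
    sq ‖θ ξ‖, ← mul_assoc]
  gcongr
  exact hC' ξ

lemma exists_isRadialWave (hr : NormInvariant g) :
    ∃ M₀ : ℝ, ∀ M, M₀ ≤ M → IsRadialWave M (profile (testWave hg hc)) := by
  obtain ⟨M₀, hM₀⟩ := hc.isCompact.isBounded.subset_closedBall (0 : E4)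
  have hR := SchwartzMap.rapidDecay (testFourier hg hc)
  refine ⟨max (M₀ + 1) 0, fun M hM => ?_⟩
  refine (isSmoothWave_testWave hg hc).isRadialWave (normInvariant_testWave hg hc hr)
    (fun x => pd_et_cosWave_zero Complex.reCLM hR x) (fun t x ht hx => ?_)
    ((le_max_right _ _).trans hM)
  · have h1 := (le_max_left (M₀ + 1) 0).trans hM
    rw [testWave, cosWave_eq_zero_of_ball hR (x₀ := x) (ρ := t + 1) (fun y hy => ?_) ht
      (by linarith), Complex.zero_re]
    rw [fourier_testFourier hg hc hr, image_eq_zero_of_notMem_tsupport (f := g), Complex.ofReal_zero]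
    intro hys
    have h2 : ‖y‖ ≤ M₀ := by simpa using hM₀ hys
    have h3 : ‖x‖ ≤ ‖y‖ + ‖y - x‖ := by
      calc ‖x‖ = ‖y - (y - x)‖ := by abel_nf
        _ ≤ _ := norm_sub_le _ _
    have h4 : ‖y - x‖ < t + 1 := by simpa [dist_eq_norm] using hy
    linarith

/-- The equality of the weighted integrals of the derivative, by integration by parts. -/
lemma integral_source_sq {M R : ℝ} {U : ℝ × ℝ → ℝ} (h : IsRadialWave M U) :
    ∫ η in R..M, η * IsRadialWave.source U (0, η) ^ 2 =
      (∫ r in R..M, r ^ 3 * pd (0, 1) U (0, r) ^ 2) - 2 * R ^ 2 * U (0, R) ^ 2 := by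
  have c2 := contDiff_pd h.smooth (0, 1)
  have c2' := c2.continuous
  have c0 := h.smooth.continuous
  -- Expanding r (r U_r + 2 U)², all terms except r³ U_r² form the derivative of 2 r² U².
  have hd : ∀ r, HasDerivAt (fun r => 2 * r ^ 2 * U (0, r) ^ 2)
      (4 * r * U (0, r) ^ 2 + 4 * r ^ 2 * U (0, r) * pd (0, 1) U (0, r)) r := by
    intro r
    have h1 : HasDerivAt (fun r => U (0, r)) (pd (0, 1) U (0, r)) r :=
      hasDerivAt_comp_curve h.smooth ((hasDerivAt_const r (0 : ℝ)).prodMk (hasDerivAt_id r))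
    have := ((hasDerivAt_pow 2 r).const_mul 2).mul (h1.pow 2)
    refine this.congr_deriv ?_
    simp
    ring
  have hi := intervalIntegral.integral_eq_sub_of_hasDerivAt (a := R) (b := M) (fun r _ => hd r)
    (Continuous.intervalIntegrable (by fun_prop) _ _)
  have e : ∀ η, η * IsRadialWave.source U (0, η) ^ 2 = η ^ 3 * pd (0, 1) U (0, η) ^ 2 +
      (4 * η * U (0, η) ^ 2 + 4 * η ^ 2 * U (0, η) * pd (0, 1) U (0, η)) := fun η => by
    simp only [IsRadialWave.source]; ring
  simp_rw [e]
  rw [intervalIntegral.integral_add (Continuous.intervalIntegrable (by fun_prop) _ _)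
    (Continuous.intervalIntegrable (by fun_prop) _ _), hi, h.supp 0 M le_rfl (by simp)]
  ring

/-- With A the area of the sphere, the squared norm of ∇g is A ∫ r³ U_r², its product with ∇(1/r²)
is 2 A U(0, R), and the squared norm of ∇(1/r²) is 2 A / R². Pythagoras leaves A (∫ r³ U_r² - 2 R²
U(0, R)²), the value found in `integral_source_sq`. -/
lemma gradNormSq_projPerp_test (hr : NormInvariant g) {R M : ℝ} (hR : 0 < R) (hM : R ≤ M)
    (h : IsRadialWave M (profile (testWave hg hc))) :
    gradNormSq R (projPerp R g) = ENNReal.ofReal (sphereArea *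
      ∫ η in R..M, η * IsRadialWave.source (profile (testWave hg hc)) (0, η) ^ 2) := by
  set U := profile (testWave hg hc) with hU
  have hsm := (isSmoothWave_testWave hg hc).smooth
  have hNI := normInvariant_testWave hg hc hr
  have e0 : (fun x => testWave hg hc (0, x)) = g := funext fun x => testWave_zero hg hc hr x
  have c2 := (contDiff_pd h.smooth (0, 1)).continuous
  have hw := isWeakGrad_gradient (isOpen_ext R) hg.contDiffOn
  have hgc : Continuous (gradient g) := by
    rw [← continuousOn_univ]
    exact continuous_gradient_iff fun j => (contDiff_pd hg _).continuous.continuousOn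
  have hgs : HasCompactSupport (gradient g) := by
    refine hc.mono' fun x hx => ?_
    by_contra hxs
    apply hx
    have : fderiv ℝ g x = 0 := by
      have := (notMem_tsupport_iff_eventuallyEq.1 hxs).fderiv_eq (𝕜 := ℝ)
      simpa using this
    simp [gradient, this]
  have hD : MemLp (gradient g) 2 (volume.restrict (ext R)) :=
    (hgc.memLp_of_hasCompactSupport hgs).restrict _
  have hgrad : ∀ x ∈ ext R, gradient g x = (pd (0, 1) U (0, ‖x‖) * ‖x‖⁻¹) • x := fun x hx => by
    rw [← e0]
    exact gradient_eq_profile hsm hNI 0 (norm_pos_iff.1 (hR.trans hx))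
  have i1 : inner ℝ (hD.toLp (gradient g) : ExtField R) (hD.toLp (gradient g)) =
      sphereArea * ∫ r in R..M, r ^ 3 * pd (0, 1) U (0, r) ^ 2 := by
    rw [inner_toLp, ← integral_ext_norm_of_support hR.le hM
      (h := fun r => pd (0, 1) U (0, r) ^ 2) fun r hrM => by
        rw [h.pd_snd_eq_zero le_rfl (by simpa using hrM)]; simp]
    refine setIntegral_congr_fun (isOpen_ext R).measurableSet fun x hx => ?_
    have hx0 : ‖x‖ ≠ 0 := (hR.trans hx).ne'
    simp only [hgrad x hx, inner_smul_left, inner_smul_right, real_inner_self_eq_norm_sq,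
      conj_trivial]
    field_simp
  have i2 : inner ℝ (hD.toLp (gradient g) : ExtField R) (fieldInvSq hR) =
      sphereArea * (2 * U (0, R)) := by
    have hz : ∫ r in R..M, r ^ 3 * (-2 * (r ^ 3)⁻¹ * pd (0, 1) U (0, r)) = 2 * U (0, R) := by
      have e : ∫ r in R..M, r ^ 3 * (-2 * (r ^ 3)⁻¹ * pd (0, 1) U (0, r)) =
          ∫ r in R..M, -2 * pd (0, 1) U (0, r) := by
        refine intervalIntegral.integral_congr fun r hr' => ?_
        rw [Set.uIcc_of_le hM] at hr'
        have : r ≠ 0 := (hR.trans_le hr'.1).ne'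
        field_simp
      rw [e, intervalIntegral.integral_const_mul,
        intervalIntegral.integral_eq_sub_of_hasDerivAt (f := fun r => U (0, r)) (fun r _ =>
          hasDerivAt_comp_curve h.smooth ((hasDerivAt_const r (0 : ℝ)).prodMk (hasDerivAt_id r)))
          (Continuous.intervalIntegrable (by fun_prop) _ _), h.supp 0 M le_rfl (by simp)]
      ring
    rw [fieldInvSq, inner_toLp, ← hz, ← integral_ext_norm_of_support hR.le hM
      (h := fun r => -2 * (r ^ 3)⁻¹ * pd (0, 1) U (0, r)) fun r hrM => by
        rw [h.pd_snd_eq_zero le_rfl (by simpa using hrM)]; simp]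
    refine setIntegral_congr_fun (isOpen_ext R).measurableSet fun x hx => ?_
    have hx0 : ‖x‖ ≠ 0 := (hR.trans hx).ne'
    simp only [hgrad x hx, gradInvSq, inner_smul_left, inner_smul_right,
      real_inner_self_eq_norm_sq, conj_trivial]
    field_simp
  rw [gradNormSq_projPerp hR hw hD, norm_fieldPerp_sq, i1, i2, inner_fieldInvSq,
    integral_source_sq h]
  congr 1
  have := sphereArea_pos.ne'
  field_simp

/-- The exterior energy estimate for radial test data. -/
theorem exists_limit_testWave (hr : NormInvariant g) {R : ℝ} (hR : 0 < R) : ∃ ℓ : ℝ,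
    Tendsto (fun t => gradNormSq (t + R) (fun x => testWave hg hc (t, x))) atTop
      (𝓝 (ENNReal.ofReal ℓ)) ∧
    Tendsto (fun t => timeDerivNormSq (t + R) (fun t x => testWave hg hc (t, x)) t) atTop
      (𝓝 (ENNReal.ofReal ℓ)) ∧
    (3 / 20 : ℝ≥0∞) * gradNormSq R (projPerp R g) ≤ ENNReal.ofReal ℓ := by
  obtain ⟨M₀, hM₀⟩ := exists_isRadialWave hg hc hr
  set M := max M₀ R with hM
  have h := hM₀ M (le_max_left _ _)
  have hRM : R ≤ M := le_max_right _ _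
  obtain ⟨ℓ, h1, h2, h3⟩ := h.exists_tendsto hR hRM
  have hsm := isSmoothWave_testWave hg hc
  have hNI := normInvariant_testWave hg hc hr
  refine ⟨sphereArea * ℓ, ?_, ?_, ?_⟩
  · refine (ENNReal.tendsto_ofReal (h1.const_mul sphereArea)).congr' ?_
    filter_upwards [eventually_ge_atTop 0] with t ht
    exact (gradNormSq_eq_profile hsm hNI h hR hRM ht).symm
  · refine (ENNReal.tendsto_ofReal (h2.const_mul sphereArea)).congr' ?_
    filter_upwards [eventually_ge_atTop 0] with t ht
    exact (timeDerivNormSq_eq_profile hsm hNI h hR hRM ht).symm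
  · rw [gradNormSq_projPerp_test hg hc hr hR hRM h]
    have e : (3 / 20 : ℝ≥0∞) = ENNReal.ofReal (3 / 20) := by
      rw [ENNReal.ofReal_div_of_pos (by norm_num)]
      norm_num
    rw [e, ← ENNReal.ofReal_mul (by norm_num)]
    refine ENNReal.ofReal_le_ofReal ?_
    calc 3 / 20 * (sphereArea * _) = sphereArea * (3 / 20 * _) := by ring
      _ ≤ _ := mul_le_mul_of_nonneg_left h3 sphereArea_pos.le

end TestData

/-! ### Density of radial test functions: truncation. -/

/-- Dominated convergence in `L²`. -/
lemma tendsto_eLpNorm_two_of_dominated {V W : Type*} [NormedAddCommGroup V] [NormedAddCommGroup W]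
    {a : ℕ → E4 → V} {G : E4 → W} (hG : MemLp G 2 volume)
    (ha : ∀ n, AEStronglyMeasurable (a n) volume) (hle : ∀ n x, ‖a n x‖ ≤ 2 * ‖G x‖)
    (hlim : ∀ᵐ x, Tendsto (fun n => ‖a n x‖) atTop (𝓝 0)) :
    Tendsto (fun n => eLpNorm (a n) 2 volume) atTop (𝓝 0) := by
  have h1 : Tendsto (fun n => ∫⁻ x, ‖a n x‖ₑ ^ 2) atTop (𝓝 (∫⁻ _ : E4, 0)) := by
    refine tendsto_lintegral_of_dominated_convergence' (fun x => 4 * ‖G x‖ₑ ^ 2)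
      (fun n => (ha n).enorm.pow_const 2) (fun n => .of_forall fun x => ?_) ?_ ?_
    · have : ‖a n x‖ₑ ≤ 2 * ‖G x‖ₑ := by
        simp only [← ofReal_norm]
        rw [show (2 : ℝ≥0∞) = ENNReal.ofReal 2 by simp, ← ENNReal.ofReal_mul (by norm_num)]
        exact ENNReal.ofReal_le_ofReal (hle n x)
      calc ‖a n x‖ₑ ^ 2 ≤ (2 * ‖G x‖ₑ) ^ 2 := by gcongr
        _ = 4 * ‖G x‖ₑ ^ 2 := by rw [mul_pow]; norm_num
    · rw [lintegral_const_mul' _ _ (by norm_num), ← eLpNorm_two_sq]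
      exact ENNReal.mul_ne_top (by norm_num) (ENNReal.pow_ne_top hG.2.ne)
    · filter_upwards [hlim] with x hx
      have h2 := ENNReal.tendsto_ofReal (hx.pow 2)
      simp only [ENNReal.ofReal_pow (norm_nonneg _), ofReal_norm] at h2
      simpa using h2
  rw [lintegral_zero] at h1
  have h2 := h1.ennrpow_const (1 / 2 : ℝ)
  rw [ENNReal.zero_rpow_of_pos (by norm_num)] at h2
  refine h2.congr fun n => ?_
  rw [← eLpNorm_two_sq, ← ENNReal.rpow_natCast, ← ENNReal.rpow_mul]
  norm_num

/-- A smooth cutoff on the line. -/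
def cutoff (n : ℕ) (s : ℝ) : ℝ := Real.smoothTransition (n + 2 - s)

lemma contDiff_cutoff (n : ℕ) : ContDiff ℝ ∞ (cutoff n) :=
  Real.smoothTransition.contDiff.comp (by fun_prop)

lemma cutoff_of_le {n : ℕ} {s : ℝ} (h : s ≤ n + 1) : cutoff n s = 1 :=
  Real.smoothTransition.one_of_one_le (by linarith)

lemma cutoff_of_ge {n : ℕ} {s : ℝ} (h : n + 2 ≤ s) : cutoff n s = 0 :=
  Real.smoothTransition.zero_of_nonpos (by linarith)

/-- The primitive of a function, cut off at infinity. -/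
def cutPrimitive (h : ℝ → ℝ) (n : ℕ) (r : ℝ) : ℝ := ∫ s in (n + 2 : ℝ)..r, cutoff n s * h s

lemma hasDerivAt_cutPrimitive {h : ℝ → ℝ} (hh : Continuous h) (n : ℕ) (r : ℝ) :
    HasDerivAt (cutPrimitive h n) (cutoff n r * h r) r := by
  have hc : Continuous fun s => cutoff n s * h s := (contDiff_cutoff n).continuous.mul hh
  exact intervalIntegral.integral_hasDerivAt_right (hc.intervalIntegrable _ _)
    (hc.stronglyMeasurableAtFilter _ _) hc.continuousAt

lemma contDiff_cutPrimitive {h : ℝ → ℝ} (hh : ContDiff ℝ ∞ h) (n : ℕ) :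
    ContDiff ℝ ∞ (cutPrimitive h n) := by
  have hd := hasDerivAt_cutPrimitive hh.continuous n
  refine contDiff_infty_iff_deriv.2 ⟨fun r => (hd r).differentiableAt, ?_⟩
  rw [show deriv (cutPrimitive h n) = fun r => cutoff n r * h r from funext fun r => (hd r).deriv]
  exact (contDiff_cutoff n).mul hh

lemma cutPrimitive_of_ge (h : ℝ → ℝ) {n : ℕ} {r : ℝ} (hr : n + 2 ≤ r) : cutPrimitive h n r = 0 := by
  rw [cutPrimitive, intervalIntegral.integral_congr (g := fun _ => 0),
    intervalIntegral.integral_zero]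
  intro s hs
  rw [Set.uIcc_of_le hr] at hs
  simp [cutoff_of_ge hs.1]

lemma cutPrimitive_of_le {h : ℝ → ℝ} (hh : ContDiff ℝ ∞ h) {n : ℕ} {r : ℝ} (hr : r ≤ n + 1) :
    cutPrimitive (deriv h) n r = h r + (cutPrimitive (deriv h) n (n + 1) - h (n + 1)) := by
  have hc' : Continuous (deriv h) := hh.continuous_deriv (by simp)
  have hc : Continuous fun s => cutoff n s * deriv h s := (contDiff_cutoff n).continuous.mul hc'
  have h1 : cutPrimitive (deriv h) n (n + 1) - cutPrimitive (deriv h) n r =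
      ∫ s in r..(n + 1 : ℝ), cutoff n s * deriv h s := by
    unfold cutPrimitive
    exact intervalIntegral.integral_interval_sub_left (hc.intervalIntegrable _ _)
      (hc.intervalIntegrable _ _)
  have h2 : ∫ s in r..(n + 1 : ℝ), cutoff n s * deriv h s = ∫ s in r..(n + 1 : ℝ), deriv h s := by
    refine intervalIntegral.integral_congr fun s hs => ?_
    rw [Set.uIcc_of_le hr] at hs
    simp [cutoff_of_le hs.2]
  rw [intervalIntegral.integral_deriv_eq_sub (fun s _ => hh.differentiable (by simp) s)
    (hc'.intervalIntegrable _ _)] at h2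
  linarith

section Truncation

variable {f : E4 → ℝ}

/-- The truncation of a radial function obtained by cutting its gradient off. -/
def truncation (f : E4 → ℝ) (n : ℕ) (x : E4) : ℝ :=
  cutPrimitive (deriv fun s : ℝ => f (s • axis)) n ‖x‖

lemma normInvariant_truncation (n : ℕ) : NormInvariant (truncation f n) := fun x y hxy => by
  rw [truncation, truncation, hxy]

lemma contDiff_along_axis (hf : ContDiff ℝ ∞ f) : ContDiff ℝ ∞ fun s : ℝ => f (s • axis) := by
  fun_prop

/-- Away from the origin the norm is smooth; near it the cutoff is 1, and the truncation is f plus a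
constant. -/
lemma contDiff_truncation (hf : ContDiff ℝ ∞ f) (hr : NormInvariant f) (n : ℕ) :
    ContDiff ℝ ∞ (truncation f n) := by
  have hh := contDiff_along_axis hf
  have hh' : ContDiff ℝ ∞ (deriv fun s : ℝ => f (s • axis)) := (contDiff_infty_iff_deriv.1 hh).2
  refine contDiff_iff_contDiffAt.2 fun x => ?_
  rcases eq_or_ne x 0 with rfl | hx
  · have e : truncation f n =ᶠ[𝓝 0] fun x => f x +
        (cutPrimitive (deriv fun s : ℝ => f (s • axis)) n (n + 1) - f (((n : ℝ) + 1) • axis)) := by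
      filter_upwards [Metric.ball_mem_nhds (0 : E4) one_pos] with y hy
      have hy1 : ‖y‖ < 1 := by simpa using hy
      have hy2 : ‖y‖ ≤ n + 1 := by
        have : (0 : ℝ) ≤ n := Nat.cast_nonneg n
        linarith
      rw [truncation, cutPrimitive_of_le hh hy2, hr y _ (norm_smul_axis (norm_nonneg y)).symm]
    exact (hf.contDiffAt.add contDiffAt_const).congr_of_eventuallyEq e
  · exact (contDiff_cutPrimitive hh' n).contDiffAt.comp x (contDiffAt_norm ℝ hx)

lemma hasCompactSupport_truncation (n : ℕ) : HasCompactSupport (truncation f n) :=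
  HasCompactSupport.intro (isCompact_closedBall (0 : E4) (n + 2)) fun x hx =>
    cutPrimitive_of_ge _ (by simpa using (not_le.1 (by simpa using hx)).le)

/-- The reason for cutting off the derivative and not f: no derivative falls on the cutoff, so no
Hardy inequality is needed for convergence in energy. -/
lemma gradient_truncation (hf : ContDiff ℝ ∞ f) (hr : NormInvariant f) (n : ℕ) {x : E4}
    (hx : x ≠ 0) : gradient (truncation f n) x = cutoff n ‖x‖ • gradient f x := by
  have hh := contDiff_along_axis hf
  have h1 := (hh.differentiable (by simp) ‖x‖).hasDerivAt
  have h2 := hasDerivAt_cutPrimitive (hh.continuous_deriv (by simp)) n ‖x‖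
  have hn := (hasGradientAt_norm hx).hasFDerivAt
  have e : (fun x : E4 => f (‖x‖ • axis)) = f :=
    funext fun x => hr _ _ (norm_smul_axis (norm_nonneg x))
  have h3 := h1.comp_hasFDerivAt x hn
  have h4 := h2.comp_hasFDerivAt x hn
  rw [show (fun s : ℝ => f (s • axis)) ∘ (fun x : E4 => ‖x‖) = f from e] at h3
  rw [gradient, gradient, h3.fderiv,
    show truncation f n = cutPrimitive (deriv fun s : ℝ => f (s • axis)) n ∘ fun x => ‖x‖ from rfl,
    h4.fderiv, mul_smul, map_smul]

/-- Density of radial test functions among smooth radial functions of finite energy. -/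
theorem exists_test_near_of_smooth {F : E4 → ℂ} (hf : ContDiff ℝ ∞ f) (hr : NormInvariant f)
    (h : RepOn Set.univ f F) (hF : MemLp (freq F) 2 volume) {δ : ℝ≥0∞} (hδ : 0 < δ) :
    ∃ (g : E4 → ℝ) (hg : ContDiff ℝ ∞ g) (hc : HasCompactSupport g), NormInvariant g ∧
      eLpNorm (freq fun ξ => F ξ - testFourier hg hc ξ) 2 volume < δ := by
  have hgrad := isWeakGrad_gradient isOpen_univ hf.contDiffOn
  have hgc : Continuous (gradient f) := by
    rw [← continuousOn_univ]
    exact continuous_gradient_iff fun j => (contDiff_pd hf _).continuous.continuousOn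
  have hG : MemLp (gradient f) 2 volume :=
    ⟨hgc.aestronglyMeasurable, by rw [← h.eLpNorm_freq hF hgrad]; exact hF.2⟩
  have hne : ∀ᵐ x : E4, x ≠ 0 := by simp [ae_iff]
  have hcut : ∀ n s, 0 ≤ 1 - cutoff n s ∧ 1 - cutoff n s ≤ 1 := fun n s =>
    ⟨sub_nonneg.2 (Real.smoothTransition.le_one _),
      sub_le_self _ (Real.smoothTransition.nonneg _)⟩
  have hlim : Tendsto (fun n => eLpNorm (fun x => (1 - cutoff n ‖x‖) • gradient f x) 2 volume)
      atTop (𝓝 0) := by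
    refine tendsto_eLpNorm_two_of_dominated hG (fun n => Continuous.aestronglyMeasurable ?_)
      (fun n x => ?_) (.of_forall fun x => ?_)
    · have := (contDiff_cutoff n).continuous
      fun_prop
    · rw [norm_smul, Real.norm_of_nonneg (hcut n _).1]
      exact mul_le_mul_of_nonneg_right ((hcut n _).2.trans one_le_two) (norm_nonneg _)
    · refine tendsto_const_nhds.congr' ?_
      obtain ⟨N, hN⟩ := exists_nat_ge ‖x‖
      filter_upwards [eventually_ge_atTop N] with n hn
      have : (N : ℝ) ≤ n := by exact_mod_cast hn
      rw [cutoff_of_le (by linarith), sub_self, zero_smul, norm_zero]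
  obtain ⟨n, hn⟩ := (hlim.eventually (gt_mem_nhds hδ)).exists
  have hg := contDiff_truncation hf hr n
  have hc := hasCompactSupport_truncation (f := f) n
  have hri := normInvariant_truncation (f := f) n
  refine ⟨truncation f n, hg, hc, hri, ?_⟩
  have hrep := repOn_testFourier hg hc hri Set.univ
  have hF' : MemLp (freq fun ξ => F ξ - testFourier hg hc ξ) 2 volume := by
    refine (hF.sub (memLp_freq_schwartz (testFourier hg hc))).ae_eq (.of_forall fun ξ => ?_)
    simp [freq, mul_sub]
  -- Plancherel's theorem turns the distance on the Fourier side into the L² norm of (1 - cutoff)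
  -- ∇f.
  rw [(h.sub hrep).eLpNorm_freq hF' (hgrad.sub (isWeakGrad_gradient isOpen_univ hg.contDiffOn))]
  refine lt_of_le_of_lt (le_of_eq (eLpNorm_congr_ae ?_)) hn
  filter_upwards [hne] with x hx
  rw [gradient_truncation hf hr n hx, sub_smul, one_smul]

end Truncation

/-! ### Density of radial test functions: mollification. -/

section Mollification

variable {g ρ : E4 → ℝ} {F : E4 → ℂ}

/-- A translate of a radial test function, on the Fourier side. -/
lemma exists_fourier_translate (hρ : ContDiff ℝ ∞ ρ) (hc : HasCompactSupport ρ)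
    (hr : NormInvariant ρ) (x : E4) : ∃ θ : 𝓢(E4, ℂ),
    (∀ y, 𝓕 θ y = (ρ (y + x) : ℂ)) ∧
    ∀ ξ, θ ξ = Real.fourierChar (-inner ℝ ξ x) • testFourier hρ hc ξ := by
  have hc' : HasCompactSupport fun y => ρ (y + x) := hc.comp_homeomorph (Homeomorph.addRight x)
  have hρ' : ContDiff ℝ ∞ fun y => ρ (y + x) := hρ.comp (contDiff_id.add contDiff_const)
  obtain ⟨θ, hθ⟩ := (IsTest.mk hρ' hc' (Set.subset_univ _)).exists_fourier_eq
  refine ⟨θ, hθ, fun ξ => ?_⟩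
  have h1 : θ ξ = ∫ y, Real.fourierChar (inner ℝ y ξ) • (ρ (y + x) : ℂ) := by
    have e : 𝓕⁻ (𝓕 θ : 𝓢(E4, ℂ)) = θ := FourierTransform.fourierInv_fourier_eq θ
    rw [← congrArg (fun η : 𝓢(E4, ℂ) => η ξ) e, SchwartzMap.fourierInv_coe, Real.fourierInv_eq]
    simp only [hθ]
  have h2 : testFourier hρ hc ξ = ∫ y, Real.fourierChar (inner ℝ y ξ) • (ρ y : ℂ) := by
    rw [← normInvariant_testFourier hρ hc hr |>.neg ξ, testFourier, SchwartzMap.fourier_coe,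
      Real.fourier_eq]
    simp only [inner_neg_right, neg_neg]
    rfl
  rw [h1, h2, Circle.smul_def, smul_eq_mul, ← integral_const_mul, ← integral_add_right_eq_self
    (fun y => (Real.fourierChar (-inner ℝ ξ x) : ℂ) * Real.fourierChar (inner ℝ y ξ) • (ρ y : ℂ)) x]
  refine integral_congr_ae (.of_forall fun y => ?_)
  change _ = Real.fourierChar (-inner ℝ ξ x) • Real.fourierChar (inner ℝ (y + x) ξ) •
    (ρ (y + x) : ℂ)
  rw [smul_smul, ← AddChar.map_add_eq_mul, inner_add_left, real_inner_comm ξ x]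
  ring_nf

lemma hasTemperateGrowth_one_add_sq (k : ℕ) :
    (fun ξ : E4 => (((1 + ‖ξ‖ ^ 2) ^ k : ℝ) : ℂ)).HasTemperateGrowth := by
  fun_prop

/-- F may be integrated against (1 + ‖ξ‖²)^k θ, which is again Schwartz, and this controls every
moment. Mollified functions are therefore smooth. -/
lemma HasFourier.rapidDecay_mul (h : HasFourier g F) (hF : MemLp (freq F) 2 volume)
    (θ : 𝓢(E4, ℂ)) : RapidDecay fun ξ => F ξ * θ ξ := by
  have hm := (aestronglyMeasurable_of_freq hF.1).mul (θ.continuous.aestronglyMeasurable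
    (μ := volume))
  refine ⟨hm, fun k => ?_⟩
  have ht := hasTemperateGrowth_one_add_sq k
  refine (h.integrable_right (SchwartzMap.smulLeftCLM ℂ
    (fun ξ : E4 => (((1 + ‖ξ‖ ^ 2) ^ k : ℝ) : ℂ)) θ)).norm.mono'
    ((continuous_norm.pow k).aestronglyMeasurable.mul hm.norm) (.of_forall fun ξ => ?_)
  rw [SchwartzMap.smulLeftCLM_apply_apply ht]
  simp only [norm_mul, norm_pow, norm_norm, smul_eq_mul, Complex.norm_real]
  have : ‖ξ‖ ^ k ≤ ‖1 + ‖ξ‖ ^ 2‖ ^ k := by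
    rw [Real.norm_of_nonneg (by positivity)]
    gcongr
    nlinarith [sq_nonneg (‖ξ‖ - 1)]
  calc ‖ξ‖ ^ k * (‖F ξ‖ * ‖θ ξ‖) ≤ ‖1 + ‖ξ‖ ^ 2‖ ^ k * (‖F ξ‖ * ‖θ ξ‖) := by gcongr
    _ = _ := by ring

/-- Mollification of a function is multiplication of its Fourier transform. -/
lemma HasFourier.fourier_mul (h : HasFourier g F) (hρ : ContDiff ℝ ∞ ρ)
    (hc : HasCompactSupport ρ) (hr : NormInvariant ρ) (x : E4) :
    𝓕 (fun ξ => F ξ * testFourier hρ hc ξ) x = ((∫ y, g y * ρ (y + x) : ℝ) : ℂ) := by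
  obtain ⟨θ, h1, h2⟩ := exists_fourier_translate hρ hc hr x
  have h3 := h.integral_eq θ
  rw [← integral_complex_ofReal, Real.fourier_eq]
  refine Eq.trans ?_ (h3.symm.trans ?_)
  · refine integral_congr_ae (.of_forall fun ξ => ?_)
    simp only [h2, mul_smul_comm]
  · refine integral_congr_ae (.of_forall fun y => ?_)
    simp only [h1, Complex.ofReal_mul]

/-- Isometries preserve Lebesgue measure. As g is radial only almost everywhere, it is first
replaced under the integral by its profile, which gives invariance at every point. -/
lemma normInvariant_mollification (hg : IsRadial g) (hr : NormInvariant ρ) :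
    NormInvariant fun x => ∫ y, g y * ρ (y + x) := by
  obtain ⟨p, hp⟩ := hg
  have e : ∀ x, ∫ y, g y * ρ (y + x) = ∫ y, p ‖y‖ * ρ (y + x) := fun x =>
    integral_congr_ae (by filter_upwards [hp] with y hy; rw [hy])
  refine .of_isometry fun A x => ?_
  simp only [e]
  have := A.measurePreserving.integral_comp A.toHomeomorph.measurableEmbedding
    fun y => p ‖y‖ * ρ (y + A x)
  rw [← this]
  refine integral_congr_ae (.of_forall fun y => ?_)
  simp only [A.norm_map, ← map_add]
  rw [hr _ _ (A.norm_map _)]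

/-- The unnormalized radial mollifiers. -/
def mollifierBump (n : ℕ) (x : E4) : ℝ := Real.smoothTransition (1 - (n + 1) ^ 2 * ‖x‖ ^ 2)

lemma contDiff_mollifierBump (n : ℕ) : ContDiff ℝ ∞ (mollifierBump n) :=
  Real.smoothTransition.contDiff.comp
    (contDiff_const.sub (contDiff_const.mul (contDiff_norm_sq ℝ)))

lemma mollifierBump_nonneg (n : ℕ) (x : E4) : 0 ≤ mollifierBump n x :=
  Real.smoothTransition.nonneg _

lemma mollifierBump_eq_zero {n : ℕ} {x : E4} (h : 1 ≤ (n + 1) * ‖x‖) : mollifierBump n x = 0 := by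
  refine Real.smoothTransition.zero_of_nonpos ?_
  rw [← mul_pow]
  linarith [one_le_pow₀ h (n := 2)]

lemma hasCompactSupport_mollifierBump (n : ℕ) : HasCompactSupport (mollifierBump n) :=
  HasCompactSupport.intro (isCompact_closedBall (0 : E4) 1) fun x hx =>
    mollifierBump_eq_zero (by
      have h1 : 1 < ‖x‖ := by simpa using hx
      have h2 : (0 : ℝ) ≤ n := Nat.cast_nonneg n
      nlinarith)

lemma integral_mollifierBump_pos (n : ℕ) : 0 < ∫ x, mollifierBump n x := by
  refine (contDiff_mollifierBump n).continuous.integral_pos_of_hasCompactSupport_nonneg_nonzero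
    (hasCompactSupport_mollifierBump n) (mollifierBump_nonneg n) (x := 0) ?_
  simp [mollifierBump]

/-- Radial mollifiers of integral one. -/
def mollifier (n : ℕ) (x : E4) : ℝ := (∫ y, mollifierBump n y)⁻¹ * mollifierBump n x

lemma contDiff_mollifier (n : ℕ) : ContDiff ℝ ∞ (mollifier n) :=
  contDiff_const.mul (contDiff_mollifierBump n)

lemma hasCompactSupport_mollifier (n : ℕ) : HasCompactSupport (mollifier n) :=
  (hasCompactSupport_mollifierBump n).mul_left

lemma normInvariant_mollifier (n : ℕ) : NormInvariant (mollifier n) := fun x y hxy => by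
  rw [mollifier, mollifier, mollifierBump, mollifierBump, hxy]

lemma mollifier_nonneg (n : ℕ) (x : E4) : 0 ≤ mollifier n x :=
  mul_nonneg (inv_nonneg.2 (integral_mollifierBump_pos n).le) (mollifierBump_nonneg n x)

lemma integral_mollifier (n : ℕ) : ∫ x, mollifier n x = 1 := by
  unfold mollifier
  rw [integral_const_mul, inv_mul_cancel₀ (integral_mollifierBump_pos n).ne']

lemma integrable_mollifier (n : ℕ) : Integrable (mollifier n) :=
  (contDiff_mollifier n).continuous.integrable_of_hasCompactSupport (hasCompactSupport_mollifier n)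

/-- The multipliers of mollification. -/
def mollifierFourier (n : ℕ) : 𝓢(E4, ℂ) :=
  testFourier (contDiff_mollifier n) (hasCompactSupport_mollifier n)

lemma mollifierFourier_apply (n : ℕ) (ξ : E4) : mollifierFourier n ξ =
    ∫ x, Real.fourierChar (-inner ℝ x ξ) • (mollifier n x : ℂ) := by
  rw [mollifierFourier, testFourier, SchwartzMap.fourier_coe, Real.fourier_eq]
  rfl

lemma norm_mollifierFourier_le (n : ℕ) (ξ : E4) : ‖mollifierFourier n ξ‖ ≤ 1 := by
  rw [mollifierFourier_apply, ← integral_mollifier n]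
  refine (norm_integral_le_integral_norm _).trans_eq (integral_congr_ae (.of_forall fun x => ?_))
  simp [Circle.norm_smul, abs_of_nonneg (mollifier_nonneg n x)]

/-- The mollifier has mass one in the ball of radius 1/(n + 1), and |exp (i s) - 1| ≤ |s|. -/
lemma norm_mollifierFourier_sub_one_le (n : ℕ) (ξ : E4) :
    ‖mollifierFourier n ξ - 1‖ ≤ 2 * Real.pi * ‖ξ‖ / (n + 1) := by
  have h1 : (1 : ℂ) = ∫ x, (mollifier n x : ℂ) := by
    rw [integral_complex_ofReal, integral_mollifier, Complex.ofReal_one]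
  have hi : Integrable fun x => (mollifier n x : ℂ) := (integrable_mollifier n).ofReal
  have hi' : Integrable fun x => Real.fourierChar (-inner ℝ x ξ) • (mollifier n x : ℂ) :=
    (Real.fourierIntegral_convergent_iff ξ).2 hi
  rw [mollifierFourier_apply, h1, ← integral_sub hi' hi]
  have h2 : ∀ x, ‖Real.fourierChar (-inner ℝ x ξ) • (mollifier n x : ℂ) - (mollifier n x : ℂ)‖ ≤
      mollifier n x * (2 * Real.pi * ‖ξ‖ / (n + 1)) := fun x => by
    have e : Real.fourierChar (-inner ℝ x ξ) • (mollifier n x : ℂ) - (mollifier n x : ℂ) =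
        (Complex.exp (Complex.I * ((2 * Real.pi * -inner ℝ x ξ : ℝ) : ℂ)) - 1) *
          (mollifier n x : ℂ) := by
      rw [Circle.smul_def, Real.fourierChar_apply, smul_eq_mul, mul_comm Complex.I]
      ring
    rw [e, norm_mul, Complex.norm_real, Real.norm_of_nonneg (mollifier_nonneg n x), mul_comm]
    by_cases hx : 1 ≤ (n + 1) * ‖x‖
    · rw [mollifier, mollifierBump_eq_zero hx]; simp
    · refine mul_le_mul_of_nonneg_left ?_ (mollifier_nonneg n x)
      refine (Real.norm_exp_I_mul_ofReal_sub_one_le).trans ?_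
      have h3 : ‖x‖ ≤ 1 / (n + 1) := by
        rw [le_div_iff₀ (by positivity), mul_comm]; exact (not_le.1 hx).le
      rw [norm_mul, norm_neg, Real.norm_of_nonneg (by positivity)]
      calc 2 * Real.pi * ‖inner ℝ x ξ‖ ≤ 2 * Real.pi * (‖x‖ * ‖ξ‖) := by
            gcongr; exact norm_inner_le_norm x ξ
        _ ≤ 2 * Real.pi * (1 / (n + 1) * ‖ξ‖) := by gcongr
        _ = _ := by ring
  refine (norm_integral_le_of_norm_le ((integrable_mollifier n).mul_const _)
    (.of_forall h2)).trans_eq ?_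
  rw [integral_mul_const, integral_mollifier, one_mul]

lemma tendsto_mollifierFourier (ξ : E4) :
    Tendsto (fun n => ‖1 - mollifierFourier n ξ‖) atTop (𝓝 0) := by
  refine squeeze_zero (fun n => norm_nonneg _) (fun n => ?_)
    (g := fun n : ℕ => 2 * Real.pi * ‖ξ‖ * (1 / ((n : ℝ) + 1))) ?_
  · rw [norm_sub_rev, mul_one_div]
    exact norm_mollifierFourier_sub_one_le n ξ
  · simpa using (tendsto_one_div_add_atTop_nhds_zero_nat (𝕜 := ℝ)).const_mul (2 * Real.pi * ‖ξ‖)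

/-- Density of radial test functions among radial functions of finite energy. -/
theorem exists_test_near (hg : IsRadial g) (h : HasFourier g F) (hF : MemLp (freq F) 2 volume)
    {δ : ℝ≥0∞} (hδ : 0 < δ) :
    ∃ (f : E4 → ℝ) (hf : ContDiff ℝ ∞ f) (hc : HasCompactSupport f), NormInvariant f ∧
      eLpNorm (freq fun ξ => F ξ - testFourier hf hc ξ) 2 volume < δ := by
  have hFm := aestronglyMeasurable_of_freq hF.1
  have hmc : ∀ n, AEStronglyMeasurable (mollifierFourier n) (volume : Measure E4) := fun n =>
    (mollifierFourier n).continuous.aestronglyMeasurable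
  have hlim : Tendsto (fun n => eLpNorm
      (freq fun ξ => F ξ - F ξ * mollifierFourier n ξ) 2 volume) atTop (𝓝 0) := by
    have e : ∀ n ξ, freq (fun ξ => F ξ - F ξ * mollifierFourier n ξ) ξ =
        (1 - mollifierFourier n ξ) * freq F ξ := fun n ξ => by simp only [freq]; ring
    refine tendsto_eLpNorm_two_of_dominated hF (fun n => ?_) (fun n ξ => ?_)
      (.of_forall fun ξ => ?_)
    · exact ((aestronglyMeasurable_const.sub (hmc n)).mul hF.1).congr
        (.of_forall fun ξ => (e n ξ).symm)
    · rw [e, norm_mul]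
      refine mul_le_mul_of_nonneg_right ?_ (norm_nonneg _)
      calc ‖1 - mollifierFourier n ξ‖ ≤ ‖(1 : ℂ)‖ + ‖mollifierFourier n ξ‖ := norm_sub_le _ _
        _ ≤ 2 := by rw [norm_one]; linarith [norm_mollifierFourier_le n ξ]
    · simp only [e, norm_mul]
      simpa using (tendsto_mollifierFourier ξ).mul_const ‖freq F ξ‖
  obtain ⟨δ', hδ', hδ2⟩ : ∃ δ' : ℝ≥0∞, 0 < δ' ∧ δ' + δ' ≤ δ :=
    ⟨δ / 2, ENNReal.half_pos hδ.ne', (ENNReal.add_halves δ).le⟩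
  obtain ⟨n, hn⟩ := (hlim.eventually (gt_mem_nhds hδ')).exists
  set Fn : E4 → ℂ := fun ξ => F ξ * mollifierFourier n ξ with hFn
  have hrd : RapidDecay Fn := h.rapidDecay_mul hF (mollifierFourier n)
  set f : E4 → ℝ := fun x => ∫ y, g y * mollifier n (y + x) with hf
  have hfe : ∀ x, 𝓕 Fn x = (f x : ℂ) := fun x =>
    h.fourier_mul (contDiff_mollifier n) (hasCompactSupport_mollifier n)
      (normInvariant_mollifier n) x
  have hri : NormInvariant f := normInvariant_mollification hg (normInvariant_mollifier n)
  have hrep : RepOn Set.univ f Fn := by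
    have := repOn_fourier hrd.integrable (fun x => by rw [hfe, Complex.ofReal_im])
      (fun x => by rw [hfe, hfe, hri.neg]) Set.univ
    simpa only [hfe, Complex.ofReal_re] using this
  have hsm : ContDiff ℝ ∞ f := by
    have h1 : ContDiff ℝ ∞ (𝓕 Fn) := Real.contDiff_fourier (N := ⊤) fun k _ => hrd.moment k
    have h2 := Complex.reCLM.contDiff.comp h1
    have e : Complex.reCLM ∘ 𝓕 Fn = f := funext fun x => by simp [hfe]
    rwa [e] at h2
  have hFn2 : MemLp (freq Fn) 2 volume := by
    refine (MemLp.bounded_mul hF (hmc n) (norm_mollifierFourier_le n)).ae_eq (.of_forall fun ξ => ?_)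
    simp only [freq, hFn]; ring
  obtain ⟨f', hf', hc', hri', hlt⟩ := exists_test_near_of_smooth hsm hri hrep hFn2 hδ'
  refine ⟨f', hf', hc', hri', ?_⟩
  have e : freq (fun ξ => F ξ - testFourier hf' hc' ξ) =
      freq (fun ξ => F ξ - Fn ξ) + freq fun ξ => Fn ξ - testFourier hf' hc' ξ := by
    funext ξ; simp only [freq, Pi.add_apply]; ring
  have hmeas : ∀ {a b : E4 → ℂ}, MemLp (freq a) 2 volume → MemLp (freq b) 2 volume →
      AEStronglyMeasurable (freq fun ξ => a ξ - b ξ) volume := fun ha hb =>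
    (ha.sub hb).1.congr (.of_forall fun ξ => by simp [freq, mul_sub])
  rw [e]
  exact (eLpNorm_add_le (hmeas hF hFn2) (hmeas hFn2 (memLp_freq_schwartz _)) one_le_two).trans_lt
    ((ENNReal.add_lt_add hn hlt).trans_le hδ2)

end Mollification

/-! ### Stability under approximation and conclusion. -/

section Approximation

/-- The norms of the weak gradients depend continuously on the functions. -/
lemma RepOn.eLpNorm_sub_le {Ω : Set E4} (hΩ : IsOpen Ω) {f f' : E4 → ℝ} {F F' : E4 → ℂ}
    (h : RepOn Ω f F) (h' : RepOn Ω f' F') (hF : MemLp (freq fun ξ => F ξ - F' ξ) 2 volume)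
    {G G' : E4 → E4} (hG : IsWeakGrad Ω f G) (hG' : IsWeakGrad Ω f' G') :
    eLpNorm (fun x => G x - G' x) 2 (volume.restrict Ω) ≤
      eLpNorm (freq fun ξ => F ξ - F' ξ) 2 volume := by
  obtain ⟨D, h1, -, h2, -⟩ := (h.sub h').exists_isWeakGrad hF
  have h3 := (ae_restrict_iff' hΩ.measurableSet).2 ((hG.sub hG').ae_eq hΩ h1)
  exact (eLpNorm_congr_ae h3).trans_le ((eLpNorm_restrict_le _ _ _ _).trans h2)

lemma HasFourier.repOn {Ω : Set E4} (hΩ : IsOpen Ω) {f g : E4 → ℝ} {F : E4 → ℂ}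
    (hg : HasFourier g F) (h0 : ∀ᵐ x : E4, x ∈ Ω → f x = g x) : RepOn Ω f F := by
  refine ⟨fun x hx => ?_, hg.integrable_right, fun φ θ hφ hθ => ?_⟩
  · obtain ⟨s, hs, hi⟩ := hg.locallyIntegrable.locallyIntegrableOn Ω x hx
    refine ⟨s ∩ Ω, inter_mem hs self_mem_nhdsWithin, ?_⟩
    refine (hi.mono_set Set.inter_subset_left).congr ?_
    refine ae_restrict_of_ae_restrict_of_subset Set.inter_subset_right ?_
    refine (ae_restrict_iff' hΩ.measurableSet).2 ?_
    filter_upwards [h0] with x hx hx' using (hx hx').symm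
  · rw [← hg.integral_eq θ, ← integral_complex_ofReal]
    refine integral_congr_ae ?_
    filter_upwards [h0] with x hx
    by_cases hxt : x ∈ Ω
    · simp [hθ, hx hxt]
    · have : φ x = 0 := image_eq_zero_of_notMem_tsupport fun h => hxt (hφ.supp h)
      simp [hθ, this]

lemma ExtRep.isTimeDeriv_sub {R t : ℝ} {u u' : ℝ → E4 → ℝ} {F F' : E4 → ℂ} (h : ExtRep R u F)
    (h' : ExtRep R u' F') (ht : 0 < t) {w w' : E4 → ℝ} (hw : IsTimeDeriv (ext (t + R)) u t w)
    (hw' : IsTimeDeriv (ext (t + R)) u' t w') :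
    IsTimeDeriv (ext (t + R)) (fun t x => u t x - u' t x) t fun x => w x - w' x := by
  refine ⟨hw.locInt.sub hw'.locInt, fun φ hφ => ?_⟩
  have key : ∀ {Ω : Set E4} {a b : E4 → ℝ}, IsTest Ω φ → LocallyIntegrableOn a Ω →
      LocallyIntegrableOn b Ω → ∫ x, (a x - b x) * φ x = (∫ x, a x * φ x) - ∫ x, b x * φ x := by
    intro Ω a b hφ ha hb
    have e1 := hφ.integrable_smul ha
    have e2 := hφ.integrable_smul hb
    simp only [smul_eq_mul] at e1 e2
    simp only [sub_mul]
    exact integral_sub (by simpa only [mul_comm] using e1) (by simpa only [mul_comm] using e2)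
  rw [key hφ hw.locInt hw'.locInt]
  refine ((hw.hasDerivAt φ hφ).sub (hw'.hasDerivAt φ hφ)).congr_of_eventuallyEq ?_
  filter_upwards [hφ.eventually_ext ht] with s hs
  exact key hs.2 (h.repOn s hs.1).locInt (h'.repOn s hs.1).locInt

lemma abs_sub_toReal_eLpNorm_le {α V : Type*} [MeasurableSpace α] [NormedAddCommGroup V]
    {μ : Measure α} {a b : α → V} (ha : MemLp a 2 μ) (hb : MemLp b 2 μ) {δ : ℝ} (hδ : 0 ≤ δ)
    (h : eLpNorm (fun x => a x - b x) 2 μ ≤ ENNReal.ofReal δ) :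
    |(eLpNorm a 2 μ).toReal - (eLpNorm b 2 μ).toReal| ≤ δ := by
  have h1 := abs_norm_sub_norm_le (ha.toLp a) (hb.toLp b)
  rw [← MemLp.toLp_sub, Lp.norm_toLp, Lp.norm_toLp, Lp.norm_toLp] at h1
  exact h1.trans (ENNReal.toReal_le_of_le_ofReal hδ h)

lemma sqrt_toReal_sq (a : ℝ≥0∞) : √(a ^ 2).toReal = a.toReal := by
  rw [ENNReal.toReal_pow, Real.sqrt_sq ENNReal.toReal_nonneg]

lemma timeDerivNormSq_eq_of_isTimeDeriv {ρ t : ℝ} {u : ℝ → E4 → ℝ} {w : E4 → ℝ}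
    (h : IsTimeDeriv (ext ρ) u t w) :
    timeDerivNormSq ρ u t = eLpNorm w 2 (volume.restrict (ext ρ)) ^ 2 := by
  rw [eLpNorm_two_sq]
  refine lintegral_congr_ae ?_
  filter_upwards [h.timeDeriv_ae_eq (isOpen_ext ρ)] with x hx
  rw [hx]

variable {R t δ : ℝ} {u u' : ℝ → E4 → ℝ} {F F' : E4 → ℂ}

lemma ExtRep.gradNormSq_ne_top (h : ExtRep R u F) (hF : MemLp (freq F) 2 volume) (ht : 0 ≤ t) :
    gradNormSq (t + R) (u t) ≠ ⊤ := by
  obtain ⟨G, h1, h2, -⟩ := h.exists_isWeakGrad hF ht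
  rw [gradNormSq_eq_of_isWeakGrad h1]
  exact ENNReal.pow_ne_top (h2.restrict _).2.ne

lemma ExtRep.timeDerivNormSq_ne_top (h : ExtRep R u F)
    (hi : ∀ θ : 𝓢(E4, ℂ), Integrable fun ξ => F ξ * θ ξ) (hF : MemLp (freq F) 2 volume)
    (ht : 0 < t) : timeDerivNormSq (t + R) u t ≠ ⊤ := by
  obtain ⟨w, h1, h2, -⟩ := h.exists_isTimeDeriv hi hF ht
  rw [timeDerivNormSq_eq_of_isTimeDeriv h1]
  exact ENNReal.pow_ne_top (h2.restrict _).2.ne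

lemma memLp_freq_sub (hF : MemLp (freq F) 2 volume) (hF' : MemLp (freq F') 2 volume) :
    MemLp (freq fun ξ => F ξ - F' ξ) 2 volume :=
  (hF.sub hF').ae_eq (.of_forall fun ξ => by simp [freq, mul_sub])

/-- The square roots are L² norms, and the difference of the two solutions is again represented on
the Fourier side. Plancherel's bound for it does not depend on t, which makes the approximation
uniform in time. -/
lemma ExtRep.abs_sqrt_gradNormSq_sub_le (h : ExtRep R u F) (h' : ExtRep R u' F')
    (hF : MemLp (freq F) 2 volume) (hF' : MemLp (freq F') 2 volume) (hδ : 0 ≤ δ)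
    (hle : eLpNorm (freq fun ξ => F ξ - F' ξ) 2 volume ≤ ENNReal.ofReal δ) (ht : 0 ≤ t) :
    |√(gradNormSq (t + R) (u t)).toReal - √(gradNormSq (t + R) (u' t)).toReal| ≤ δ := by
  obtain ⟨G, h1, h2, -⟩ := h.exists_isWeakGrad hF ht
  obtain ⟨G', h1', h2', -⟩ := h'.exists_isWeakGrad hF' ht
  obtain ⟨D, h3, -, h4⟩ := (h.sub h').exists_isWeakGrad (memLp_freq_sub hF hF') ht
  have h5 := (ae_restrict_iff' (isOpen_ext _).measurableSet).2
    ((h1.sub h1').ae_eq (isOpen_ext _) h3)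
  rw [gradNormSq_eq_of_isWeakGrad h1, gradNormSq_eq_of_isWeakGrad h1', sqrt_toReal_sq,
    sqrt_toReal_sq]
  exact abs_sub_toReal_eLpNorm_le (h2.restrict _) (h2'.restrict _) hδ
    ((eLpNorm_congr_ae h5).trans_le ((eLpNorm_restrict_le _ _ _ _).trans (h4.trans hle)))

lemma ExtRep.abs_sqrt_timeDerivNormSq_sub_le (h : ExtRep R u F) (h' : ExtRep R u' F')
    (hi : ∀ θ : 𝓢(E4, ℂ), Integrable fun ξ => F ξ * θ ξ)
    (hi' : ∀ θ : 𝓢(E4, ℂ), Integrable fun ξ => F' ξ * θ ξ)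
    (hF : MemLp (freq F) 2 volume) (hF' : MemLp (freq F') 2 volume) (hδ : 0 ≤ δ)
    (hle : eLpNorm (freq fun ξ => F ξ - F' ξ) 2 volume ≤ ENNReal.ofReal δ) (ht : 0 < t) :
    |√(timeDerivNormSq (t + R) u t).toReal - √(timeDerivNormSq (t + R) u' t).toReal| ≤ δ := by
  obtain ⟨w, h1, h2, -⟩ := h.exists_isTimeDeriv hi hF ht
  obtain ⟨w', h1', h2', -⟩ := h'.exists_isTimeDeriv hi' hF' ht
  obtain ⟨D, h3, -, h4⟩ := (h.sub h').exists_isTimeDeriv (fun θ => by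
    simpa only [sub_mul] using! (hi θ).sub (hi' θ)) (memLp_freq_sub hF hF') ht
  have h5 := (ae_restrict_iff' (isOpen_ext _).measurableSet).2
    ((h.isTimeDeriv_sub h' ht h1 h1').ae_eq (isOpen_ext _) h3)
  rw [timeDerivNormSq_eq_of_isTimeDeriv h1, timeDerivNormSq_eq_of_isTimeDeriv h1', sqrt_toReal_sq,
    sqrt_toReal_sq]
  exact abs_sub_toReal_eLpNorm_le (h2.restrict _) (h2'.restrict _) hδ
    ((eLpNorm_congr_ae h5).trans_le ((eLpNorm_restrict_le _ _ _ _).trans (h4.trans hle)))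

/-- Exchange of two limits, one of them uniform. -/
lemma exists_tendsto_of_approx {a b : ℝ → ℝ} {an bn : ℕ → ℝ → ℝ} {L : ℕ → ℝ}
    (ha : ∀ n t, 0 < t → |a t - an n t| ≤ 1 / ((n : ℝ) + 1))
    (hb : ∀ n t, 0 < t → |b t - bn n t| ≤ 1 / ((n : ℝ) + 1))
    (han : ∀ n, Tendsto (an n) atTop (𝓝 (L n))) (hbn : ∀ n, Tendsto (bn n) atTop (𝓝 (L n))) :
    ∃ l, Tendsto L atTop (𝓝 l) ∧ Tendsto a atTop (𝓝 l) ∧ Tendsto b atTop (𝓝 l) := by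
  have h0 := tendsto_one_div_add_atTop_nhds_zero_nat (𝕜 := ℝ)
  have hL : CauchySeq L := by
    refine cauchySeq_of_le_tendsto_0 (fun N : ℕ => 1 / ((N : ℝ) + 1) + 1 / ((N : ℝ) + 1))
      (fun n m N hn hm => ?_) (by simpa using h0.add h0)
    refine le_of_tendsto ((han n).dist (han m)) ?_
    filter_upwards [eventually_gt_atTop 0] with t ht
    have e : ∀ k, N ≤ k → dist (an k t) (a t) ≤ 1 / ((N : ℝ) + 1) := fun k hk => by
      rw [dist_comm, Real.dist_eq]
      exact (ha k t ht).trans (Nat.one_div_le_one_div hk)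
    exact (dist_triangle_right _ _ (a t)).trans (add_le_add (e n hn) (e m hm))
  obtain ⟨l, hl⟩ := cauchySeq_tendsto_of_complete hL
  have key : ∀ {c : ℝ → ℝ} {cn : ℕ → ℝ → ℝ},
      (∀ n t, 0 < t → |c t - cn n t| ≤ 1 / ((n : ℝ) + 1)) →
      (∀ n, Tendsto (cn n) atTop (𝓝 (L n))) → Tendsto c atTop (𝓝 l) := by
    intro c cn hc hcn
    refine TendstoUniformlyOnFilter.tendsto_of_eventually_tendsto (F := cn) (p := atTop) ?_
      (.of_forall hcn) hl
    refine Metric.tendstoUniformlyOnFilter_iff.2 fun ε hε => ?_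
    filter_upwards [(h0.eventually (gt_mem_nhds hε)).prod_mk (eventually_gt_atTop (0 : ℝ))] with p hp
    exact (hc _ _ hp.2).trans_lt hp.1
  exact ⟨l, hl, key ha han, key hb hbn⟩

end Approximation

/-- The exterior energy estimate, for a solution of finite energy. -/
theorem exists_limit_of_extRep {R : ℝ} (hR : 0 < R) {u₀ g : E4 → ℝ} {u : ℝ → E4 → ℝ} {F : E4 → ℂ}
    (hg : HasFourier g F) (hgr : IsRadial g) (hF : MemLp (freq F) 2 volume)
    (h0 : ∀ᵐ x : E4, x ∈ ext R → u₀ x = g x) (hu : ExtRep R u F) : ∃ ℓ : ℝ≥0,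
      Tendsto (fun t : ℝ => gradNormSq (t + R) (u t)) atTop (𝓝 (ℓ : ℝ≥0∞)) ∧
      Tendsto (fun t : ℝ => timeDerivNormSq (t + R) u t) atTop (𝓝 (ℓ : ℝ≥0∞)) ∧
      (3 / 20 : ℝ≥0∞) * gradNormSq R (projPerp R u₀) ≤ (ℓ : ℝ≥0∞) := by
  have hpos : ∀ n : ℕ, (0 : ℝ) < 1 / ((n : ℝ) + 1) := fun n => Nat.one_div_pos_of_nat
  choose f hf hc hr hlt using fun n : ℕ =>
    exists_test_near hgr hg hF (ENNReal.ofReal_pos.2 (hpos n))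
  choose ℓ h1 h2 h3 using fun n => exists_limit_testWave (hf n) (hc n) (hr n) hR
  have hE := fun n => extRep_testWave (hf n) (hc n) (hr n) R
  have hT := fun n => memLp_freq_schwartz (testFourier (hf n) (hc n))
  have hTi : ∀ n (θ : 𝓢(E4, ℂ)), Integrable fun ξ => testFourier (hf n) (hc n) ξ * θ ξ :=
    fun n => (repOn_testFourier (hf n) (hc n) (hr n) Set.univ).integrable
  have hsqrt : ∀ {a : ℝ → ℝ≥0∞} {l : ℝ}, Tendsto a atTop (𝓝 (ENNReal.ofReal l)) →
      Tendsto (fun t => √(a t).toReal) atTop (𝓝 √(ENNReal.ofReal l).toReal) := fun h =>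
    ((ENNReal.tendsto_toReal ENNReal.ofReal_ne_top).comp h).sqrt
  obtain ⟨l, hl, ha, hb⟩ := exists_tendsto_of_approx
    (fun n t ht => hu.abs_sqrt_gradNormSq_sub_le (hE n) hF (hT n) (hpos n).le (hlt n).le ht.le)
    (fun n t ht => hu.abs_sqrt_timeDerivNormSq_sub_le (hE n) hg.integrable_right (hTi n) hF (hT n)
      (hpos n).le (hlt n).le ht) (fun n => hsqrt (h1 n)) (fun n => hsqrt (h2 n))
  have hback : ∀ {a : ℝ → ℝ≥0∞}, (∀ t, 0 < t → a t ≠ ⊤) →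
      Tendsto (fun t => √(a t).toReal) atTop (𝓝 l) →
      Tendsto a atTop (𝓝 (ENNReal.ofReal (l ^ 2))) := fun hfin h => by
    refine (ENNReal.tendsto_ofReal (h.pow 2)).congr' ?_
    filter_upwards [eventually_gt_atTop 0] with t ht
    rw [Real.sq_sqrt ENNReal.toReal_nonneg, ENNReal.ofReal_toReal (hfin t ht)]
  refine ⟨(l ^ 2).toNNReal, hback (fun t ht => hu.gradNormSq_ne_top hF ht.le) ha,
    hback (fun t ht => hu.timeDerivNormSq_ne_top hg.integrable_right hF ht) hb, ?_⟩
  have hrep := hg.repOn (isOpen_ext R) h0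
  have hrepn := fun n => repOn_testFourier (hf n) (hc n) (hr n) (ext R)
  obtain ⟨G, hG, hG2, -⟩ := hrep.exists_isWeakGrad hF
  choose Gn hGn hGn2 _ using fun n => (hrepn n).exists_isWeakGrad (hT n)
  have hG2' := hG2.restrict (ext R)
  have hGn2' := fun n => (hGn2 n).restrict (ext R)
  have hlim : Tendsto (fun n => ((hGn2' n).toLp (Gn n) : ExtField R)) atTop
      (𝓝 (hG2'.toLp G)) := by
    refine tendsto_iff_norm_sub_tendsto_zero.2 (squeeze_zero (fun n => norm_nonneg _) (fun n => ?_)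
      (tendsto_one_div_add_atTop_nhds_zero_nat (𝕜 := ℝ)))
    rw [norm_sub_rev, ← MemLp.toLp_sub, Lp.norm_toLp]
    exact ENNReal.toReal_le_of_le_ofReal (hpos n).le
      ((hrep.eLpNorm_sub_le (isOpen_ext R) (hrepn n) (memLp_freq_sub hF (hT n)) hG (hGn n)).trans
        (hlt n).le)
  have h34 : (3 / 20 : ℝ≥0∞) = ENNReal.ofReal (3 / 20) := by
    rw [ENNReal.ofReal_div_of_pos (by norm_num)]
    norm_num
  rw [gradNormSq_projPerp hR hG hG2', h34, ← ENNReal.ofReal_mul (by norm_num)]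
  refine ENNReal.ofReal_le_ofReal ?_
  -- The gradients converge in L²(|x| > R) and the projection is continuous, so the inequality for
  -- test data passes to the limit.
  refine le_of_tendsto_of_tendsto' (((((continuous_fieldPerp hR).tendsto _).comp hlim).norm.pow
    2).const_mul (3 / 20)) (hl.pow 2) fun n => ?_
  have := h3 n
  rw [gradNormSq_projPerp hR (hGn n) (hGn2' n), h34, ← ENNReal.ofReal_mul (by norm_num)] at this
  rw [Real.sq_sqrt ENNReal.toReal_nonneg]
  exact (ENNReal.ofReal_le_iff_le_toReal ENNReal.ofReal_ne_top).1 this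

end ExteriorWave

end

theorem proposition3p2 (R : ℝ) (hR : 0 < R) (u₀ : ExteriorWave.E4 → ℝ)
    (hu₀ : ExteriorWave.MemHDot1Ext R u₀) (u : ℝ → ExteriorWave.E4 → ℝ)
    (hu : ExteriorWave.IsExteriorFreeWave R u₀ (fun _ => 0) u) :
    ∃ ℓ : ℝ≥0,
      Tendsto (fun t : ℝ => ExteriorWave.gradNormSq (t + R) (u t)) atTop (𝓝 (ℓ : ℝ≥0∞)) ∧
      Tendsto (fun t : ℝ => ExteriorWave.timeDerivNormSq (t + R) u t) atTop
        (𝓝 (ℓ : ℝ≥0∞)) ∧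
      (3 / 20 : ℝ≥0∞) * ExteriorWave.gradNormSq R (ExteriorWave.projPerp R u₀) ≤
        (ℓ : ℝ≥0∞) := by
  obtain ⟨g, ⟨F, hgF, hF⟩, hgr, h0⟩ := hu₀
  exact ExteriorWave.exists_limit_of_extRep hR hgF hgr (ExteriorWave.memLp_freq hF) h0
    (hu.extRep hgF h0)
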